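/- Let $q\in L_2(0,\pi)$ be real valued and $h,H\in\mathbb R$. Let $\lambda_0<\lambda_1<\cdots$ be the eigenvalues of $$-y''+q(x)y=\lambda y,\quad 0<x<\pi,\qquad y'(0)-hy(0)=0,\quad y'(\pi)+Hy(\pi)=0,$$ and write $\lambda_n=\rho_n^2$, with $\rho_n\ge 0$ when $\lambda_n\ge 0$. For $\rho\in\mathbb C$ let $\varphi(\rho,x)$ be the solution of $-y''+qy=\rho^2y$ with $\varphi(\rho,0)=1$, $\varphi'(\rho,0)=h$, and let $\alpha_n=\int_0^\pi\varphi^2(\rho_n,x)\,dx$ and $\omega=h+H+\frac12\int_0^\pi q(t)\,dt$. There is a kernel $G$, continuous on $0\le t\le x\le\pi$ and independent of $\rho$, with $$\varphi(\rho,x)=\cos\rho x+\int_0^xG(x,t)\cos\rho t\,dt\qquad(\rho\in\mathbb C,\ 0\le x\le\pi).$$ For every such $G$, the (left) partial derivative $G_x(\pi,t)$ exists for almost every $t\in(0,\pi)$ and belongs to $L_2(0,\pi)$. With $P_m$ the Legendre polynomials, put $$h_k=(4k+1)\int_0^\pi\bigl(G_x(\pi,t)+H\,G(\pi,t)\bigr)P_{2k}(t/\pi)\,dt,\qquad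 k=0,1,2,\dots,$$ and let $j_m(z)=\sqrt{\pi/(2z)}\,J_{m+1/2}(z)$ be the spherical Bessel functions. Consider the flipped problem $$-y''+q(\pi-x)y=\lambda y,\quad 0<x<\pi,\qquad y'(0)-Hy(0)=0,\quad y'(\pi)+hy(\pi)=0.$$ Its eigenvalues are again $\lambda_n$, with eigenfunctions $\varphi(\rho_n,\pi-x)$. Let $\alpha_n^r=\int_0^\pi\psi_n^2(x)\,dx$ be its norming constants, where $\psi_n$ is the solution of $-y''+q(\pi-x)y=\lambda_ny$ with $\psi_n(0)=1$, $\psi_n'(0)=H$. Then, for all $n\ge0$, $\alpha_n>0$, $\varphi(\rho_n,\pi)\neq0$ and $$\alpha_n^r=\frac{\alpha_n}{\varphi^2(\rho_n,\pi)}.$$ Moreover, for every $n$ with $\lambda_n>0$ (in particular for all $n\ge1$ if $\rho_0=0$), $$\alpha_n^r=\frac{\Bigl((1+\pi\omega)\sin\rho_n\pi+\pi\rho_n\cos\rho_n\pi+\sum_{k=0}^\infty(-1)^kh_k\bigl(\pi j_{2k+1}(\rho_n\pi)-\tfrac{2k}{\rho_n}j_{2k}(\rho_n\pi)\bigr)\Bigr)^2}{4\alpha_n\rho_n^2},$$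 where the series converges absolutely, and, if $\rho_0=0$, $$\alpha_0^r=\frac{\bigl(\pi+\omega\frac{\pi^2}{3}+h_1\frac{\pi^2}{15}\bigr)^2}{\alpha_0}.$$ -/

import Mathlib

open Real Set MeasureTheory

noncomputable section

/-- `y` (with derivative `dy`) is a Caratheodory solution of `-y'' + q y = μ y` on `[0, π]`:
`y` is differentiable on `[0, π]` (one-sidedly at the end points) with derivative `dy`, and `dy` is
absolutely continuous with `dy' = (q - μ) y` almost everywhere, that is, `dy` is the indefinite
integral of `(q - μ) y`. -/
structure SLSolution (𝕜 : Type) [RCLike 𝕜] (q : ℝ → ℝ) (μ : 𝕜) (y dy : ℝ → 𝕜) : Prop where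
  hasDeriv : ∀ x ∈ Icc (0 : ℝ) π, HasDerivWithinAt y (dy x) (Icc 0 π) x
  integral_eq : ∀ x ∈ Icc (0 : ℝ) π,
    dy x = dy 0 + ∫ t in (0 : ℝ)..x, ((q t : 𝕜) - μ) * y t

/-- The solution `φ` of `-y'' + q y = μ y` with `φ(0) = 1`, `φ'(0) = h`. -/
structure SLPhi (𝕜 : Type) [RCLike 𝕜] (q : ℝ → ℝ) (h : ℝ) (μ : 𝕜) (y dy : ℝ → 𝕜) : Prop
    extends SLSolution 𝕜 q μ y dy where
  init : y 0 = 1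
  init_deriv : dy 0 = (h : 𝕜)

/-- `y` is an eigenfunction, for the eigenvalue `μ`, of the problem
`-y'' + q y = μ y`, `y'(0) - h y(0) = 0`, `y'(π) + H y(π) = 0`. -/
structure SLEigenfunction (𝕜 : Type) [RCLike 𝕜] (q : ℝ → ℝ) (h H : ℝ) (μ : 𝕜)
    (y dy : ℝ → 𝕜) : Prop extends SLSolution 𝕜 q μ y dy where
  bc_zero : dy 0 - (h : 𝕜) * y 0 = 0
  bc_pi : dy π + (H : 𝕜) * y π = 0
  nontrivial : ∃ x ∈ Icc (0 : ℝ) π, y x ≠ 0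

/-- The set of all (complex) eigenvalues of
`-y'' + q y = μ y`, `y'(0) - h y(0) = 0`, `y'(π) + H y(π) = 0`. -/
def slSpectrum (q : ℝ → ℝ) (h H : ℝ) : Set ℂ :=
  {μ | ∃ y dy : ℝ → ℂ, SLEigenfunction ℂ q h H μ y dy}

/-- The flipped potential `x ↦ q (π - x)`. -/
def slFlip (q : ℝ → ℝ) : ℝ → ℝ := fun x => q (π - x)

/-- The norming constant belonging to a normalized eigenfunction `y`. -/
def slNorming (y : ℝ → ℝ) : ℝ := ∫ x in (0 : ℝ)..π, y x ^ 2

/-- `ω = h + H + (1/2) ∫₀^π q`. -/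
def slOmega (q : ℝ → ℝ) (h H : ℝ) : ℝ := h + H + (1 / 2) * ∫ t in (0 : ℝ)..π, q t

/-- `G` is the transmutation kernel: it is continuous on `0 ≤ t ≤ x ≤ π`, does not depend on `ρ`,
and `φ(ρ, x) = cos ρx + ∫₀^x G(x, t) cos ρt dt` for all complex `ρ`. -/
structure IsTransmutationKernel (q : ℝ → ℝ) (h : ℝ) (G : ℝ → ℝ → ℝ) : Prop where
  continuousOn : ContinuousOn (fun p : ℝ × ℝ => G p.1 p.2) {p | 0 ≤ p.2 ∧ p.2 ≤ p.1 ∧ p.1 ≤ π}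
  transmutes : ∀ (ρ : ℂ) (y dy : ℝ → ℂ), SLPhi ℂ q h (ρ ^ 2) y dy → ∀ x ∈ Icc (0 : ℝ) π,
    y x = Complex.cos (ρ * x) + ∫ t in (0 : ℝ)..x, (G x t : ℂ) * Complex.cos (ρ * t)

/-- The partial derivative `∂G/∂x (x, t)`, taken inside the triangle `0 ≤ t ≤ x ≤ π` (so from the
left at `x = π`). -/
def kernelDx (G : ℝ → ℝ → ℝ) (x t : ℝ) : ℝ := derivWithin (fun s => G s t) (Icc t π) x

/-- The Legendre polynomial `Pₙ` (Rodrigues' formula). -/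
def legendreP (n : ℕ) : Polynomial ℝ :=
  Polynomial.C (1 / (2 ^ n * (n.factorial : ℝ))) *
    (Polynomial.derivative^[n] ((Polynomial.X ^ 2 - 1) ^ n))

/-- The coefficients `gₙ(x)` of `G(x, t) = ∑ (gₙ(x) / x) P₂ₙ(t / x)`. -/
def kernelCoeff (G : ℝ → ℝ → ℝ) (n : ℕ) (x : ℝ) : ℝ :=
  (4 * n + 1) * ∫ t in (0 : ℝ)..x, G x t * (legendreP (2 * n)).eval (t / x)

/-- The coefficients `γₙ(x)` of `∂G/∂x (x, t) = ∑ (γₙ(x) / x) P₂ₙ(t / x)`. -/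
def kernelDxCoeff (G : ℝ → ℝ → ℝ) (n : ℕ) (x : ℝ) : ℝ :=
  (4 * n + 1) * ∫ t in (0 : ℝ)..x, kernelDx G x t * (legendreP (2 * n)).eval (t / x)

/-- `hₙ = γₙ(π) + H gₙ(π)`. -/
def slCoeffH (G : ℝ → ℝ → ℝ) (H : ℝ) (n : ℕ) : ℝ :=
  kernelDxCoeff G n π + H * kernelCoeff G n π

/-- The Bessel function of the first kind `J_ν(x)`, for `x > 0` and `ν > -1`. -/
def besselJ (ν x : ℝ) : ℝ :=
  ∑' m : ℕ, (-1) ^ m / ((m.factorial : ℝ) * Real.Gamma (m + ν + 1)) * (x / 2) ^ (2 * (m : ℝ) + ν)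

/-- The spherical Bessel function `j_k(z) = √(π / (2 z)) J_{k + 1/2}(z)`, for `z > 0`. -/
def sphericalJ (k : ℕ) (z : ℝ) : ℝ := √(π / (2 * z)) * besselJ (k + 1 / 2) z

/-- The terms `(-1)^k h_k (π j_{2k+1}(ρπ) - (2k/ρ) j_{2k}(ρπ))`. -/
def flipTerm (G : ℝ → ℝ → ℝ) (H ρ : ℝ) (k : ℕ) : ℝ :=
  (-1) ^ k * slCoeffH G H k *
    (π * sphericalJ (2 * k + 1) (ρ * π) - 2 * k / ρ * sphericalJ (2 * k) (ρ * π))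

end

/-!
The flipped problem is handled by reflection. If `φ` is the normalized eigenfunction, then
`x ↦ φ(π - x)` solves the flipped problem, so by uniqueness of the Cauchy problem
(`SLSolution.eq_of_init`) `ψ(x) = φ(π - x) / φ(π)`, which gives `α^r = α / φ(π)²`
(`slNorming_flip`). It remains to express `φ(π)` through `α` and the kernel.

*The kernel.* After replacing `q` by its extension by zero, a kernel is obtained as the solution of
the integral equation
`G(x, t) = h + ½ (∫₀^{(x+t)/2} q + ∫₀^{(x-t)/2} q) + ½ ∫ q(s) ∫_{|τ - t| ≤ x - s} G̃(s, τ) dτ ds`,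
where `G̃(s, ·)` is the even extension of `G(s, ·)` from `[0, s]`, cut off outside `[-s, s]`. In a
weighted sup norm with weight `exp(βx)` the integral operator is a contraction
(`exists_exp_weight`, `abs_goursatOp_le`, `exists_goursat_solution`). By Fubini's theorem and the
addition theorem for the cosine, `cos ρx + ∫₀ˣ G(x, t) cos ρt dt` satisfies the Volterra equation
`Z = cos ρx + h sin(ρx)/ρ + ∫₀ˣ sin(ρ(x-s))/ρ q(s) Z(s) ds`, hence equals `φ(ρ, ·)`
(`transmutedCos_volterra`, `SLPhi.of_volterra`). A kernel is unique because the functions `cos ρt`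
separate continuous functions on `[0, x]` (`IsTransmutationKernel.eq`), so everything may be
computed for the one constructed. Differentiating the integral equation at `x = π` gives
`G_x(π, ·)` almost everywhere (`ae_hasDerivWithinAt_goursat`).

*The characteristic function.* Put `F = G_x(π, ·) + H G(π, ·)`. Then
`Δ(ρ) = φ'(ρ, π) + H φ(ρ, π) = -ρ sin ρπ + ω cos ρπ + ∫₀^π F(t) cos ρt dt`
(`exists_slPhi_transmutedCosReal`). Green's formula for the parameters `ρ` and `ρₙ`, divided by
`ρ² - ρₙ²`, tends to `φ(ρₙ, π) dΔ/d(ρ²) = -αₙ` (`norming_eq_of_tendsto`). For `ρₙ > 0` this reads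
`2ρₙαₙ = φ(ρₙ, π) ((1 + πω) sin ρₙπ + πρₙ cos ρₙπ + ∫₀^π F(t) t sin ρₙt dt)`; for `ρ₀ = 0` the
integral is `½ ∫₀^π F(t) t² dt`, and `Δ(0) = 0` eliminates the mean value of `F`.

*The series.* The even Legendre polynomials `P₂ₖ(t/π)` are an orthogonal basis of `L²(0, π)`
(`hasSum_legendre`), the `hₖ` are the coefficients of `F` in it, and the coefficients of `t sin ρt`
are found by comparing power series with those of the spherical Bessel functions
(`integral_legendreP_div_pi_mul_sin`). Parseval's identity turns the integral into the series.
-/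


/-! ### Solutions, reflection and norming constants -/

/-- For square integrable `g`, the operator `f ↦ ∫₀ˣ |g| f` has arbitrarily small norm with respect
to the weight `exp (β x)`, once `β` is large. -/
theorem exists_exp_weight {g : ℝ → ℝ} (hg : IntegrableOn g (Ioc 0 π))
    (hg2 : IntegrableOn (fun t => g t ^ 2) (Ioc 0 π)) {δ : ℝ} (hδ : 0 < δ) :
    ∃ β : ℝ, 0 < β ∧ ∀ x ∈ Icc (0 : ℝ) π,
      ∫ s in (0 : ℝ)..x, |g s| * exp (β * s) ≤ δ * exp (β * x) := by
  set N := ∫ s in Ioc 0 π, g s ^ 2 with hN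
  have hN0 : 0 ≤ N := integral_nonneg fun _ => sq_nonneg _
  set ε := δ / (2 * (N + 1)) with hε
  have hε0 : 0 < ε := by positivity
  refine ⟨1 / (4 * ε * δ), by positivity, fun x hx => ?_⟩
  set β := 1 / (4 * ε * δ) with hβ
  have hβ0 : 0 < β := by positivity
  have hsub : Ioc 0 x ⊆ Ioc 0 π := Ioc_subset_Ioc_right hx.2
  have i1 : IntervalIntegrable (fun s => |g s| * exp (β * s)) volume 0 x := by
    apply IntervalIntegrable.mul_continuousOn
    · rw [intervalIntegrable_iff_integrableOn_Ioc_of_le hx.1]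
      exact (hg.mono_set hsub).abs
    · fun_prop
  have i2 : IntervalIntegrable (fun s => g s ^ 2) volume 0 x := by
    rw [intervalIntegrable_iff_integrableOn_Ioc_of_le hx.1]
    exact hg2.mono_set hsub
  have i3 : IntervalIntegrable (fun s => exp (2 * β * s)) volume 0 x :=
    (by fun_prop : Continuous fun s => exp (2 * β * s)).intervalIntegrable _ _
  have hle : ∫ s in (0 : ℝ)..x, |g s| * exp (β * s) ≤
      ∫ s in (0 : ℝ)..x, (ε * exp (β * x) * g s ^ 2 +
        exp (-(β * x)) / (4 * ε) * exp (2 * β * s)) := by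
    refine intervalIntegral.integral_mono_on hx.1 i1
      ((i2.const_mul _).add (i3.const_mul _)) fun s _ => ?_
    -- the inequality `a b ≤ ε a² + b² / (4 ε)`
    have e1 : exp (2 * β * s) = exp (β * s) ^ 2 := by rw [← Real.exp_nat_mul]; ring_nf
    have e2 : exp (-(β * x)) = (exp (β * x))⁻¹ := Real.exp_neg _
    rw [e1, e2]
    set E := exp (β * x)
    set f := exp (β * s)
    have hE : 0 < E := Real.exp_pos _
    have key : ε * E * g s ^ 2 + E⁻¹ / (4 * ε) * f ^ 2 - |g s| * f =
        ε * E * (|g s| - f / (2 * ε * E)) ^ 2 := by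
      rw [← sq_abs (g s)]; field_simp; ring
    have : 0 ≤ ε * E * (|g s| - f / (2 * ε * E)) ^ 2 := by positivity
    linarith
  have h2 : ∫ s in (0 : ℝ)..x, g s ^ 2 ≤ N := by
    rw [intervalIntegral.integral_of_le hx.1]
    exact setIntegral_mono_set hg2 (Filter.Eventually.of_forall fun _ => sq_nonneg _)
      hsub.eventuallyLE
  have h3 : ∫ s in (0 : ℝ)..x, exp (2 * β * s) ≤ exp (2 * β * x) / (2 * β) := by
    rw [intervalIntegral.integral_comp_mul_left (fun s => exp s) (by positivity : 2 * β ≠ 0)]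
    simp only [integral_exp, mul_zero, Real.exp_zero, smul_eq_mul]
    rw [div_eq_inv_mul]
    gcongr
    linarith
  rw [intervalIntegral.integral_add (i2.const_mul _) (i3.const_mul _),
    intervalIntegral.integral_const_mul, intervalIntegral.integral_const_mul] at hle
  have e1 : exp (2 * β * x) = exp (β * x) ^ 2 := by rw [← Real.exp_nat_mul]; ring_nf
  have e2 : exp (-(β * x)) = (exp (β * x))⁻¹ := Real.exp_neg _
  rw [e1] at h3
  rw [e2] at hle
  set E := exp (β * x)
  have hE : 0 < E := Real.exp_pos _
  have h4 : ε * E * ∫ s in (0 : ℝ)..x, g s ^ 2 ≤ δ / 2 * E := by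
    calc _ ≤ ε * E * (N + 1) := by gcongr; linarith
      _ = δ / 2 * E := by rw [hε]; field_simp
  have h5 : E⁻¹ / (4 * ε) * ∫ s in (0 : ℝ)..x, exp (2 * β * s) ≤ δ / 2 * E := by
    calc _ ≤ E⁻¹ / (4 * ε) * (E ^ 2 / (2 * β)) := by gcongr
      _ = δ / 2 * E := by rw [hβ]; field_simp
  linarith

section Solutions

variable {𝕜 : Type} [RCLike 𝕜] {q : ℝ → ℝ} {μ : 𝕜} {y dy : ℝ → 𝕜}

theorem integrableOn_potential (hq : MemLp q 2 (volume.restrict (Ioo (0 : ℝ) π))) :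
    IntegrableOn q (Ioc 0 π) := by
  rw [integrableOn_Ioc_iff_integrableOn_Ioo]
  exact hq.integrable (by norm_num)

theorem intervalIntegrable_potential_sub (hq : MemLp q 2 (volume.restrict (Ioo (0 : ℝ) π)))
    (μ : 𝕜) : IntervalIntegrable (fun t => (q t : 𝕜) - μ) volume 0 π := by
  rw [intervalIntegrable_iff_integrableOn_Ioc_of_le pi_pos.le]
  exact (integrableOn_potential hq).ofReal.sub (integrableOn_const (by simp))

theorem SLSolution.continuousOn (S : SLSolution 𝕜 q μ y dy) : ContinuousOn y (Icc 0 π) :=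
  fun x hx => (S.hasDeriv x hx).continuousWithinAt

theorem SLSolution.intervalIntegrable (hq : MemLp q 2 (volume.restrict (Ioo (0 : ℝ) π)))
    (S : SLSolution 𝕜 q μ y dy) :
    IntervalIntegrable (fun t => ((q t : 𝕜) - μ) * y t) volume 0 π :=
  (intervalIntegrable_potential_sub hq μ).mul_continuousOn
    (by rw [uIcc_of_le pi_pos.le]; exact S.continuousOn)

theorem SLSolution.intervalIntegrable_of_mem
    (hq : MemLp q 2 (volume.restrict (Ioo (0 : ℝ) π)))
    (S : SLSolution 𝕜 q μ y dy) {a b : ℝ} (ha : a ∈ Icc 0 π) (hb : b ∈ Icc 0 π) :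
    IntervalIntegrable (fun t => ((q t : 𝕜) - μ) * y t) volume a b :=
  (S.intervalIntegrable hq).mono_set
    (by rw [uIcc_of_le pi_pos.le]; exact uIcc_subset_Icc ha hb)

/-- A solution with vanishing Cauchy data at `0` is zero. -/
theorem SLSolution.eq_zero (hq : MemLp q 2 (volume.restrict (Ioo (0 : ℝ) π)))
    (S : SLSolution 𝕜 q μ y dy) (h0 : y 0 = 0) (h1 : dy 0 = 0) :
    ∀ x ∈ Icc (0 : ℝ) π, y x = 0 ∧ dy x = 0 := by
  -- two integrations bound the weighted maximum `M` of `y` by `M π / 8`, hence `M = 0`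
  have ig := intervalIntegrable_potential_sub hq μ
  rw [intervalIntegrable_iff_integrableOn_Ioc_of_le pi_pos.le] at ig
  have hL2 : MemLp (fun t => (q t : 𝕜) - μ) 2 (volume.restrict (Ioo (0 : ℝ) π)) :=
    hq.ofReal.sub (memLp_const μ)
  have ig2 : IntegrableOn (fun t => ‖(q t : 𝕜) - μ‖ ^ 2) (Ioc 0 π) := by
    rw [integrableOn_Ioc_iff_integrableOn_Ioo]
    exact hL2.integrable_norm_pow (by norm_num)
  obtain ⟨β, hβ, hw⟩ := exists_exp_weight (g := fun t => ‖(q t : 𝕜) - μ‖) ig.norm ig2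
    (δ := 1 / 8) (by norm_num)
  have hcont : ContinuousOn (fun x => exp (-(β * x)) * ‖y x‖) (Icc 0 π) :=
    (by fun_prop : Continuous fun x => exp (-(β * x))).continuousOn.mul S.continuousOn.norm
  obtain ⟨x0, hx0, hmax⟩ := isCompact_Icc.exists_isMaxOn (nonempty_Icc.2 pi_pos.le) hcont
  set M := exp (-(β * x0)) * ‖y x0‖ with hM
  have hM0 : 0 ≤ M := by positivity
  have hy : ∀ x ∈ Icc (0 : ℝ) π, ‖y x‖ ≤ M * exp (β * x) := fun x hx => by
    have h : exp (-(β * x)) * ‖y x‖ ≤ M := hmax hx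
    rwa [Real.exp_neg, inv_mul_le_iff₀ (Real.exp_pos _), mul_comm] at h
  have hdy : ∀ u ∈ Icc (0 : ℝ) π, ‖dy u‖ ≤ M / 8 * exp (β * u) := fun u hu => by
    rw [S.integral_eq u hu, h1, zero_add]
    calc ‖∫ t in (0 : ℝ)..u, ((q t : 𝕜) - μ) * y t‖
        ≤ ∫ t in (0 : ℝ)..u, ‖((q t : 𝕜) - μ) * y t‖ :=
          intervalIntegral.norm_integral_le_integral_norm hu.1
      _ ≤ ∫ t in (0 : ℝ)..u, M * (|‖(q t : 𝕜) - μ‖| * exp (β * t)) := by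
          refine intervalIntegral.integral_mono_on hu.1
            (S.intervalIntegrable_of_mem hq ⟨le_rfl, pi_pos.le⟩ hu).norm ?_ fun t ht => ?_
          · refine (IntervalIntegrable.mul_continuousOn ?_ (by fun_prop)).const_mul _
            rw [intervalIntegrable_iff_integrableOn_Ioc_of_le hu.1]
            exact (ig.mono_set (Ioc_subset_Ioc_right hu.2)).norm.abs
          · rw [norm_mul, abs_norm]
            have := hy t ⟨ht.1, ht.2.trans hu.2⟩
            nlinarith [norm_nonneg ((q t : 𝕜) - μ)]
      _ ≤ M * (1 / 8 * exp (β * u)) := by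
          rw [intervalIntegral.integral_const_mul]
          exact mul_le_mul_of_nonneg_left (hw u hu) hM0
      _ = M / 8 * exp (β * u) := by ring
  have hy2 : ∀ x ∈ Icc (0 : ℝ) π, ‖y x‖ ≤ M / 8 * exp (β * x) * π := fun x hx => by
    have hsub : Icc 0 x ⊆ Icc 0 π := Icc_subset_Icc_right hx.2
    have h := norm_image_sub_le_of_norm_deriv_le_segment' (f := y) (f' := dy) (a := 0) (b := x)
      (C := M / 8 * exp (β * x)) (fun u hu => (S.hasDeriv u (hsub hu)).mono hsub)
      (fun u hu => (hdy u ⟨hu.1, hu.2.le.trans hx.2⟩).trans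
        (by gcongr; exact hu.2.le)) x ⟨hx.1, le_rfl⟩
    rw [h0, sub_zero, sub_zero] at h
    exact h.trans (by gcongr; exact hx.2)
  have hMle : M ≤ M / 8 * π := by
    have h := hy2 x0 hx0
    calc M ≤ exp (-(β * x0)) * (M / 8 * exp (β * x0) * π) := by rw [hM]; gcongr
      _ = M / 8 * π * (exp (-(β * x0)) * exp (β * x0)) := by ring
      _ = M / 8 * π := by rw [← Real.exp_add]; simp
  have hMz : M = 0 := by nlinarith [pi_lt_four]
  intro x hx
  constructor
  · simpa [hMz] using hy x hx
  · simpa [hMz] using hdy x hx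

theorem SLSolution.sub {y₂ dy₂ : ℝ → 𝕜} (hq : MemLp q 2 (volume.restrict (Ioo (0 : ℝ) π)))
    (S : SLSolution 𝕜 q μ y dy) (S₂ : SLSolution 𝕜 q μ y₂ dy₂) :
    SLSolution 𝕜 q μ (fun x => y x - y₂ x) (fun x => dy x - dy₂ x) where
  hasDeriv x hx := (S.hasDeriv x hx).sub (S₂.hasDeriv x hx)
  integral_eq x hx := by
    have h0 : (0 : ℝ) ∈ Icc 0 π := ⟨le_rfl, pi_pos.le⟩
    simp only [mul_sub]
    rw [intervalIntegral.integral_sub (S.intervalIntegrable_of_mem hq h0 hx)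
      (S₂.intervalIntegrable_of_mem hq h0 hx), S.integral_eq x hx, S₂.integral_eq x hx]
    ring

theorem SLSolution.const_mul (S : SLSolution 𝕜 q μ y dy) (k : 𝕜) :
    SLSolution 𝕜 q μ (fun x => k * y x) (fun x => k * dy x) where
  hasDeriv x hx := (S.hasDeriv x hx).const_mul k
  integral_eq x hx := by
    simp only [mul_left_comm _ k]
    rw [intervalIntegral.integral_const_mul, S.integral_eq x hx]
    ring

/-- A solution is determined by its Cauchy data at `0`. -/
theorem SLSolution.eq_of_init {y₂ dy₂ : ℝ → 𝕜}
    (hq : MemLp q 2 (volume.restrict (Ioo (0 : ℝ) π)))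
    (S : SLSolution 𝕜 q μ y dy) (S₂ : SLSolution 𝕜 q μ y₂ dy₂) (h0 : y 0 = y₂ 0)
    (h1 : dy 0 = dy₂ 0) {x : ℝ} (hx : x ∈ Icc 0 π) : y x = y₂ x ∧ dy x = dy₂ x := by
  have h := (S.sub hq S₂).eq_zero hq (by simp [h0]) (by simp [h1]) x hx
  exact ⟨sub_eq_zero.1 h.1, sub_eq_zero.1 h.2⟩

theorem SLPhi.eq {h : ℝ} {y₂ dy₂ : ℝ → 𝕜}
    (hq : MemLp q 2 (volume.restrict (Ioo (0 : ℝ) π)))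
    (S : SLPhi 𝕜 q h μ y dy) (S₂ : SLPhi 𝕜 q h μ y₂ dy₂) {x : ℝ} (hx : x ∈ Icc 0 π) :
    y x = y₂ x ∧ dy x = dy₂ x :=
  S.toSLSolution.eq_of_init hq S₂.toSLSolution (S.init.trans S₂.init.symm)
    (S.init_deriv.trans S₂.init_deriv.symm) hx

/-- Solutions do not see the values of the potential outside `(0, π)`. -/
theorem SLSolution.congr_potential {q' : ℝ → ℝ} (hqq : EqOn q q' (Ioo 0 π))
    (S : SLSolution 𝕜 q μ y dy) : SLSolution 𝕜 q' μ y dy where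
  hasDeriv := S.hasDeriv
  integral_eq x hx := by
    rw [S.integral_eq x hx, intervalIntegral.integral_of_le hx.1,
      intervalIntegral.integral_of_le hx.1, integral_Ioc_eq_integral_Ioo,
      integral_Ioc_eq_integral_Ioo]
    congr 1
    refine setIntegral_congr_fun measurableSet_Ioo fun t ht => ?_
    simp only [hqq ⟨ht.1, ht.2.trans_le hx.2⟩]

theorem pi_sub_mem_Icc {x : ℝ} (hx : x ∈ Icc 0 π) : π - x ∈ Icc 0 π :=
  ⟨by linarith [hx.2], by linarith [hx.1]⟩

theorem slFlip_slFlip (q : ℝ → ℝ) : slFlip (slFlip q) = q := by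
  funext x; simp [slFlip]

theorem memLp_slFlip (hq : MemLp q 2 (volume.restrict (Ioo (0 : ℝ) π))) :
    MemLp (slFlip q) 2 (volume.restrict (Ioo (0 : ℝ) π)) := by
  have hmp := (Measure.measurePreserving_sub_left (volume : Measure ℝ) π).restrict_preimage
    (s := Ioo 0 π) measurableSet_Ioo
  have hpre : (fun x => π - x) ⁻¹' Ioo 0 π = Ioo 0 π := by
    ext x; simp only [mem_preimage, mem_Ioo]; constructor <;> rintro ⟨h1, h2⟩ <;>
      constructor <;> linarith
  rw [hpre] at hmp
  exact hq.comp_measurePreserving hmp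

/-- Reflecting a solution about the midpoint of `[0, π]` solves the equation with the flipped
potential. -/
theorem SLSolution.flip (hq : MemLp q 2 (volume.restrict (Ioo (0 : ℝ) π)))
    (S : SLSolution 𝕜 q μ y dy) :
    SLSolution 𝕜 (slFlip q) μ (fun x => y (π - x)) (fun x => -dy (π - x)) where
  hasDeriv x hx := by
    have h := (S.hasDeriv (π - x) (pi_sub_mem_Icc hx)).scomp x
      (((hasDerivAt_id x).const_sub π).hasDerivWithinAt (s := Icc 0 π))
      (fun t ht => pi_sub_mem_Icc ht)
    simpa [Function.comp_def] using h
  integral_eq x hx := by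
    have h0 : (0 : ℝ) ∈ Icc 0 π := ⟨le_rfl, pi_pos.le⟩
    have hp : π ∈ Icc 0 π := ⟨pi_pos.le, le_rfl⟩
    have e1 : ∫ t in (0 : ℝ)..x, ((slFlip q t : 𝕜) - μ) * y (π - t) =
        ∫ t in (π - x)..π, ((q t : 𝕜) - μ) * y t := by
      have := intervalIntegral.integral_comp_sub_left
        (fun t => ((q t : 𝕜) - μ) * y t) (a := 0) (b := x) π
      simpa [slFlip] using this
    rw [e1, sub_zero, S.integral_eq _ (pi_sub_mem_Icc hx), S.integral_eq _ hp,
      ← intervalIntegral.integral_add_adjacent_intervals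
        (S.intervalIntegrable_of_mem hq h0 (pi_sub_mem_Icc hx))
        (S.intervalIntegrable_of_mem hq (pi_sub_mem_Icc hx) hp)]
    ring

theorem SLEigenfunction.flip {h H : ℝ} (hq : MemLp q 2 (volume.restrict (Ioo (0 : ℝ) π)))
    (S : SLEigenfunction 𝕜 q h H μ y dy) :
    SLEigenfunction 𝕜 (slFlip q) H h μ (fun x => y (π - x)) (fun x => -dy (π - x)) where
  toSLSolution := S.toSLSolution.flip hq
  bc_zero := by
    have := S.bc_pi
    simp only [sub_zero]
    linear_combination -this
  bc_pi := by
    have := S.bc_zero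
    simp only [sub_self]
    linear_combination -this
  nontrivial := by
    obtain ⟨x, hx, hne⟩ := S.nontrivial
    exact ⟨π - x, pi_sub_mem_Icc hx, by simpa using hne⟩

theorem slSpectrum_flip {h H : ℝ} (hq : MemLp q 2 (volume.restrict (Ioo (0 : ℝ) π))) :
    slSpectrum (slFlip q) H h = slSpectrum q h H := by
  apply Subset.antisymm
  · rintro μ ⟨y, dy, S⟩
    have := S.flip (memLp_slFlip hq)
    rw [slFlip_slFlip] at this
    exact ⟨_, _, this⟩
  · rintro μ ⟨y, dy, S⟩
    exact ⟨_, _, S.flip hq⟩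

/-- Real solutions are complex solutions. -/
theorem SLPhi.ofReal {h μ : ℝ} {y dy : ℝ → ℝ} (S : SLPhi ℝ q h μ y dy) :
    SLPhi ℂ q h (μ : ℂ) (fun x => (y x : ℂ)) (fun x => (dy x : ℂ)) where
  hasDeriv x hx := (S.hasDeriv x hx).ofReal_comp
  integral_eq x hx := by
    rw [S.integral_eq x hx]
    push_cast
    rw [← intervalIntegral.integral_ofReal]
    simp
  init := by simp [S.init]
  init_deriv := by simp [S.init_deriv]

/-- The real part of a complex solution, for a real spectral parameter. -/
theorem SLPhi.re {h μ : ℝ} {y dy : ℝ → ℂ} (hq : MemLp q 2 (volume.restrict (Ioo (0 : ℝ) π)))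
    (S : SLPhi ℂ q h (μ : ℂ) y dy) :
    SLPhi ℝ q h μ (fun x => (y x).re) (fun x => (dy x).re) where
  hasDeriv x hx := Complex.reCLM.hasFDerivAt.comp_hasDerivWithinAt x (S.hasDeriv x hx)
  integral_eq x hx := by
    have hi := S.toSLSolution.intervalIntegrable_of_mem hq (a := 0) ⟨le_rfl, pi_pos.le⟩ hx
    have := Complex.reCLM.intervalIntegral_comp_comm hi
    rw [S.integral_eq x hx, Complex.add_re]
    simp only [Complex.reCLM_apply] at this
    rw [← this]
    simp [Complex.mul_re]
  init := by simp [S.init]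
  init_deriv := by simp [S.init_deriv]

end Solutions

section Norming

variable {q : ℝ → ℝ} {h H μ : ℝ} {y dy : ℝ → ℝ}

/-- If `μ` is an eigenvalue, the normalized solution is an eigenfunction. -/
theorem SLPhi.eigenfunction (hq : MemLp q 2 (volume.restrict (Ioo (0 : ℝ) π)))
    (hμ : (μ : ℂ) ∈ slSpectrum q h H) (S : SLPhi ℝ q h μ y dy) :
    SLEigenfunction ℝ q h H μ y dy where
  toSLSolution := S.toSLSolution
  bc_zero := by simp [S.init, S.init_deriv]
  nontrivial := ⟨0, ⟨le_rfl, pi_pos.le⟩, by simp [S.init]⟩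
  bc_pi := by
    obtain ⟨v, dv, T⟩ := hμ
    have hp : π ∈ Icc 0 π := ⟨pi_pos.le, le_rfl⟩
    have hbc : dv 0 = h * v 0 := sub_eq_zero.1 T.bc_zero
    have hv0 : v 0 ≠ 0 := fun h0 => by
      obtain ⟨x, hx, hne⟩ := T.nontrivial
      exact hne (T.toSLSolution.eq_zero hq h0 (by simp [hbc, h0]) x hx).1
    have e := T.toSLSolution.eq_of_init hq (S.ofReal.toSLSolution.const_mul (v 0))
      (by simp [S.init]) (by simp [S.init_deriv, hbc, mul_comm]) hp
    have hb := T.bc_pi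
    rw [e.1, e.2] at hb
    have : v 0 * ((dy π + H * y π : ℝ) : ℂ) = 0 := by
      push_cast; simp only [Complex.coe_algebraMap] at hb; linear_combination hb
    rcases mul_eq_zero.1 this with h' | h'
    · exact absurd h' hv0
    · exact_mod_cast h'

theorem SLPhi.norming_pos (S : SLPhi ℝ q h μ y dy) : 0 < slNorming y := by
  have hc : ContinuousOn (fun x => y x ^ 2) (Icc 0 π) := S.toSLSolution.continuousOn.pow 2
  refine intervalIntegral.integral_pos pi_pos hc (fun _ _ => sq_nonneg _)
    ⟨0, ⟨le_rfl, pi_pos.le⟩, by simp [S.init]⟩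

/-- An eigenfunction does not vanish at `π`: otherwise its Cauchy data there would vanish. -/
theorem SLEigenfunction.apply_pi_ne_zero (hq : MemLp q 2 (volume.restrict (Ioo (0 : ℝ) π)))
    (S : SLEigenfunction ℝ q h H μ y dy) : y π ≠ 0 := fun h0 => by
  obtain ⟨x, hx, hne⟩ := (S.flip hq).nontrivial
  have hd : dy π = 0 := by simpa [h0] using S.bc_pi
  exact hne ((S.flip hq).toSLSolution.eq_zero (memLp_slFlip hq) (by simp [h0])
    (by simp [hd]) x hx).1

/-- The solutions `ψ` and `y(π - ·) / y(π)` of the flipped equation have the same Cauchy data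
at `0`. -/
theorem slNorming_flip {ψ dψ : ℝ → ℝ} (hq : MemLp q 2 (volume.restrict (Ioo (0 : ℝ) π)))
    (S : SLEigenfunction ℝ q h H μ y dy) (T : SLPhi ℝ (slFlip q) H μ ψ dψ) :
    slNorming ψ = slNorming y / y π ^ 2 := by
  have hne := S.apply_pi_ne_zero hq
  have hbc : dy π = -(H * y π) := by have := S.bc_pi; simp at this; linarith
  have e : ∀ x ∈ Icc 0 π, ψ x = (y π)⁻¹ * y (π - x) := fun x hx =>
    (T.toSLSolution.eq_of_init (memLp_slFlip hq)
      ((S.flip hq).toSLSolution.const_mul (y π)⁻¹) (by simp [T.init, hne])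
      (by simp [T.init_deriv, hbc]; field_simp) hx).1
  have e2 : slNorming ψ = ∫ x in (0 : ℝ)..π, ((y π) ^ 2)⁻¹ * y (π - x) ^ 2 := by
    refine intervalIntegral.integral_congr fun x hx => ?_
    rw [uIcc_of_le pi_pos.le] at hx
    simp only [e x hx]
    ring
  rw [e2, intervalIntegral.integral_const_mul,
    intervalIntegral.integral_comp_sub_left (fun x => y x ^ 2) π]
  simp [slNorming, div_eq_inv_mul]

end Norming

/-! ### The Goursat integral equation for the kernel -/

/-- The even extension in `τ` of the restriction of `G` to the triangle `0 ≤ τ ≤ s`, extended by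
zero to the plane. -/
noncomputable def evenTri (G : ℝ → ℝ → ℝ) (s τ : ℝ) : ℝ := if |τ| ≤ s then G s |τ| else 0

/-- The integral of `evenTri G s` over the interval `[t - (x - s), t + (x - s)]`, which is the
section at height `s` of the backward light cone of `(x, t)`; it is `0` for `x < s`. -/
noncomputable def coneIntegral (G : ℝ → ℝ → ℝ) (x t s : ℝ) : ℝ :=
  ∫ τ, if |τ - t| ≤ x - s then evenTri G s τ else 0

/-- The free term of the Goursat integral equation. -/
noncomputable def goursatFree (q : ℝ → ℝ) (h x t : ℝ) : ℝ :=
  h + 1 / 2 * ((∫ s in (0 : ℝ)..(x + t) / 2, q s) + ∫ s in (0 : ℝ)..(x - t) / 2, q s)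

/-- The integral operator of the Goursat integral equation; `q` is meant to vanish
outside `(0, π)`. -/
noncomputable def goursatOp (q : ℝ → ℝ) (G : ℝ → ℝ → ℝ) (x t : ℝ) : ℝ :=
  1 / 2 * ∫ s, q s * coneIntegral G x t s

section Cone

variable {G G₁ G₂ : ℝ → ℝ → ℝ} {C : ℝ}

theorem evenTri_neg (G : ℝ → ℝ → ℝ) (s τ : ℝ) : evenTri G s (-τ) = evenTri G s τ := by
  simp [evenTri]

theorem measurable_evenTri (hG : Continuous fun p : ℝ × ℝ => G p.1 p.2) :
    Measurable fun p : ℝ × ℝ => evenTri G p.1 p.2 := by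
  unfold evenTri
  refine Measurable.ite (measurableSet_le (by fun_prop) (by fun_prop)) ?_ measurable_const
  exact (hG.comp (continuous_fst.prodMk continuous_snd.abs)).measurable

theorem abs_evenTri_le {s : ℝ} (hC0 : 0 ≤ C) (hC : ∀ τ ∈ Icc 0 s, |G s τ| ≤ C) (τ : ℝ) :
    |evenTri G s τ| ≤ C := by
  unfold evenTri
  split_ifs with h
  · exact hC _ ⟨abs_nonneg _, h⟩
  · simpa using hC0

theorem abs_evenTri_le_indicator {s : ℝ} (hC : ∀ τ ∈ Icc 0 s, |G s τ| ≤ C) (τ : ℝ) :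
    |evenTri G s τ| ≤ (Icc (-s) s).indicator (fun _ => C) τ := by
  unfold evenTri
  split_ifs with h
  · rw [indicator_of_mem (show τ ∈ Icc (-s) s from abs_le.1 h)]
    exact hC _ ⟨abs_nonneg _, h⟩
  · rw [indicator_of_notMem (show τ ∉ Icc (-s) s from fun h' => h (abs_le.2 h'))]
    simp

theorem integrable_evenTri (hG : Continuous fun p : ℝ × ℝ => G p.1 p.2) {s : ℝ}
    (hC : ∀ τ ∈ Icc 0 s, |G s τ| ≤ C) : Integrable (evenTri G s) := by
  refine Integrable.mono' (g := (Icc (-s) s).indicator (fun _ => C)) ?_ ?_ ?_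
  · exact (integrable_indicator_iff measurableSet_Icc).2 (integrableOn_const (by simp))
  · exact ((measurable_evenTri hG).comp measurable_prodMk_left).aestronglyMeasurable
  · exact Filter.Eventually.of_forall fun τ => abs_evenTri_le_indicator hC τ

theorem coneIntegral_eq_setIntegral (G : ℝ → ℝ → ℝ) (x t s : ℝ) :
    coneIntegral G x t s = ∫ τ in Icc (t - (x - s)) (t + (x - s)), evenTri G s τ := by
  rw [← integral_indicator measurableSet_Icc, coneIntegral]
  congr 1
  ext τ
  by_cases h : |τ - t| ≤ x - s
  · rw [if_pos h, indicator_of_mem]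
    rw [abs_le] at h
    constructor <;> linarith
  · rw [if_neg h, indicator_of_notMem]
    contrapose! h
    rw [abs_le]
    constructor <;> linarith [h.1, h.2]

theorem coneIntegral_eq_intervalIntegral {x s : ℝ} (hs : s ≤ x) (G : ℝ → ℝ → ℝ) (t : ℝ) :
    coneIntegral G x t s = ∫ τ in (t - (x - s))..(t + (x - s)), evenTri G s τ := by
  rw [coneIntegral_eq_setIntegral, intervalIntegral.integral_of_le (by linarith),
    integral_Icc_eq_integral_Ioc]

theorem coneIntegral_eq_zero {x s : ℝ} (hs : x ≤ s) (G : ℝ → ℝ → ℝ) (t : ℝ) :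
    coneIntegral G x t s = 0 := by
  rcases hs.lt_or_eq with h | rfl
  · rw [coneIntegral_eq_setIntegral, Icc_eq_empty (by linarith)]
    simp
  · rw [coneIntegral_eq_intervalIntegral le_rfl]
    simp

/-- The cone integral through the primitive of `evenTri G s`, for all positions of `x` and `s`. -/
theorem coneIntegral_eq_max (G : ℝ → ℝ → ℝ) (x t s : ℝ) :
    coneIntegral G x t s = ∫ τ in (t - max (x - s) 0)..(t + max (x - s) 0), evenTri G s τ := by
  rcases le_total s x with h | h
  · rw [max_eq_left (by linarith), coneIntegral_eq_intervalIntegral h]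
  · rw [max_eq_right (by linarith), coneIntegral_eq_zero h]
    simp

theorem coneIntegral_neg (G : ℝ → ℝ → ℝ) (x t s : ℝ) :
    coneIntegral G x (-t) s = coneIntegral G x t s := by
  unfold coneIntegral
  rw [← integral_neg_eq_self]
  refine integral_congr_ae (Filter.Eventually.of_forall fun τ => ?_)
  simp only [evenTri_neg]
  rw [show -τ - -t = -(τ - t) by ring, abs_neg]

theorem abs_coneIntegral_le (hG : Continuous fun p : ℝ × ℝ => G p.1 p.2) {s : ℝ} (hs : 0 ≤ s)
    (hC : ∀ τ ∈ Icc 0 s, |G s τ| ≤ C) (x t : ℝ) : |coneIntegral G x t s| ≤ 2 * s * C := by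
  rw [coneIntegral_eq_setIntegral]
  calc |∫ τ in Icc (t - (x - s)) (t + (x - s)), evenTri G s τ|
      ≤ ∫ τ in Icc (t - (x - s)) (t + (x - s)), |evenTri G s τ| := abs_integral_le_integral_abs
    _ ≤ ∫ τ, |evenTri G s τ| :=
        setIntegral_le_integral (integrable_evenTri hG hC).abs
          (Filter.Eventually.of_forall fun _ => abs_nonneg _)
    _ ≤ ∫ τ, (Icc (-s) s).indicator (fun _ => C) τ :=
        integral_mono (integrable_evenTri hG hC).abs
          ((integrable_indicator_iff measurableSet_Icc).2 (integrableOn_const (by simp)))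
          (abs_evenTri_le_indicator hC)
    _ = 2 * s * C := by
        rw [integral_indicator measurableSet_Icc]
        simp [hs]
        left; ring

theorem continuous_coneIntegral (hG : Continuous fun p : ℝ × ℝ => G p.1 p.2) {s : ℝ}
    (hC : ∀ τ ∈ Icc 0 s, |G s τ| ≤ C) :
    Continuous fun p : ℝ × ℝ => coneIntegral G p.1 p.2 s := by
  have hi := integrable_evenTri hG hC
  have hP : Continuous fun y => ∫ τ in (0 : ℝ)..y, evenTri G s τ :=
    intervalIntegral.continuous_primitive (fun _ _ => hi.intervalIntegrable) 0
  have : (fun p : ℝ × ℝ => coneIntegral G p.1 p.2 s) = fun p =>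
      (∫ τ in (0 : ℝ)..p.2 + max (p.1 - s) 0, evenTri G s τ) -
        ∫ τ in (0 : ℝ)..p.2 - max (p.1 - s) 0, evenTri G s τ := by
    ext p
    rw [coneIntegral_eq_max, intervalIntegral.integral_interval_sub_left hi.intervalIntegrable
      hi.intervalIntegrable]
  rw [this]
  exact (hP.comp (by fun_prop)).sub (hP.comp (by fun_prop))

theorem measurable_cone_integrand (hG : Continuous fun p : ℝ × ℝ => G p.1 p.2) (x : ℝ) :
    Measurable fun p : (ℝ × ℝ) × ℝ =>
      if |p.2 - p.1.1| ≤ x - p.1.2 then evenTri G p.1.2 p.2 else 0 :=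
  Measurable.ite (measurableSet_le (by fun_prop) (by fun_prop))
    ((measurable_evenTri hG).comp (by fun_prop : Measurable fun p : (ℝ × ℝ) × ℝ => (p.1.2, p.2)))
    measurable_const

/-- Joint measurability of the cone integral in `(t, s)`. -/
theorem stronglyMeasurable_coneIntegral (hG : Continuous fun p : ℝ × ℝ => G p.1 p.2) (x : ℝ) :
    StronglyMeasurable fun p : ℝ × ℝ => coneIntegral G x p.1 p.2 :=
  (measurable_cone_integrand hG x).stronglyMeasurable.integral_prod_right

theorem stronglyMeasurable_coneIntegral_right (hG : Continuous fun p : ℝ × ℝ => G p.1 p.2)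
    (x t : ℝ) : StronglyMeasurable (coneIntegral G x t) :=
  (stronglyMeasurable_coneIntegral hG x).comp_measurable measurable_prodMk_left

variable {q : ℝ → ℝ} {h : ℝ}

theorem abs_potential_mul_coneIntegral_le (hsupp : ∀ x ∉ Ioo 0 π, q x = 0)
    (hG : Continuous fun p : ℝ × ℝ => G p.1 p.2) (hC0 : 0 ≤ C) (hC : ∀ s τ, |G s τ| ≤ C)
    (x t s : ℝ) : |q s * coneIntegral G x t s| ≤ |q s| * (2 * π * C) := by
  rw [abs_mul]
  by_cases hs : s ∈ Ioo 0 π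
  · gcongr
    exact (abs_coneIntegral_le hG hs.1.le (fun τ _ => hC s τ) x t).trans (by gcongr; exact hs.2.le)
  · simp [hsupp s hs]

theorem integrable_potential_mul_coneIntegral (hq : Integrable q)
    (hsupp : ∀ x ∉ Ioo 0 π, q x = 0) (hG : Continuous fun p : ℝ × ℝ => G p.1 p.2)
    (hC0 : 0 ≤ C) (hC : ∀ s τ, |G s τ| ≤ C) (x t : ℝ) :
    Integrable fun s => q s * coneIntegral G x t s := by
  refine Integrable.mono' (hq.abs.mul_const (2 * π * C)) ?_ ?_
  · exact hq.aestronglyMeasurable.mul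
      (stronglyMeasurable_coneIntegral_right hG x t).aestronglyMeasurable
  · exact Filter.Eventually.of_forall fun s =>
      abs_potential_mul_coneIntegral_le hsupp hG hC0 hC x t s

theorem continuous_goursatOp (hq : Integrable q) (hsupp : ∀ x ∉ Ioo 0 π, q x = 0)
    (hG : Continuous fun p : ℝ × ℝ => G p.1 p.2) (hC0 : 0 ≤ C) (hC : ∀ s τ, |G s τ| ≤ C) :
    Continuous fun p : ℝ × ℝ => goursatOp q G p.1 p.2 := by
  refine continuous_const.mul (continuous_of_dominated (bound := fun s => |q s| * (2 * π * C))
    (fun p => (integrable_potential_mul_coneIntegral hq hsupp hG hC0 hC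
      p.1 p.2).aestronglyMeasurable) (fun p => Filter.Eventually.of_forall fun s =>
      abs_potential_mul_coneIntegral_le hsupp hG hC0 hC p.1 p.2 s)
    (hq.abs.mul_const _) (Filter.Eventually.of_forall fun s => ?_))
  exact continuous_const.mul (continuous_coneIntegral hG fun τ _ => hC s τ)

theorem continuous_goursatFree (hq : Integrable q) (h : ℝ) :
    Continuous fun p : ℝ × ℝ => goursatFree q h p.1 p.2 := by
  have hP : Continuous fun y => ∫ τ in (0 : ℝ)..y, q τ :=
    intervalIntegral.continuous_primitive (fun _ _ => hq.intervalIntegrable) 0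
  exact continuous_const.add (continuous_const.mul
    ((hP.comp (by fun_prop)).add (hP.comp (by fun_prop))))

theorem goursatOp_sub (hq : Integrable q) (hsupp : ∀ x ∉ Ioo 0 π, q x = 0)
    (hG₁ : Continuous fun p : ℝ × ℝ => G₁ p.1 p.2) (hG₂ : Continuous fun p : ℝ × ℝ => G₂ p.1 p.2)
    (hC0 : 0 ≤ C) (hC₁ : ∀ s τ, |G₁ s τ| ≤ C) (hC₂ : ∀ s τ, |G₂ s τ| ≤ C) (x t : ℝ) :
    goursatOp q (fun s τ => G₁ s τ - G₂ s τ) x t = goursatOp q G₁ x t - goursatOp q G₂ x t := by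
  unfold goursatOp
  rw [← mul_sub, ← integral_sub (integrable_potential_mul_coneIntegral hq hsupp hG₁ hC0 hC₁ x t)
    (integrable_potential_mul_coneIntegral hq hsupp hG₂ hC0 hC₂ x t)]
  congr 2
  ext s
  rw [← mul_sub, coneIntegral_eq_setIntegral, coneIntegral_eq_setIntegral,
    coneIntegral_eq_setIntegral, ← integral_sub
      (integrable_evenTri hG₁ fun τ _ => hC₁ s τ).integrableOn
      (integrable_evenTri hG₂ fun τ _ => hC₂ s τ).integrableOn]
  congr 2
  ext τ
  unfold evenTri
  split_ifs <;> simp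

/-- In the weight `exp (β x)` of `exists_exp_weight` the Goursat operator is a contraction. -/
theorem abs_goursatOp_le (hq : Integrable q) (hsupp : ∀ x ∉ Ioo 0 π, q x = 0)
    (hG : Continuous fun p : ℝ × ℝ => G p.1 p.2) {M β : ℝ} (hM : 0 ≤ M)
    (hGM : ∀ s ∈ Icc 0 π, ∀ τ, |G s τ| ≤ M * exp (β * s)) {x : ℝ} (hx : x ∈ Icc 0 π)
    (hw : ∫ s in (0 : ℝ)..x, |q s| * exp (β * s) ≤ 1 / 8 * exp (β * x)) (t : ℝ) :
    |goursatOp q G x t| ≤ 1 / 2 * M * exp (β * x) := by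
  have hzero : ∀ s ∉ Ioc 0 x, q s * coneIntegral G x t s = 0 := fun s hs => by
    rcases lt_or_ge x s with h' | h'
    · rw [coneIntegral_eq_zero h'.le, mul_zero]
    · rw [hsupp s (fun h2 => hs ⟨h2.1, h'⟩), zero_mul]
  have e : ∫ s, q s * coneIntegral G x t s = ∫ s in (0 : ℝ)..x, q s * coneIntegral G x t s := by
    rw [intervalIntegral.integral_of_le hx.1, setIntegral_eq_integral_of_forall_compl_eq_zero hzero]
  have hb : |∫ s in (0 : ℝ)..x, q s * coneIntegral G x t s| ≤
      ∫ s in (0 : ℝ)..x, 2 * π * M * (|q s| * exp (β * s)) := by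
    rw [← Real.norm_eq_abs]
    refine intervalIntegral.norm_integral_le_of_norm_le hx.1
      (Filter.Eventually.of_forall fun s hs => ?_) ?_
    · have hs' : s ∈ Icc 0 π := ⟨hs.1.le, hs.2.trans hx.2⟩
      rw [norm_eq_abs, abs_mul]
      have h1 := abs_coneIntegral_le hG hs'.1 (fun τ _ => hGM s hs' τ) x t
      have h2 : 2 * s * (M * exp (β * s)) ≤ 2 * π * (M * exp (β * s)) := by
        gcongr; exact hs'.2
      calc |q s| * |coneIntegral G x t s| ≤ |q s| * (2 * π * (M * exp (β * s))) := by
            gcongr; exact h1.trans h2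
        _ = _ := by ring
    · exact (hq.abs.intervalIntegrable.mul_continuousOn (by fun_prop)).const_mul _
  rw [intervalIntegral.integral_const_mul] at hb
  rw [goursatOp, e, abs_mul, abs_of_pos (by norm_num : (0 : ℝ) < 1 / 2)]
  have hE := Real.exp_pos (β * x)
  calc 1 / 2 * |∫ s in (0 : ℝ)..x, q s * coneIntegral G x t s|
      ≤ 1 / 2 * (2 * π * M * (1 / 8 * exp (β * x))) := by
        gcongr; exact hb.trans (by gcongr)
    _ = π / 8 * (M * exp (β * x)) := by ring
    _ ≤ 1 / 2 * (M * exp (β * x)) :=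
        mul_le_mul_of_nonneg_right (by linarith [pi_lt_four]) (by positivity)
    _ = _ := by ring

/-- The function on the plane that equals `exp (β s) W (s, τ)` on the square `[0, π]²` and is
constant in `s` and in `τ` beyond the sides of the square. -/
noncomputable def unweight (β : ℝ) (W : C(Icc (0 : ℝ) π × Icc (0 : ℝ) π, ℝ)) (s τ : ℝ) : ℝ :=
  exp (β * projIcc 0 π pi_pos.le s) * W (projIcc 0 π pi_pos.le s, projIcc 0 π pi_pos.le τ)

theorem continuous_unweight (β : ℝ) (W : C(Icc (0 : ℝ) π × Icc (0 : ℝ) π, ℝ)) :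
    Continuous fun p : ℝ × ℝ => unweight β W p.1 p.2 := by
  unfold unweight
  have := continuous_projIcc (a := 0) (b := π) (h := pi_pos.le)
  fun_prop

theorem abs_unweight_le {β : ℝ} (hβ : 0 ≤ β) (W : C(Icc (0 : ℝ) π × Icc (0 : ℝ) π, ℝ)) (s τ : ℝ) :
    |unweight β W s τ| ≤ exp (β * π) * ‖W‖ := by
  unfold unweight
  rw [abs_mul, abs_of_pos (Real.exp_pos _)]
  gcongr
  · exact (projIcc 0 π pi_pos.le s).2.2
  · exact W.norm_coe_le_norm _

/-- The Goursat integral equation has a continuous solution on the square `[0, π]²`. -/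
theorem exists_goursat_solution (hq : Integrable q) (hq2 : Integrable fun t => q t ^ 2)
    (hsupp : ∀ x ∉ Ioo 0 π, q x = 0) (h : ℝ) :
    ∃ G : ℝ → ℝ → ℝ, (Continuous fun p : ℝ × ℝ => G p.1 p.2) ∧
      (∃ C, 0 ≤ C ∧ ∀ s τ, |G s τ| ≤ C) ∧
      ∀ x ∈ Icc 0 π, ∀ t ∈ Icc 0 π, G x t = goursatFree q h x t + goursatOp q G x t := by
  obtain ⟨β, hβ, hw⟩ := exists_exp_weight (g := q) hq.integrableOn hq2.integrableOn
    (δ := 1 / 8) (by norm_num)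
  have hb0 : ∀ W : C(Icc (0 : ℝ) π × Icc (0 : ℝ) π, ℝ), 0 ≤ exp (β * π) * ‖W‖ := fun W => by
    positivity
  -- the Goursat equation for `W(x, t) = exp (-β x) G(x, t)`, as a fixed point equation
  let Φ : C(Icc (0 : ℝ) π × Icc (0 : ℝ) π, ℝ) → C(Icc (0 : ℝ) π × Icc (0 : ℝ) π, ℝ) := fun W =>
    { toFun := fun p => exp (-(β * p.1)) *
        (goursatFree q h p.1 p.2 + goursatOp q (unweight β W) p.1 p.2)
      continuous_toFun := by
        have h1 := continuous_goursatFree hq h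
        have h2 := continuous_goursatOp hq hsupp (continuous_unweight β W) (hb0 W)
          (abs_unweight_le hβ.le W)
        have h3 : Continuous fun p : Icc (0 : ℝ) π × Icc (0 : ℝ) π => ((p.1 : ℝ), (p.2 : ℝ)) := by
          fun_prop
        exact (by fun_prop : Continuous fun p : Icc (0 : ℝ) π × Icc (0 : ℝ) π =>
          exp (-(β * p.1))).mul ((h1.comp h3).add (h2.comp h3)) }
  have hΦ : ContractingWith (1 / 2) Φ := by
    refine ⟨by norm_num [← NNReal.coe_lt_coe], LipschitzWith.of_dist_le_mul fun W₁ W₂ => ?_⟩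
    rw [ContinuousMap.dist_le (by positivity)]
    rintro ⟨x, t⟩
    have hsub := goursatOp_sub hq hsupp (continuous_unweight β W₁) (continuous_unweight β W₂)
      (le_max_of_le_left (hb0 W₁))
      (fun s τ => (abs_unweight_le hβ.le W₁ s τ).trans (le_max_left _ (exp (β * π) * ‖W₂‖)))
      (fun s τ => (abs_unweight_le hβ.le W₂ s τ).trans (le_max_right _ _)) x t
    have hle := abs_goursatOp_le (G := fun s τ => unweight β W₁ s τ - unweight β W₂ s τ)
      (M := dist W₁ W₂) (β := β) hq hsupp
      ((continuous_unweight β W₁).sub (continuous_unweight β W₂)) dist_nonneg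
      (fun s hs τ => by
        unfold unweight
        rw [← mul_sub, abs_mul, abs_of_pos (Real.exp_pos _), projIcc_of_mem _ hs, mul_comm]
        gcongr
        rw [← Real.dist_eq]
        exact ContinuousMap.dist_apply_le_dist _) x.2 (hw x x.2) t
    rw [hsub] at hle
    change dist (exp (-(β * x)) * (goursatFree q h x t + goursatOp q (unweight β W₁) x t))
      (exp (-(β * x)) * (goursatFree q h x t + goursatOp q (unweight β W₂) x t)) ≤ _
    rw [Real.dist_eq, ← mul_sub, add_sub_add_left_eq_sub, abs_mul, abs_of_pos (Real.exp_pos _),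
      Real.exp_neg, inv_mul_le_iff₀ (Real.exp_pos _)]
    refine hle.trans (le_of_eq ?_)
    push_cast
    ring
  set W := hΦ.fixedPoint Φ with hW
  have hfix : Φ W = W := hΦ.fixedPoint_isFixedPt
  refine ⟨unweight β W, continuous_unweight β W, ⟨_, hb0 W, abs_unweight_le hβ.le W⟩,
    fun x hx t ht => ?_⟩
  have e := congrArg (fun V : C(Icc (0 : ℝ) π × Icc (0 : ℝ) π, ℝ) => V (⟨x, hx⟩, ⟨t, ht⟩)) hfix
  change exp (-(β * x)) * (goursatFree q h x t + goursatOp q (unweight β W) x t) = _ at e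
  have e2 : unweight β W x t = exp (β * x) * W (⟨x, hx⟩, ⟨t, ht⟩) := by
    rw [unweight, projIcc_of_mem _ hx, projIcc_of_mem _ ht]
  rw [e2]
  rw [← e, ← mul_assoc, ← Real.exp_add]
  simp

end Cone

/-! ### The Volterra equation and the transmuted cosine -/

section CosPrim

/-- The function `sin (ρ x) / ρ`, written as a primitive of `cos (ρ t)` to include `ρ = 0`. -/
noncomputable def cosPrim (ρ : ℂ) (x : ℝ) : ℂ := ∫ t in (0 : ℝ)..x, Complex.cos (ρ * t)

variable (ρ : ℂ)

theorem continuous_cos_mul : Continuous fun t : ℝ => Complex.cos (ρ * t) := by fun_prop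

theorem hasDerivAt_mul_ofReal (x : ℝ) : HasDerivAt (fun t : ℝ => ρ * (t : ℂ)) ρ x := by
  simpa using (Complex.ofRealCLM.hasDerivAt (x := x)).const_mul ρ

theorem hasDerivAt_cosPrim (x : ℝ) : HasDerivAt (cosPrim ρ) (Complex.cos (ρ * x)) x :=
  intervalIntegral.integral_hasDerivAt_right ((continuous_cos_mul ρ).intervalIntegrable _ _)
    ((continuous_cos_mul ρ).stronglyMeasurableAtFilter _ _) (continuous_cos_mul ρ).continuousAt

theorem continuous_cosPrim : Continuous (cosPrim ρ) :=
  continuous_iff_continuousAt.2 fun x => (hasDerivAt_cosPrim ρ x).continuousAt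

@[simp] theorem cosPrim_zero : cosPrim ρ 0 = 0 := by simp [cosPrim]

theorem mul_cosPrim (x : ℝ) : ρ * cosPrim ρ x = Complex.sin (ρ * x) := by
  have hd : ∀ t ∈ uIcc 0 x, HasDerivAt (fun t : ℝ => Complex.sin (ρ * t))
      (Complex.cos (ρ * t) * ρ) t := fun t _ => (Complex.hasDerivAt_sin _).comp t (hasDerivAt_mul_ofReal ρ t)
  have := intervalIntegral.integral_eq_sub_of_hasDerivAt hd
    ((by fun_prop : Continuous fun t : ℝ => Complex.cos (ρ * t) * ρ).intervalIntegrable _ _)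
  rw [intervalIntegral.integral_mul_const] at this
  simp only [Complex.ofReal_zero, mul_zero, Complex.sin_zero, sub_zero] at this
  rw [cosPrim, mul_comm, this]

theorem hasDerivAt_cos_mul (x : ℝ) :
    HasDerivAt (fun t : ℝ => Complex.cos (ρ * t)) (-ρ ^ 2 * cosPrim ρ x) x := by
  have e : -ρ ^ 2 * cosPrim ρ x = -Complex.sin (ρ * x) * ρ := by rw [← mul_cosPrim]; ring
  rw [e]
  exact (Complex.hasDerivAt_cos _).comp x (hasDerivAt_mul_ofReal ρ x)

theorem integral_cos_mul (a b : ℝ) :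
    ∫ t in a..b, Complex.cos (ρ * t) = cosPrim ρ b - cosPrim ρ a :=
  (intervalIntegral.integral_interval_sub_left ((continuous_cos_mul ρ).intervalIntegrable _ _)
    ((continuous_cos_mul ρ).intervalIntegrable _ _)).symm

theorem cosPrim_add_sub (τ a : ℝ) :
    cosPrim ρ (τ + a) - cosPrim ρ (τ - a) = 2 * Complex.cos (ρ * τ) * cosPrim ρ a := by
  by_cases h : ρ = 0
  · subst h
    simp [cosPrim]
    ring
  · apply mul_left_cancel₀ h
    rw [mul_sub, mul_cosPrim, mul_cosPrim, mul_left_comm, mul_cosPrim]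
    push_cast
    rw [mul_add, mul_sub, Complex.sin_add, Complex.sin_sub]
    ring

theorem cosPrim_neg (x : ℝ) : cosPrim ρ (-x) = -cosPrim ρ x := by
  have := cosPrim_add_sub ρ 0 x
  simp at this
  linear_combination -this

theorem integral_symm_of_even {𝕜 : Type*} [RCLike 𝕜] {f : ℝ → 𝕜} (hf : ∀ t, f (-t) = f t) {x : ℝ}
    (hi : IntervalIntegrable f volume (-x) x) :
    ∫ t in (-x)..x, f t = 2 * ∫ t in (0 : ℝ)..x, f t := by
  have h0 : (0 : ℝ) ∈ uIcc (-x) x := by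
    rcases le_total 0 x with h | h
    · rw [uIcc_of_le (by linarith)]; exact ⟨by linarith, h⟩
    · rw [uIcc_of_ge (by linarith)]; exact ⟨h, by linarith⟩
  rw [← intervalIntegral.integral_add_adjacent_intervals
    (hi.mono_set (uIcc_subset_uIcc left_mem_uIcc h0))
    (hi.mono_set (uIcc_subset_uIcc h0 right_mem_uIcc))]
  have := intervalIntegral.integral_comp_neg f (a := 0) (b := x)
  simp only [hf, neg_zero] at this
  rw [← this]; ring

end CosPrim

section Fubini

theorem integrable_prod_of_le {μ ν : Measure ℝ} [IsFiniteMeasure μ] [SFinite ν]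
    {E : Type*} [NormedAddCommGroup E]
    {F : ℝ × ℝ → ℂ} {f : ℝ → E} (hf : Integrable f ν) (hF : AEStronglyMeasurable F (μ.prod ν))
    {C : ℝ} (hC : ∀ᵐ p ∂μ.prod ν, ‖F p‖ ≤ C * ‖f p.2‖) : Integrable F (μ.prod ν) :=
  Integrable.mono' ((hf.comp_snd μ).norm.const_mul C) hF hC

/-- Convolution with a `C¹` function, as the primitive of the convolution with its derivative. -/
theorem integral_sub_mul_eq_primitive {K k : ℝ → ℂ} (hK : ∀ x, HasDerivAt K (k x) x)
    (hk : Continuous k) {f : ℝ → ℂ} {x : ℝ} (hx : 0 ≤ x)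
    (hf : IntervalIntegrable f volume 0 x) :
    ∫ s in (0 : ℝ)..x, K (x - s) * f s = K 0 * (∫ s in (0 : ℝ)..x, f s) +
      ∫ u in (0 : ℝ)..x, ∫ s in (0 : ℝ)..u, k (u - s) * f s := by
  have hf' : Integrable f (volume.restrict (Ioc 0 x)) :=
    (intervalIntegrable_iff_integrableOn_Ioc_of_le hx).1 hf
  have hKc : Continuous K := continuous_iff_continuousAt.2 fun x => (hK x).continuousAt
  -- both iterated integrals of `k (u - s) f s` over the triangle `s ≤ u`
  set F : ℝ × ℝ → ℂ := fun p => if p.2 ≤ p.1 then k (p.1 - p.2) * f p.2 else 0 with hF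
  obtain ⟨C, hC⟩ := (isCompact_Icc (a := -x) (b := x)).exists_bound_of_continuousOn hk.continuousOn
  have hC0 : 0 ≤ C := (norm_nonneg _).trans (hC 0 ⟨by linarith, hx⟩)
  have hFi : Integrable F ((volume.restrict (Ioc 0 x)).prod (volume.restrict (Ioc 0 x))) := by
    refine integrable_prod_of_le (C := C) hf' ?_ ?_
    · have h1 : AEStronglyMeasurable (fun p : ℝ × ℝ => k (p.1 - p.2) * f p.2)
          ((volume.restrict (Ioc 0 x)).prod (volume.restrict (Ioc 0 x))) :=
        (hk.comp (by fun_prop)).aestronglyMeasurable.mul (hf'.comp_snd _).aestronglyMeasurable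
      have h2 : MeasurableSet {p : ℝ × ℝ | p.2 ≤ p.1} := measurableSet_le (by fun_prop) (by fun_prop)
      exact h1.indicator h2
    · rw [Measure.prod_restrict]
      refine (ae_restrict_mem (measurableSet_Ioc.prod measurableSet_Ioc)).mono fun p hp => ?_
      simp only [hF]
      split_ifs with h
      · rw [norm_mul]
        gcongr
        exact hC _ ⟨by linarith [hp.1.1, hp.2.2], by linarith [hp.1.2, hp.2.1]⟩
      · simp only [norm_zero]; positivity
  have hsw := integral_integral_swap (f := fun a b => F (a, b)) hFi
  have e1 : ∫ u in (0 : ℝ)..x, ∫ s in (0 : ℝ)..u, k (u - s) * f s =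
      ∫ u in Ioc 0 x, ∫ s in Ioc 0 x, F (u, s) := by
    rw [intervalIntegral.integral_of_le hx]
    refine setIntegral_congr_fun measurableSet_Ioc fun u hu => ?_
    simp only [intervalIntegral.integral_of_le hu.1.le]
    have : (fun s => F (u, s)) = (Iic u).indicator fun s => k (u - s) * f s := by
      ext s; simp [hF, indicator]
    rw [this, setIntegral_indicator measurableSet_Iic, Ioc_inter_Iic, min_eq_right hu.2]
  have e2 : ∫ s in (0 : ℝ)..x, (K (x - s) - K 0) * f s =
      ∫ s in Ioc 0 x, ∫ u in Ioc 0 x, F (u, s) := by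
    rw [intervalIntegral.integral_of_le hx]
    refine setIntegral_congr_fun measurableSet_Ioc fun s hs => ?_
    have h1 : (fun u => F (u, s)) = (Ici s).indicator fun u => k (u - s) * f s := by
      ext u; simp [hF, indicator]
    have h2 : Ioc 0 x ∩ Ici s = Icc s x := by
      ext u; simp only [mem_inter_iff, mem_Ioc, mem_Ici, mem_Icc]
      constructor
      · rintro ⟨⟨_, h⟩, h'⟩; exact ⟨h', h⟩
      · rintro ⟨h', h⟩; exact ⟨⟨hs.1.trans_le h', h⟩, h'⟩
    simp only [h1]
    rw [setIntegral_indicator measurableSet_Ici, h2, integral_Icc_eq_integral_Ioc,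
      ← intervalIntegral.integral_of_le hs.2, intervalIntegral.integral_mul_const]
    congr 1
    rw [intervalIntegral.integral_comp_sub_right (fun u => k u),
      intervalIntegral.integral_eq_sub_of_hasDerivAt (fun t _ => hK t)
        (hk.intervalIntegrable _ _), sub_self]
  have i1 : IntervalIntegrable (fun s => K (x - s) * f s) volume 0 x :=
    hf.continuousOn_mul (hKc.comp (by fun_prop)).continuousOn
  have e3 : ∫ s in (0 : ℝ)..x, (K (x - s) - K 0) * f s =
      (∫ s in (0 : ℝ)..x, K (x - s) * f s) - K 0 * ∫ s in (0 : ℝ)..x, f s := by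
    rw [← intervalIntegral.integral_const_mul, ← intervalIntegral.integral_sub i1 (hf.const_mul _)]
    simp only [sub_mul]
  rw [e1]
  rw [hsw, ← e2, e3]
  ring

end Fubini

section Volterra

variable {q : ℝ → ℝ} {h : ℝ} {ρ : ℂ} {Z : ℝ → ℂ}

theorem continuous_cos_convolution {f : ℝ → ℂ} (hf : Integrable f) :
    Continuous fun u : ℝ => ∫ s in (0 : ℝ)..u, Complex.cos (ρ * ((u - s : ℝ) : ℂ)) * f s := by
  have i1 : ∀ a b, IntervalIntegrable (fun s : ℝ => Complex.cos (ρ * s) * f s) volume a b :=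
    fun a b => hf.intervalIntegrable.continuousOn_mul (by fun_prop)
  have i2 : ∀ a b, IntervalIntegrable (fun s : ℝ => Complex.sin (ρ * s) * f s) volume a b :=
    fun a b => hf.intervalIntegrable.continuousOn_mul (by fun_prop)
  have e : (fun u : ℝ => ∫ s in (0 : ℝ)..u, Complex.cos (ρ * ((u - s : ℝ) : ℂ)) * f s) =
      fun u : ℝ => Complex.cos (ρ * u) * (∫ s in (0 : ℝ)..u, Complex.cos (ρ * s) * f s) +
        Complex.sin (ρ * u) * ∫ s in (0 : ℝ)..u, Complex.sin (ρ * s) * f s := by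
    ext u
    rw [← intervalIntegral.integral_const_mul, ← intervalIntegral.integral_const_mul,
      ← intervalIntegral.integral_add ((i1 _ _).const_mul _) ((i2 _ _).const_mul _)]
    congr 1
    ext s
    push_cast
    rw [mul_sub, Complex.cos_sub]
    ring
  rw [e]
  have h1 := intervalIntegral.continuous_primitive i1 0
  have h2 := intervalIntegral.continuous_primitive i2 0
  fun_prop

/-- A continuous solution of the Volterra equation
`Z(x) = cos ρx + h sin(ρx)/ρ + ∫₀ˣ sin(ρ(x-s))/ρ q(s) Z(s) ds` is the normalized solution of the
differential equation. -/
theorem SLPhi.of_volterra (hq : Integrable q) (hsupp : ∀ x ∉ Ioo 0 π, q x = 0)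
    (hZ : Continuous Z)
    (hV : ∀ x ∈ Icc 0 π, Z x = Complex.cos (ρ * x) + h * cosPrim ρ x +
      ∫ s in (0 : ℝ)..x, cosPrim ρ (x - s) * ((q s : ℂ) * Z s)) :
    SLPhi ℂ q h (ρ ^ 2) Z (fun x => -ρ ^ 2 * cosPrim ρ x + h * Complex.cos (ρ * x) +
      ∫ s in (0 : ℝ)..x, Complex.cos (ρ * ((x - s : ℝ) : ℂ)) * ((q s : ℂ) * Z s)) := by
  have hf : Integrable fun s => (q s : ℂ) * Z s := by
    obtain ⟨C, hC⟩ := (isCompact_Icc (a := 0) (b := π)).exists_bound_of_continuousOn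
      hZ.continuousOn
    refine Integrable.mono' (hq.norm.mul_const C)
      (hq.ofReal.aestronglyMeasurable.mul hZ.aestronglyMeasurable)
      (Filter.Eventually.of_forall fun s => ?_)
    by_cases hs : s ∈ Ioo 0 π
    · rw [norm_mul, Complex.norm_real]
      gcongr
      exact hC s ⟨hs.1.le, hs.2.le⟩
    · simp [hsupp s hs]
  have hu := continuous_cos_convolution (ρ := ρ) hf
  refine ⟨⟨fun x hx => ?_, fun x hx => ?_⟩, ?_, ?_⟩
  · have hd := ((hasDerivAt_cos_mul ρ x).add ((hasDerivAt_cosPrim ρ x).const_mul (h : ℂ))).add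
      (intervalIntegral.integral_hasDerivAt_right (hu.intervalIntegrable 0 x)
        (hu.stronglyMeasurableAtFilter _ _) hu.continuousAt)
    refine hd.hasDerivWithinAt.congr_of_mem (fun t ht => ?_) hx
    rw [hV t ht, integral_sub_mul_eq_primitive (hasDerivAt_cosPrim ρ) (continuous_cos_mul ρ) ht.1
      hf.intervalIntegrable]
    simp
  · have e1 := integral_sub_mul_eq_primitive (hasDerivAt_cos_mul ρ)
      (continuous_const.mul (continuous_cosPrim ρ)) hx.1 (hf.intervalIntegrable (a := 0) (b := x))
    have hcv : ∀ u ∈ Icc 0 x, (∫ s in (0 : ℝ)..u, -ρ ^ 2 * cosPrim ρ (u - s) *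
        ((q s : ℂ) * Z s)) = -ρ ^ 2 * Z u +
          (ρ ^ 2 * Complex.cos (ρ * u) - h * (-ρ ^ 2 * cosPrim ρ u)) := fun u hu => by
      rw [hV u ⟨hu.1, hu.2.trans hx.2⟩]
      simp only [mul_assoc]
      rw [intervalIntegral.integral_const_mul]
      ring
    have e2 : ∫ u in (0 : ℝ)..x, ∫ s in (0 : ℝ)..u, -ρ ^ 2 * cosPrim ρ (u - s) *
        ((q s : ℂ) * Z s) = (∫ u in (0 : ℝ)..x, -ρ ^ 2 * Z u) +
          (ρ ^ 2 * cosPrim ρ x - h * (Complex.cos (ρ * x) - 1)) := by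
      have h3 : ∫ u in (0 : ℝ)..x, -ρ ^ 2 * cosPrim ρ u = Complex.cos (ρ * x) - 1 := by
        rw [intervalIntegral.integral_eq_sub_of_hasDerivAt (fun t _ => hasDerivAt_cos_mul ρ t)
          ((continuous_const.mul (continuous_cosPrim ρ)).intervalIntegrable _ _)]
        simp
      rw [← h3, cosPrim, ← intervalIntegral.integral_const_mul,
        ← intervalIntegral.integral_const_mul, ← intervalIntegral.integral_sub,
        ← intervalIntegral.integral_add]
      · refine intervalIntegral.integral_congr fun u hu => ?_
        rw [uIcc_of_le hx.1] at hu
        exact hcv u hu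
      · exact (by fun_prop : Continuous fun u => -ρ ^ 2 * Z u).intervalIntegrable _ _
      · have := continuous_cosPrim ρ
        exact (by fun_prop : Continuous fun u : ℝ => ρ ^ 2 * Complex.cos (ρ * u) -
          h * (-ρ ^ 2 * cosPrim ρ u)).intervalIntegrable _ _
      · exact (by fun_prop : Continuous fun u : ℝ => ρ ^ 2 * Complex.cos (ρ * u)).intervalIntegrable
          _ _
      · have := continuous_cosPrim ρ
        exact (by fun_prop : Continuous fun u : ℝ => h * (-ρ ^ 2 * cosPrim ρ u)).intervalIntegrable
          _ _
    have e3 : ∫ t in (0 : ℝ)..x, ((q t : ℂ) - ρ ^ 2) * Z t =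
        (∫ t in (0 : ℝ)..x, (q t : ℂ) * Z t) + ∫ u in (0 : ℝ)..x, -ρ ^ 2 * Z u := by
      rw [← intervalIntegral.integral_add hf.intervalIntegrable
        ((by fun_prop : Continuous fun u => -ρ ^ 2 * Z u).intervalIntegrable _ _)]
      congr 1; ext t; ring
    rw [e2] at e1
    simp only [Complex.ofReal_zero, mul_zero, Complex.cos_zero, one_mul] at e1
    simp only [Complex.coe_algebraMap] at *
    rw [e3, e1]
    simp
    ring
  · have := hV 0 ⟨le_rfl, pi_pos.le⟩
    simpa using this
  · simp

end Volterra

section Transmutation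

variable {q : ℝ → ℝ} {h : ℝ} {ρ : ℂ} {G : ℝ → ℝ → ℝ} {C : ℝ}

/-- The transmutation `cos ρx + ∫₀ˣ G(x, t) cos ρt dt` of the cosine. -/
noncomputable def transmutedCos (G : ℝ → ℝ → ℝ) (ρ : ℂ) (x : ℝ) : ℂ :=
  Complex.cos (ρ * x) + ∫ t in (0 : ℝ)..x, (G x t : ℂ) * Complex.cos (ρ * t)

theorem continuous_transmutedCos (hG : Continuous fun p : ℝ × ℝ => G p.1 p.2) :
    Continuous (transmutedCos G ρ) := by
  have : Continuous fun x : ℝ => ∫ t in (0 : ℝ)..x, (G x t : ℂ) * Complex.cos (ρ * t) := by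
    refine intervalIntegral.continuous_parametric_intervalIntegral_of_continuous (f := fun x t : ℝ =>
      (G x t : ℂ) * Complex.cos (ρ * t)) ?_ continuous_id
    exact (Complex.continuous_ofReal.comp hG).mul (by fun_prop)
  exact (continuous_cos_mul ρ).add this

/-- The kernel in the representation `G(x, t) = h + ∫ q(s) goursatKernel G x t s ds` of a solution
of the Goursat equation. -/
noncomputable def goursatKernel (G : ℝ → ℝ → ℝ) (x t s : ℝ) : ℝ :=
  1 / 2 * ((if s < (x + t) / 2 then 1 else 0) + if s < (x - t) / 2 then 1 else 0) +
    1 / 2 * coneIntegral G x t s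

theorem integral_primitive_eq (hsupp : ∀ x ∉ Ioo 0 π, q x = 0) {y : ℝ} (hy : 0 ≤ y) :
    ∫ s in (0 : ℝ)..y, q s = ∫ s, q s * if s < y then 1 else 0 := by
  have : (fun s => q s * if s < y then 1 else 0) = (Ioo 0 y).indicator q := by
    ext s
    by_cases h1 : s < y
    · by_cases h0 : 0 < s
      · simp [h1, h0, indicator]
      · simp [h1, h0, indicator, hsupp s (fun h => h0 h.1)]
    · simp [h1, indicator]
  rw [this, integral_indicator measurableSet_Ioo, intervalIntegral.integral_of_le hy,
    integral_Ioc_eq_integral_Ioo]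

theorem integrable_mul_ite_lt (hq : Integrable q) (y : ℝ) :
    Integrable fun s => q s * if s < y then 1 else 0 := by
  have : (fun s => q s * if s < y then 1 else 0) = (Iio y).indicator q := by
    ext s; by_cases h1 : s < y <;> simp [h1, indicator]
  rw [this]
  exact hq.indicator measurableSet_Iio

theorem goursat_eq_integral (hq : Integrable q) (hsupp : ∀ x ∉ Ioo 0 π, q x = 0)
    (hG : Continuous fun p : ℝ × ℝ => G p.1 p.2) (hC0 : 0 ≤ C) (hC : ∀ s τ, |G s τ| ≤ C)
    {x t : ℝ} (ht : t ∈ Icc 0 x) :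
    goursatFree q h x t + goursatOp q G x t = h + ∫ s, q s * goursatKernel G x t s := by
  have i1 := integrable_mul_ite_lt hq ((x + t) / 2)
  have i2 := integrable_mul_ite_lt hq ((x - t) / 2)
  have i3 := integrable_potential_mul_coneIntegral hq hsupp hG hC0 hC x t
  have e : ∀ s, q s * goursatKernel G x t s = 1 / 2 * ((q s * if s < (x + t) / 2 then 1 else 0) +
      q s * if s < (x - t) / 2 then 1 else 0) + 1 / 2 * (q s * coneIntegral G x t s) := fun s => by
    unfold goursatKernel; ring
  have e' : ∫ s, q s * goursatKernel G x t s =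
      1 / 2 * ((∫ s, q s * if s < (x + t) / 2 then 1 else 0) +
        ∫ s, q s * if s < (x - t) / 2 then 1 else 0) +
        1 / 2 * ∫ s, q s * coneIntegral G x t s := by
    simp only [e]
    rw [← integral_add i1 i2, ← integral_const_mul, ← integral_const_mul]
    exact integral_add ((i1.add i2).const_mul _) (i3.const_mul _)
  rw [e', goursatFree, goursatOp,
    integral_primitive_eq hsupp (by linarith [ht.1, ht.2]),
    integral_primitive_eq hsupp (by linarith [ht.1, ht.2])]
  ring

theorem measurable_goursatKernel (hG : Continuous fun p : ℝ × ℝ => G p.1 p.2) (x : ℝ) :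
    Measurable fun p : ℝ × ℝ => goursatKernel G x p.1 p.2 := by
  unfold goursatKernel
  refine (((Measurable.ite (measurableSet_lt (by fun_prop) (by fun_prop)) measurable_const
    measurable_const).add (Measurable.ite (measurableSet_lt (by fun_prop) (by fun_prop))
      measurable_const measurable_const)).const_mul _).add
      ((stronglyMeasurable_coneIntegral hG x).measurable.const_mul _)

/-- The cosine integral of the free part of the kernel. -/
theorem integral_cos_mul_ite {x s : ℝ} (hs : s ∈ Ioc 0 x) :
    ∫ t in (0 : ℝ)..x, Complex.cos (ρ * t) *
      ((if s < (x + t) / 2 then 1 else 0) + if s < (x - t) / 2 then 1 else 0) =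
      2 * Complex.cos (ρ * s) * cosPrim ρ (x - s) := by
  have hx : 0 ≤ x := hs.1.le.trans hs.2
  have key : ∀ t : ℝ, Complex.cos (ρ * t) *
      ((if s < (x + t) / 2 then 1 else 0) + if s < (x - t) / 2 then 1 else 0) =
      (Ioi (2 * s - x)).indicator (fun t : ℝ => Complex.cos (ρ * t)) t +
      (Iio (x - 2 * s)).indicator (fun t : ℝ => Complex.cos (ρ * t)) t := fun t => by
    have h1 : s < (x + t) / 2 ↔ t ∈ Ioi (2 * s - x) := by
      rw [mem_Ioi]; constructor <;> intro h <;> linarith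
    have h2 : s < (x - t) / 2 ↔ t ∈ Iio (x - 2 * s) := by
      rw [mem_Iio]; constructor <;> intro h <;> linarith
    simp only [h1, h2, indicator]
    split_ifs <;> ring
  have hi : IntegrableOn (fun t : ℝ => Complex.cos (ρ * t)) (Ioc 0 x) :=
    (intervalIntegrable_iff_integrableOn_Ioc_of_le hx).1
      ((continuous_cos_mul ρ).intervalIntegrable _ _)
  simp only [key]
  rw [intervalIntegral.integral_of_le hx, integral_add (hi.indicator measurableSet_Ioi)
    (hi.indicator measurableSet_Iio), setIntegral_indicator measurableSet_Ioi,
    setIntegral_indicator measurableSet_Iio]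
  have fin : cosPrim ρ x - cosPrim ρ (2 * s - x) = 2 * Complex.cos (ρ * s) * cosPrim ρ (x - s) := by
    rw [← cosPrim_add_sub]
    congr 2 <;> ring
  rcases le_total (2 * s) x with h | h
  · have h1 : Ioc 0 x ∩ Ioi (2 * s - x) = Ioc 0 x := by
      ext t; simp only [mem_inter_iff, mem_Ioc, mem_Ioi]
      exact ⟨fun h => h.1, fun h' => ⟨h', by linarith [h'.1]⟩⟩
    have h2 : Ioc 0 x ∩ Iio (x - 2 * s) = Ioo 0 (x - 2 * s) := by
      ext t; simp only [mem_inter_iff, mem_Ioc, mem_Iio, mem_Ioo]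
      exact ⟨fun h => ⟨h.1.1, h.2⟩, fun h' => ⟨⟨h'.1, by linarith [h'.2, hs.1]⟩, h'.2⟩⟩
    rw [h1, h2, ← integral_Ioc_eq_integral_Ioo, ← intervalIntegral.integral_of_le hx,
      ← intervalIntegral.integral_of_le (by linarith), integral_cos_mul, integral_cos_mul, ← fin,
      show 2 * s - x = -(x - 2 * s) by ring, cosPrim_neg]
    simp
  · have h1 : Ioc 0 x ∩ Ioi (2 * s - x) = Ioc (2 * s - x) x := by
      ext t; simp only [mem_inter_iff, mem_Ioc, mem_Ioi]
      exact ⟨fun h => ⟨h.2, h.1.2⟩, fun h' => ⟨⟨by linarith [h'.1], h'.2⟩, h'.1⟩⟩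
    have h2 : Ioc 0 x ∩ Iio (x - 2 * s) = ∅ := by
      ext t; simp only [mem_inter_iff, mem_Ioc, mem_Iio, mem_empty_iff_false, iff_false]
      rintro ⟨h1, h2⟩; linarith [h1.1]
    rw [h1, h2, ← intervalIntegral.integral_of_le (by linarith [hs.2]), integral_cos_mul, fin]
    simp

theorem integrable_cos_mul_evenTri (hG : Continuous fun p : ℝ × ℝ => G p.1 p.2) {s : ℝ}
    (hC : ∀ τ ∈ Icc 0 s, |G s τ| ≤ C) :
    Integrable fun τ : ℝ => Complex.cos (ρ * τ) * (evenTri G s τ : ℂ) := by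
  obtain ⟨D, hD⟩ := (isCompact_Icc (a := -s) (b := s)).exists_bound_of_continuousOn
    (continuous_cos_mul ρ).continuousOn
  refine Integrable.mono' ((integrable_evenTri hG hC).norm.const_mul D)
    ((continuous_cos_mul ρ).aestronglyMeasurable.mul
      (integrable_evenTri hG hC).ofReal.aestronglyMeasurable)
    (Filter.Eventually.of_forall fun τ => ?_)
  rw [norm_mul, Complex.norm_real]
  by_cases h : |τ| ≤ s
  · gcongr
    exact hD τ (abs_le.1 h)
  · simp [evenTri, h]

theorem integral_cos_mul_evenTri (hG : Continuous fun p : ℝ × ℝ => G p.1 p.2) {s : ℝ} (hs : 0 ≤ s)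
    (hC : ∀ τ ∈ Icc 0 s, |G s τ| ≤ C) :
    ∫ τ : ℝ, Complex.cos (ρ * τ) * (evenTri G s τ : ℂ) =
      2 * ∫ τ in (0 : ℝ)..s, (G s τ : ℂ) * Complex.cos (ρ * τ) := by
  have h0 : ∀ τ ∉ Icc (-s) s, Complex.cos (ρ * τ) * (evenTri G s τ : ℂ) = 0 := fun τ hτ => by
    have : ¬ |τ| ≤ s := fun h => hτ (abs_le.1 h)
    simp [evenTri, this]
  rw [← setIntegral_eq_integral_of_forall_compl_eq_zero h0, integral_Icc_eq_integral_Ioc,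
    ← intervalIntegral.integral_of_le (by linarith), integral_symm_of_even]
  · congr 1
    refine intervalIntegral.integral_congr fun τ hτ => ?_
    rw [uIcc_of_le hs] at hτ
    simp only [evenTri, abs_of_nonneg hτ.1, hτ.2, if_true]
    ring
  · intro t
    simp [evenTri_neg]
  · exact (integrable_cos_mul_evenTri hG hC).intervalIntegrable

/-- The cosine integral of the cone integral: the section of the cone translates, and
`cos ρ(τ + a) + cos ρ(τ - a) = 2 cos ρτ cos ρa` is integrated in `a`. -/
theorem integral_cos_mul_coneIntegral (hG : Continuous fun p : ℝ × ℝ => G p.1 p.2) {x s : ℝ}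
    (hs : s ∈ Ioc 0 x) (hC : ∀ τ ∈ Icc 0 s, |G s τ| ≤ C) :
    ∫ t in (0 : ℝ)..x, Complex.cos (ρ * t) * (coneIntegral G x t s : ℂ) =
      2 * cosPrim ρ (x - s) * ∫ τ in (0 : ℝ)..s, (G s τ : ℂ) * Complex.cos (ρ * τ) := by
  have hx : 0 ≤ x := hs.1.le.trans hs.2
  set F : ℝ × ℝ → ℂ := fun p => Complex.cos (ρ * p.1) *
    ((if |p.2 - p.1| ≤ x - s then evenTri G s p.2 else 0 : ℝ) : ℂ) with hF
  obtain ⟨D, hD⟩ := (isCompact_Icc (a := -x) (b := x)).exists_bound_of_continuousOn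
    (continuous_cos_mul ρ).continuousOn
  have hD0 : 0 ≤ D := (norm_nonneg _).trans (hD 0 ⟨by linarith, hx⟩)
  have hFi : Integrable F ((volume.restrict (Ioc (-x) x)).prod volume) := by
    refine integrable_prod_of_le (C := D) (integrable_evenTri hG hC) ?_ ?_
    · refine AEStronglyMeasurable.mul (by fun_prop) (Complex.measurable_ofReal.comp ?_).aestronglyMeasurable
      exact (measurable_cone_integrand hG x).comp
        (by fun_prop : Measurable fun p : ℝ × ℝ => ((p.1, s), p.2))
    · rw [← Measure.restrict_univ (μ := (volume : Measure ℝ)), Measure.restrict_restrict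
        measurableSet_Ioc, inter_univ, Measure.prod_restrict]
      refine (ae_restrict_mem (measurableSet_Ioc.prod MeasurableSet.univ)).mono fun p hp => ?_
      simp only [hF]
      rw [norm_mul, Complex.norm_real]
      have := hD p.1 ⟨hp.1.1.le, hp.1.2⟩
      gcongr
      split_ifs <;> simp
  have hcone : ∀ t : ℝ, Complex.cos (ρ * t) * (coneIntegral G x t s : ℂ) = ∫ τ, F (t, τ) := by
    intro t
    simp only [hF]
    rw [integral_const_mul, coneIntegral]
    exact congrArg _ integral_ofReal.symm
  have hi : IntervalIntegrable (fun t : ℝ => Complex.cos (ρ * t) * (coneIntegral G x t s : ℂ))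
      volume (-x) x := by
    rw [intervalIntegrable_iff_integrableOn_Ioc_of_le (by linarith)]
    simp only [hcone]
    exact hFi.integral_prod_left
  have h2 := integral_symm_of_even (x := x) (fun t => by
    rw [coneIntegral_neg]; simp) hi
  have hsw := integral_integral_swap (f := fun a b => F (a, b)) hFi
  have hin : ∀ τ : ℝ, ∫ t in Ioc (-x) x, F (t, τ) =
      2 * cosPrim ρ (x - s) * (Complex.cos (ρ * τ) * (evenTri G s τ : ℂ)) := by
    intro τ
    by_cases hτ : |τ| ≤ s
    · have hτ' := abs_le.1 hτ
      have e : (fun t => F (t, τ)) = (Icc (τ - (x - s)) (τ + (x - s))).indicator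
          fun t : ℝ => Complex.cos (ρ * t) * (evenTri G s τ : ℂ) := by
        ext t
        by_cases h : |τ - t| ≤ x - s
        · have h' := abs_le.1 h
          rw [indicator_of_mem (by constructor <;> linarith)]
          simp [hF, h]
        · rw [indicator_of_notMem]
          · simp [hF, h]
          · contrapose! h
            exact abs_le.2 ⟨by linarith [h.2], by linarith [h.1]⟩
      have hset : Icc (-x) x ∩ Icc (τ - (x - s)) (τ + (x - s)) =
          Icc (τ - (x - s)) (τ + (x - s)) :=
        inter_eq_right.2 (Icc_subset_Icc (by linarith) (by linarith))
      rw [e, ← integral_Icc_eq_integral_Ioc, setIntegral_indicator measurableSet_Icc, hset,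
        integral_Icc_eq_integral_Ioc, ← intervalIntegral.integral_of_le (by linarith [hs.2]),
        intervalIntegral.integral_mul_const, integral_cos_mul, cosPrim_add_sub]
      ring
    · simp [hF, evenTri, hτ]
  have e3 : 2 * ∫ t in (0 : ℝ)..x, Complex.cos (ρ * t) * (coneIntegral G x t s : ℂ) =
      2 * cosPrim ρ (x - s) * (2 * ∫ τ in (0 : ℝ)..s, (G s τ : ℂ) * Complex.cos (ρ * τ)) := by
    rw [← h2, intervalIntegral.integral_of_le (by linarith)]
    simp only [hcone]
    rw [hsw]
    simp only [hin]
    rw [integral_const_mul, integral_cos_mul_evenTri hG hs.1.le hC]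
  linear_combination e3 / 2

/-- The transmuted cosine satisfies the Volterra equation of the differential equation. -/
theorem transmutedCos_volterra (hq : Integrable q) (hsupp : ∀ x ∉ Ioo 0 π, q x = 0)
    (hG : Continuous fun p : ℝ × ℝ => G p.1 p.2) (hC0 : 0 ≤ C) (hC : ∀ s τ, |G s τ| ≤ C)
    (hGe : ∀ x ∈ Icc 0 π, ∀ t ∈ Icc 0 π, G x t = goursatFree q h x t + goursatOp q G x t)
    {x : ℝ} (hx : x ∈ Icc 0 π) :
    transmutedCos G ρ x = Complex.cos (ρ * x) + h * cosPrim ρ x +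
      ∫ s in (0 : ℝ)..x, cosPrim ρ (x - s) * ((q s : ℂ) * transmutedCos G ρ s) := by
  set F : ℝ × ℝ → ℂ := fun p => Complex.cos (ρ * p.1) *
    ((q p.2 * goursatKernel G x p.1 p.2 : ℝ) : ℂ) with hF
  obtain ⟨D, hD⟩ := (isCompact_Icc (a := 0) (b := π)).exists_bound_of_continuousOn
    (continuous_cos_mul ρ).continuousOn
  have hD0 : 0 ≤ D := (norm_nonneg _).trans (hD x hx)
  have hFi : Integrable F ((volume.restrict (Ioc 0 x)).prod volume) := by
    refine integrable_prod_of_le (C := D * (1 + π * C)) hq ?_ ?_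
    · refine AEStronglyMeasurable.mul (by fun_prop) ?_
      exact (Complex.continuous_ofReal.comp_aestronglyMeasurable
        ((hq.comp_snd _).aestronglyMeasurable.mul
          (measurable_goursatKernel hG x).aestronglyMeasurable))
    · rw [← Measure.restrict_univ (μ := (volume : Measure ℝ)), Measure.restrict_restrict
        measurableSet_Ioc, inter_univ, Measure.prod_restrict]
      refine (ae_restrict_mem (measurableSet_Ioc.prod MeasurableSet.univ)).mono fun p hp => ?_
      simp only [hF]
      rw [norm_mul, Complex.norm_real, norm_mul]
      by_cases hs : p.2 ∈ Ioo 0 π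
      · have h1 := hD p.1 ⟨hp.1.1.le, hp.1.2.trans hx.2⟩
        have h2 : ‖goursatKernel G x p.1 p.2‖ ≤ 1 + π * C := by
          have h3 := (abs_coneIntegral_le hG hs.1.le (fun τ _ => hC p.2 τ) x p.1).trans
            (show 2 * p.2 * C ≤ 2 * π * C by gcongr; exact hs.2.le)
          rw [abs_le] at h3
          rw [Real.norm_eq_abs, abs_le]
          unfold goursatKernel
          split_ifs <;> constructor <;> linarith
        calc _ ≤ D * (‖q p.2‖ * (1 + π * C)) := by gcongr
          _ = _ := by ring
      · simp [hsupp _ hs]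
  have hsw := integral_integral_swap (f := fun a b => F (a, b)) hFi
  -- both sides agree for each fixed `s`
  have hin : ∀ s : ℝ, ∫ t in Ioc 0 x, F (t, s) =
      (Ioc 0 x).indicator (fun s => cosPrim ρ (x - s) * ((q s : ℂ) * transmutedCos G ρ s)) s := by
    intro s
    have e0 : ∀ t : ℝ, F (t, s) = (q s / 2 : ℂ) * (Complex.cos (ρ * t) *
        ((if s < (x + t) / 2 then 1 else 0) + if s < (x - t) / 2 then 1 else 0)) +
        (q s / 2 : ℂ) * (Complex.cos (ρ * t) * (coneIntegral G x t s : ℂ)) := fun t => by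
      simp only [hF, goursatKernel]
      split_ifs <;> push_cast <;> ring
    by_cases hs0 : s ∈ Ioo 0 π
    · by_cases hsx : s ≤ x
      · have hs : s ∈ Ioc 0 x := ⟨hs0.1, hsx⟩
        rw [indicator_of_mem hs]
        simp only [e0]
        rw [← intervalIntegral.integral_of_le hx.1, intervalIntegral.integral_add,
          intervalIntegral.integral_const_mul, intervalIntegral.integral_const_mul,
          integral_cos_mul_ite hs, integral_cos_mul_coneIntegral hG hs (fun τ _ => hC s τ),
          transmutedCos]
        · ring
        · refine IntervalIntegrable.const_mul ?_ _
          refine IntervalIntegrable.continuousOn_mul ?_ (by fun_prop)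
          refine IntervalIntegrable.add ?_ ?_
          all_goals
            rw [intervalIntegrable_iff_integrableOn_Ioc_of_le hx.1]
            refine Integrable.mono' (g := fun _ => (1 : ℝ)) (integrableOn_const (by simp)) ?_
              (Filter.Eventually.of_forall fun t => by split_ifs <;> simp)
            exact (Measurable.ite (measurableSet_lt (by fun_prop) (by fun_prop)) measurable_const
              measurable_const).aestronglyMeasurable
        · refine IntervalIntegrable.const_mul ?_ _
          refine IntervalIntegrable.continuousOn_mul ?_ (by fun_prop)
          exact (Complex.continuous_ofReal.comp ((continuous_coneIntegral hG fun τ _ => hC s τ).comp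
            (by fun_prop : Continuous fun t : ℝ => (x, t)))).intervalIntegrable _ _
      · rw [indicator_of_notMem (fun h => hsx h.2)]
        push Not at hsx
        refine setIntegral_eq_zero_of_forall_eq_zero fun t ht => ?_
        have h1 : ¬ s < (x + t) / 2 := by linarith [ht.2]
        have h2 : ¬ s < (x - t) / 2 := by linarith [ht.1, hx.1]
        simp [hF, goursatKernel, h1, h2, coneIntegral_eq_zero hsx.le]
    · simp [hF, hsupp s hs0, indicator]
  have hL : ∫ t in (0 : ℝ)..x, (G x t : ℂ) * Complex.cos (ρ * t) =
      h * cosPrim ρ x + ∫ t in Ioc 0 x, ∫ s, F (t, s) := by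
    rw [cosPrim, ← intervalIntegral.integral_const_mul, ← intervalIntegral.integral_of_le hx.1,
      ← intervalIntegral.integral_add]
    · refine intervalIntegral.integral_congr fun t ht => ?_
      rw [uIcc_of_le hx.1] at ht
      simp only [hF]
      rw [hGe x hx t ⟨ht.1, ht.2.trans hx.2⟩, goursat_eq_integral hq hsupp hG hC0 hC ht,
        integral_const_mul, integral_complex_ofReal]
      push_cast
      ring
    · exact ((continuous_cos_mul ρ).intervalIntegrable _ _).const_mul _
    · rw [intervalIntegrable_iff_integrableOn_Ioc_of_le hx.1]
      exact hFi.integral_prod_left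
  rw [transmutedCos, hL, hsw]
  simp only [hin]
  rw [integral_indicator measurableSet_Ioc, ← intervalIntegral.integral_of_le hx.1]
  ring

end Transmutation

/-! ### The derivative of the kernel at the right end point -/

section KernelDeriv

variable {q : ℝ → ℝ} {h : ℝ} {ρ : ℂ} {G : ℝ → ℝ → ℝ} {C : ℝ}

/-- The sum of the boundary values of `evenTri G` on the two edges of the light cone
of `(π, t)`. -/
noncomputable def coneEdge (G : ℝ → ℝ → ℝ) (t s : ℝ) : ℝ :=
  evenTri G s (t + (π - s)) + evenTri G s (t - (π - s))

/-- The partial derivative `G_x(π, t)` of a solution of the Goursat integral equation, obtained by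
differentiating the equation. -/
noncomputable def goursatDx (q : ℝ → ℝ) (G : ℝ → ℝ → ℝ) (t : ℝ) : ℝ :=
  1 / 4 * (q (π / 2 + t / 2) + q (π / 2 - t / 2)) + 1 / 2 * ∫ s, q s * coneEdge G t s

theorem measurable_coneEdge (hG : Continuous fun p : ℝ × ℝ => G p.1 p.2) :
    Measurable fun p : ℝ × ℝ => coneEdge G p.1 p.2 := by
  have h1 : Measurable fun p : ℝ × ℝ => (p.2, p.1 + (π - p.2)) := by fun_prop
  have h2 : Measurable fun p : ℝ × ℝ => (p.2, p.1 - (π - p.2)) := by fun_prop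
  exact ((measurable_evenTri hG).comp h1).add ((measurable_evenTri hG).comp h2)

theorem abs_coneEdge_le (hC0 : 0 ≤ C) (hC : ∀ s τ, |G s τ| ≤ C) (t s : ℝ) :
    |coneEdge G t s| ≤ 2 * C := by
  have h1 := abs_evenTri_le hC0 (fun τ _ => hC s τ) (t + (π - s))
  have h2 := abs_evenTri_le hC0 (fun τ _ => hC s τ) (t - (π - s))
  exact (abs_add_le _ _).trans (by linarith)

theorem ae_comp_affine {p : ℝ → Prop} (hp : ∀ᵐ y, p y) {c : ℝ} (hc : c ≠ 0) (d : ℝ) :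
    ∀ᵐ t, p (d + c * t) := by
  have h1 : ∀ᵐ y, p (d + y) :=
    (measurePreserving_add_left volume d).quasiMeasurePreserving.ae hp
  have h2 : Measure.QuasiMeasurePreserving (fun t : ℝ => c * t) volume volume := by
    refine ⟨by fun_prop, ?_⟩
    rw [Real.map_volume_mul_left hc]
    exact Measure.smul_absolutelyContinuous
  exact h2.ae h1

theorem ae_hasDerivAt_goursatFree (hq : Integrable q) (h : ℝ) :
    ∀ᵐ t, HasDerivAt (fun x => goursatFree q h x t)
      (1 / 4 * (q (π / 2 + t / 2) + q (π / 2 - t / 2))) π := by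
  have hL := LocallyIntegrable.ae_hasDerivAt_integral hq.locallyIntegrable
  filter_upwards [ae_comp_affine hL (c := 1 / 2) (by norm_num) (π / 2),
    ae_comp_affine hL (c := -(1 / 2)) (by norm_num) (π / 2)] with t h1 h2
  rw [show π / 2 + 1 / 2 * t = (π + t) / 2 by ring] at h1
  rw [show π / 2 + -(1 / 2) * t = (π - t) / 2 by ring] at h2
  have d1 : HasDerivAt (fun x => (x + t) / 2) (1 / 2) π :=
    ((hasDerivAt_id π).add_const t).div_const 2
  have d2 : HasDerivAt (fun x => (x - t) / 2) (1 / 2) π :=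
    ((hasDerivAt_id π).sub_const t).div_const 2
  have := ((((h1 0).comp π d1).add ((h2 0).comp π d2)).const_mul (1 / 2)).const_add h
  refine this.congr_deriv ?_
  rw [show π / 2 + t / 2 = (π + t) / 2 by ring, show π / 2 - t / 2 = (π - t) / 2 by ring]
  ring

theorem continuousAt_evenTri (hG : Continuous fun p : ℝ × ℝ => G p.1 p.2) {s y : ℝ}
    (hy : |y| ≠ s) : ContinuousAt (evenTri G s) y := by
  rcases hy.lt_or_gt with h | h
  · have hc : Continuous fun τ => G s |τ| := hG.comp (by fun_prop : Continuous fun τ => (s, |τ|))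
    refine hc.continuousAt.congr ?_
    filter_upwards [(isOpen_lt continuous_abs continuous_const).mem_nhds h] with τ hτ
    exact (if_pos (le_of_lt hτ)).symm
  · refine (continuousAt_const (y := (0 : ℝ))).congr ?_
    filter_upwards [(isOpen_lt continuous_const continuous_abs).mem_nhds h] with τ hτ
    exact (if_neg (not_le.2 hτ)).symm

/-- The cone integral is Lipschitz in `x`, which dominates the difference quotients of
`goursatOp`. -/
theorem abs_coneIntegral_sub_le (hG : Continuous fun p : ℝ × ℝ => G p.1 p.2) (hC0 : 0 ≤ C)
    (hC : ∀ s τ, |G s τ| ≤ C) (x x' t s : ℝ) :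
    |coneIntegral G x t s - coneIntegral G x' t s| ≤ 2 * C * |x - x'| := by
  have hi := fun a b => (integrable_evenTri hG fun τ _ => hC s τ).intervalIntegrable
    (a := a) (b := b)
  have hb : ∀ a b, ‖∫ τ in a..b, evenTri G s τ‖ ≤ C * |b - a| := fun a b =>
    intervalIntegral.norm_integral_le_of_norm_le_const
      fun τ _ => abs_evenTri_le hC0 (fun τ _ => hC s τ) τ
  rw [coneIntegral_eq_max, coneIntegral_eq_max]
  set a := max (x - s) 0
  set b := max (x' - s) 0
  have hab : |a - b| ≤ |x - x'| := by
    have := abs_max_sub_max_le_abs (x - s) (x' - s) 0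
    rwa [sub_sub_sub_cancel_right] at this
  have e : (∫ τ in (t - a)..(t + a), evenTri G s τ) - ∫ τ in (t - b)..(t + b), evenTri G s τ =
      (∫ τ in (t + b)..(t + a), evenTri G s τ) + ∫ τ in (t - a)..(t - b), evenTri G s τ := by
    have h1 := intervalIntegral.integral_add_adjacent_intervals (hi (t - a) (t - b))
      (hi (t - b) (t + b))
    have h2 := intervalIntegral.integral_add_adjacent_intervals (hi (t - a) (t + b))
      (hi (t + b) (t + a))
    linarith
  rw [e]
  have h1 := hb (t + b) (t + a)
  have h2 := hb (t - a) (t - b)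
  rw [show t + a - (t + b) = a - b by ring] at h1
  rw [show t - b - (t - a) = a - b by ring] at h2
  calc _ ≤ C * |a - b| + C * |a - b| := (abs_add_le _ _).trans (add_le_add h1 h2)
    _ = 2 * C * |a - b| := by ring
    _ ≤ _ := by gcongr

/-- The two excluded values of `s` are those for which an edge of the cone meets the boundary
`|τ| = s`, where `evenTri G s` jumps. -/
theorem hasDerivAt_coneIntegral (hG : Continuous fun p : ℝ × ℝ => G p.1 p.2)
    (hC : ∀ s τ, |G s τ| ≤ C) {t s : ℝ} (ht : t ∈ Ioo 0 π) (hs : s ∈ Ioo 0 π)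
    (h1 : s ≠ (π + t) / 2) (h2 : s ≠ (π - t) / 2) :
    HasDerivAt (fun x => coneIntegral G x t s) (coneEdge G t s) π := by
  have hi := integrable_evenTri hG (fun τ _ => hC s τ)
  have hP : ∀ y, |y| ≠ s → HasDerivAt (fun y => ∫ τ in (0 : ℝ)..y, evenTri G s τ)
      (evenTri G s y) y := fun y hy =>
    intervalIntegral.integral_hasDerivAt_right hi.intervalIntegrable
      ((measurable_evenTri hG).comp measurable_prodMk_left).stronglyMeasurable.stronglyMeasurableAtFilter
      (continuousAt_evenTri hG hy)
  have a1 : |t + (π - s)| ≠ s := by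
    rw [abs_of_pos (by linarith [ht.1, hs.2])]
    intro h; apply h1; linarith
  have a2 : |t - (π - s)| ≠ s := by
    intro h
    rcases abs_eq (hs.1.le) |>.1 h with h | h
    · linarith [ht.2]
    · apply h2; linarith
  have d1 : HasDerivAt (fun x => t + (x - s)) 1 π := ((hasDerivAt_id π).sub_const s).const_add t
  have d2 : HasDerivAt (fun x => t - (x - s)) (-1) π := ((hasDerivAt_id π).sub_const s).const_sub t
  have hd := ((hP _ a1).comp π d1).sub ((hP _ a2).comp π d2)
  have hd' : HasDerivAt (fun x => (∫ τ in (0 : ℝ)..(t + (x - s)), evenTri G s τ) -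
      ∫ τ in (0 : ℝ)..(t - (x - s)), evenTri G s τ) (coneEdge G t s) π := by
    refine hd.congr_deriv ?_
    rw [coneEdge]; ring
  refine hd'.congr_of_eventuallyEq ?_
  filter_upwards [lt_mem_nhds hs.2] with x hx
  rw [coneIntegral_eq_intervalIntegral hx.le, intervalIntegral.integral_interval_sub_left
    hi.intervalIntegrable hi.intervalIntegrable]

theorem hasDerivAt_goursatOp (hq : Integrable q) (hsupp : ∀ x ∉ Ioo 0 π, q x = 0)
    (hG : Continuous fun p : ℝ × ℝ => G p.1 p.2) (hC0 : 0 ≤ C) (hC : ∀ s τ, |G s τ| ≤ C)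
    {t : ℝ} (ht : t ∈ Ioo 0 π) :
    HasDerivAt (fun x => goursatOp q G x t) (1 / 2 * ∫ s, q s * coneEdge G t s) π := by
  refine HasDerivAt.const_mul _ ?_
  refine (hasDerivAt_integral_of_dominated_loc_of_lip (F := fun x s => q s * coneIntegral G x t s)
    (F' := fun s => q s * coneEdge G t s) (s := univ) (bound := fun s => |q s| * (2 * C))
    Filter.univ_mem ?_ (integrable_potential_mul_coneIntegral hq hsupp hG hC0 hC π t) ?_ ?_
    (hq.abs.mul_const _) ?_).2
  · exact Filter.Eventually.of_forall fun x =>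
      (integrable_potential_mul_coneIntegral hq hsupp hG hC0 hC x t).aestronglyMeasurable
  · exact hq.aestronglyMeasurable.mul
      ((measurable_coneEdge hG).comp measurable_prodMk_left).aestronglyMeasurable
  · refine Filter.Eventually.of_forall fun s => LipschitzOnWith.of_dist_le_mul fun x _ x' _ => ?_
    rw [Real.dist_eq, Real.dist_eq, ← mul_sub, abs_mul, Real.coe_nnabs, abs_mul, abs_abs,
      abs_of_nonneg (by positivity : 0 ≤ 2 * C), mul_assoc]
    gcongr
    exact abs_coneIntegral_sub_le hG hC0 hC x x' t s
  · filter_upwards [Measure.ae_ne volume ((π + t) / 2), Measure.ae_ne volume ((π - t) / 2)]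
      with s h1 h2
    by_cases hs : s ∈ Ioo 0 π
    · exact (hasDerivAt_coneIntegral hG hC ht hs h1 h2).const_mul _
    · simpa [hsupp s hs] using hasDerivAt_const π (0 : ℝ)

/-- The left derivative of a solution of the Goursat equation at `x = π`. -/
theorem ae_hasDerivWithinAt_goursat (hq : Integrable q) (hsupp : ∀ x ∉ Ioo 0 π, q x = 0)
    (hG : Continuous fun p : ℝ × ℝ => G p.1 p.2) (hC0 : 0 ≤ C) (hC : ∀ s τ, |G s τ| ≤ C)
    (hGe : ∀ x ∈ Icc 0 π, ∀ t ∈ Icc 0 π, G x t = goursatFree q h x t + goursatOp q G x t) :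
    ∀ᵐ t ∂(volume.restrict (Ioo (0 : ℝ) π)),
      HasDerivWithinAt (fun x => G x t) (goursatDx q G t) (Icc t π) π := by
  filter_upwards [ae_restrict_of_ae (ae_hasDerivAt_goursatFree hq h),
    ae_restrict_mem measurableSet_Ioo] with t hfree ht
  refine ((hfree.add (hasDerivAt_goursatOp hq hsupp hG hC0 hC ht)).hasDerivWithinAt
    (s := Icc t π)).congr_of_mem (fun x hx => ?_) ⟨ht.2.le, le_rfl⟩
  exact hGe x ⟨ht.1.le.trans hx.1, hx.2⟩ t ⟨ht.1.le, ht.2.le⟩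

theorem integrable_comp_affine {E : Type*} [NormedAddCommGroup E] {f : ℝ → E} (hf : Integrable f)
    {c : ℝ} (hc : c ≠ 0) (d : ℝ) : Integrable fun t => f (d + c * t) :=
  (hf.comp_add_left d).comp_mul_left' hc

theorem integrable_potential_comp (hq : Integrable q) :
    (Integrable fun t => q (π / 2 + t / 2)) ∧ Integrable fun t => q (π / 2 - t / 2) := by
  have h1 := integrable_comp_affine hq (c := 1 / 2) (by norm_num) (π / 2)
  have h2 := integrable_comp_affine hq (c := -(1 / 2)) (by norm_num) (π / 2)
  constructor
  · convert h1 using 3; ring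
  · convert h2 using 3; ring

theorem memLp_goursatDx (hq : Integrable q) (hq2 : Integrable fun t => q t ^ 2)
    (hG : Continuous fun p : ℝ × ℝ => G p.1 p.2) (hC0 : 0 ≤ C) (hC : ∀ s τ, |G s τ| ≤ C) :
    MemLp (goursatDx q G) 2 (volume.restrict (Ioo (0 : ℝ) π)) := by
  have i := integrable_potential_comp hq
  have i2 := integrable_potential_comp hq2
  have m1 : MemLp (fun t => q (π / 2 + t / 2)) 2 volume :=
    (memLp_two_iff_integrable_sq i.1.aestronglyMeasurable).2 i2.1
  have m2 : MemLp (fun t => q (π / 2 - t / 2)) 2 volume :=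
    (memLp_two_iff_integrable_sq i.2.aestronglyMeasurable).2 i2.2
  have m3 : MemLp (fun t => ∫ s, q s * coneEdge G t s) 2 (volume.restrict (Ioo (0 : ℝ) π)) := by
    refine MemLp.of_bound ?_ (∫ s, |q s| * (2 * C)) (Filter.Eventually.of_forall fun t => ?_)
    · refine AEStronglyMeasurable.integral_prod_right' (f := fun p : ℝ × ℝ => q p.2 * coneEdge G p.1 p.2) ?_
      exact ((hq.comp_snd _).aestronglyMeasurable).mul (measurable_coneEdge hG).aestronglyMeasurable
    · refine norm_integral_le_of_norm_le (hq.abs.mul_const _) (Filter.Eventually.of_forall fun s => ?_)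
      rw [Real.norm_eq_abs, abs_mul]
      gcongr
      exact abs_coneEdge_le hC0 hC t s
  exact (((m1.add m2).restrict _).const_mul (1 / 4)).add (m3.const_mul (1 / 2))

theorem intervalIntegrable_goursatDx (hq : Integrable q) (hq2 : Integrable fun t => q t ^ 2)
    (hG : Continuous fun p : ℝ × ℝ => G p.1 p.2) (hC0 : 0 ≤ C) (hC : ∀ s τ, |G s τ| ≤ C) :
    IntervalIntegrable (goursatDx q G) volume 0 π := by
  rw [intervalIntegrable_iff_integrableOn_Ioc_of_le pi_pos.le, integrableOn_Ioc_iff_integrableOn_Ioo]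
  exact (memLp_goursatDx hq hq2 hG hC0 hC).integrable (by norm_num)

/-- The cosine integral of the contribution of `q` to `G_x(π, t)`. -/
theorem integral_potential_mul_cos (hq : Integrable q) :
    ∫ t in (0 : ℝ)..π, ((q (π / 2 + t / 2) + q (π / 2 - t / 2) : ℝ) : ℂ) * Complex.cos (ρ * t) =
      2 * ∫ s in (0 : ℝ)..π, (q s : ℂ) * Complex.cos (ρ * ((π - 2 * s : ℝ) : ℂ)) := by
  have i := integrable_potential_comp hq
  set f : ℝ → ℂ := fun s => (q s : ℂ) * Complex.cos (ρ * ((π - 2 * s : ℝ) : ℂ)) with hf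
  have hfi : ∀ a b, IntervalIntegrable f volume a b := fun a b =>
    hq.ofReal.intervalIntegrable.mul_continuousOn (by fun_prop)
  have h1 := intervalIntegral.integral_comp_add_div (a := 0) (b := π) f (two_ne_zero) (π / 2)
  have h2 := intervalIntegral.integral_comp_sub_div (a := 0) (b := π) f (two_ne_zero) (π / 2)
  simp only [zero_div, add_zero, sub_zero, add_halves, sub_self] at h1 h2
  have e : ∀ t : ℝ, ((q (π / 2 + t / 2) + q (π / 2 - t / 2) : ℝ) : ℂ) * Complex.cos (ρ * t) =
      f (π / 2 + t / 2) + f (π / 2 - t / 2) := fun t => by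
    simp only [hf]
    rw [show π - 2 * (π / 2 + t / 2) = -t by ring, show π - 2 * (π / 2 - t / 2) = t by ring]
    push_cast
    rw [mul_neg, Complex.cos_neg]
    ring
  have j1 : IntervalIntegrable (fun t => f (π / 2 + t / 2)) volume 0 π := by
    have : IntervalIntegrable (fun t => ((q (π / 2 + t / 2) : ℝ) : ℂ) *
      Complex.cos (ρ * ((π - 2 * (π / 2 + t / 2) : ℝ) : ℂ))) volume 0 π :=
      i.1.ofReal.intervalIntegrable.mul_continuousOn (by fun_prop)
    exact this
  have j2 : IntervalIntegrable (fun t => f (π / 2 - t / 2)) volume 0 π := by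
    have : IntervalIntegrable (fun t => ((q (π / 2 - t / 2) : ℝ) : ℂ) *
      Complex.cos (ρ * ((π - 2 * (π / 2 - t / 2) : ℝ) : ℂ))) volume 0 π :=
      i.2.ofReal.intervalIntegrable.mul_continuousOn (by fun_prop)
    exact this
  simp only [e]
  rw [intervalIntegral.integral_add j1 j2, h1, h2,
    ← intervalIntegral.integral_add_adjacent_intervals (hfi 0 (π / 2)) (hfi (π / 2) π)]
  simp only [Complex.real_smul]
  push_cast
  ring

/-- The cosine integral of the boundary values on the light cone. -/
theorem integral_coneEdge_mul_cos (hG : Continuous fun p : ℝ × ℝ => G p.1 p.2)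
    (hC : ∀ s τ, |G s τ| ≤ C) {s : ℝ} (hs : s ∈ Ioo 0 π) :
    ∫ t in (0 : ℝ)..π, (coneEdge G t s : ℂ) * Complex.cos (ρ * t) =
      2 * Complex.cos (ρ * ((π - s : ℝ) : ℂ)) *
        ∫ τ in (0 : ℝ)..s, (G s τ : ℂ) * Complex.cos (ρ * τ) := by
  set a := π - s with ha
  have key : ∀ b : ℝ, Integrable fun τ : ℝ => Complex.cos (ρ * ((τ - b : ℝ) : ℂ)) *
      (evenTri G s τ : ℂ) := fun b => by
    obtain ⟨D, hD⟩ := (isCompact_Icc (a := -s) (b := s)).exists_bound_of_continuousOn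
      (by fun_prop : Continuous fun τ : ℝ => Complex.cos (ρ * ((τ - b : ℝ) : ℂ))).continuousOn
    have hi := integrable_evenTri hG (fun τ _ => hC s τ) (s := s)
    refine Integrable.mono' (hi.norm.const_mul D)
      ((by fun_prop : Continuous fun τ : ℝ =>
        Complex.cos (ρ * ((τ - b : ℝ) : ℂ))).aestronglyMeasurable.mul hi.ofReal.aestronglyMeasurable)
      (Filter.Eventually.of_forall fun τ => ?_)
    rw [norm_mul, Complex.norm_real]
    by_cases h : |τ| ≤ s
    · gcongr
      exact hD τ (abs_le.1 h)
    · simp [evenTri, h]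
  have i1 : Integrable fun t : ℝ => Complex.cos (ρ * t) * (evenTri G s (t + a) : ℂ) := by
    simpa using (key a).comp_add_right a
  have i2 : Integrable fun t : ℝ => Complex.cos (ρ * t) * (evenTri G s (t - a) : ℂ) := by
    simpa using (key (-a)).comp_sub_right a
  have hi : Integrable fun t : ℝ => (coneEdge G t s : ℂ) * Complex.cos (ρ * t) := by
    refine (i1.add i2).congr (Filter.Eventually.of_forall fun t => ?_)
    simp only [coneEdge, Pi.add_apply, ← ha]
    push_cast; ring
  have heven : ∀ t : ℝ, (coneEdge G (-t) s : ℂ) * Complex.cos (ρ * ((-t : ℝ) : ℂ)) =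
      (coneEdge G t s : ℂ) * Complex.cos (ρ * t) := fun t => by
    unfold coneEdge
    rw [show -t + (π - s) = -(t - (π - s)) by ring, show -t - (π - s) = -(t + (π - s)) by ring,
      evenTri_neg, evenTri_neg, add_comm (evenTri G s (t - _))]
    simp
  have hsupp : ∀ t ∉ Icc (-π) π, (coneEdge G t s : ℂ) * Complex.cos (ρ * t) = 0 := fun t ht => by
    have hz : ∀ y : ℝ, (y = t + (π - s) ∨ y = t - (π - s)) → evenTri G s y = 0 := fun y hy => by
      refine if_neg fun h => ht ?_
      have := abs_le.1 h
      rcases hy with rfl | rfl <;> constructor <;> linarith [hs.1, hs.2]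
    simp [coneEdge, hz _ (Or.inl rfl), hz _ (Or.inr rfl)]
  have e1 := integral_symm_of_even (x := π) heven hi.intervalIntegrable
  rw [intervalIntegral.integral_of_le (by linarith [pi_pos]), ← integral_Icc_eq_integral_Ioc,
    setIntegral_eq_integral_of_forall_compl_eq_zero hsupp] at e1
  have e2 : ∫ t : ℝ, (coneEdge G t s : ℂ) * Complex.cos (ρ * t) =
      (∫ t : ℝ, Complex.cos (ρ * t) * (evenTri G s (t + a) : ℂ)) +
        ∫ t : ℝ, Complex.cos (ρ * t) * (evenTri G s (t - a) : ℂ) := by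
    rw [← integral_add i1 i2]
    congr 1; ext t
    simp only [coneEdge, ← ha]
    push_cast; ring
  have e3 : ∫ t : ℝ, Complex.cos (ρ * t) * (evenTri G s (t + a) : ℂ) =
      ∫ τ : ℝ, Complex.cos (ρ * ((τ - a : ℝ) : ℂ)) * (evenTri G s τ : ℂ) := by
    rw [← integral_sub_right_eq_self _ a]
    simp
  have e4 : ∫ t : ℝ, Complex.cos (ρ * t) * (evenTri G s (t - a) : ℂ) =
      ∫ τ : ℝ, Complex.cos (ρ * ((τ - -a : ℝ) : ℂ)) * (evenTri G s τ : ℂ) := by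
    rw [← integral_add_right_eq_self _ a]
    simp
  have e5 : ∫ t : ℝ, (coneEdge G t s : ℂ) * Complex.cos (ρ * t) =
      2 * Complex.cos (ρ * a) * ∫ τ : ℝ, Complex.cos (ρ * τ) * (evenTri G s τ : ℂ) := by
    rw [e2, e3, e4, ← integral_add (key a) (key (-a)), ← integral_const_mul]
    congr 1; ext τ
    push_cast
    rw [sub_neg_eq_add, mul_add, mul_sub, Complex.cos_add, Complex.cos_sub]
    ring
  rw [e5, integral_cos_mul_evenTri hG hs.1.le (fun τ _ => hC s τ)] at e1
  linear_combination -e1 / 2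

/-- The derivative at `π` of the solution, as the cosine transform of `G_x(π, t)`. -/
theorem integral_cos_mul_transmutedCos (hq : Integrable q) (hsupp : ∀ x ∉ Ioo 0 π, q x = 0)
    (hG : Continuous fun p : ℝ × ℝ => G p.1 p.2) (hC0 : 0 ≤ C) (hC : ∀ s τ, |G s τ| ≤ C) :
    ∫ s in (0 : ℝ)..π, Complex.cos (ρ * ((π - s : ℝ) : ℂ)) * ((q s : ℂ) * transmutedCos G ρ s) =
      ((1 / 2 * ∫ s in (0 : ℝ)..π, q s : ℝ) : ℂ) * Complex.cos (ρ * π) +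
        ∫ t in (0 : ℝ)..π, (goursatDx q G t : ℂ) * Complex.cos (ρ * t) := by
  set F : ℝ × ℝ → ℂ := fun p => Complex.cos (ρ * p.1) *
    ((q p.2 * coneEdge G p.1 p.2 : ℝ) : ℂ) with hF
  obtain ⟨D, hD⟩ := (isCompact_Icc (a := 0) (b := π)).exists_bound_of_continuousOn
    (continuous_cos_mul ρ).continuousOn
  have hD0 : 0 ≤ D := (norm_nonneg _).trans (hD 0 ⟨le_rfl, pi_pos.le⟩)
  have hFi : Integrable F ((volume.restrict (Ioc 0 π)).prod volume) := by
    refine integrable_prod_of_le (C := D * (2 * C)) hq ?_ ?_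
    · refine AEStronglyMeasurable.mul (by fun_prop) ?_
      exact (Complex.continuous_ofReal.comp_aestronglyMeasurable
        ((hq.comp_snd _).aestronglyMeasurable.mul (measurable_coneEdge hG).aestronglyMeasurable))
    · rw [← Measure.restrict_univ (μ := (volume : Measure ℝ)), Measure.restrict_restrict
        measurableSet_Ioc, inter_univ, Measure.prod_restrict]
      refine (ae_restrict_mem (measurableSet_Ioc.prod MeasurableSet.univ)).mono fun p hp => ?_
      simp only [hF]
      rw [norm_mul, Complex.norm_real, norm_mul]
      have h1 := hD p.1 ⟨hp.1.1.le, hp.1.2⟩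
      have h2 : ‖coneEdge G p.1 p.2‖ ≤ 2 * C := abs_coneEdge_le hC0 hC _ _
      calc _ ≤ D * (‖q p.2‖ * (2 * C)) := by gcongr
        _ = _ := by ring
  have hsw := integral_integral_swap (f := fun a b => F (a, b)) hFi
  have hin : ∀ s : ℝ, ∫ t in Ioc 0 π, F (t, s) =
      (Ioc 0 π).indicator (fun s => 2 * (Complex.cos (ρ * ((π - s : ℝ) : ℂ)) * ((q s : ℂ) *
        ∫ τ in (0 : ℝ)..s, (G s τ : ℂ) * Complex.cos (ρ * τ)))) s := fun s => by
    by_cases hs : s ∈ Ioo 0 π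
    · rw [indicator_of_mem (Ioo_subset_Ioc_self hs)]
      have : ∀ t : ℝ, F (t, s) = (q s : ℂ) * ((coneEdge G t s : ℂ) * Complex.cos (ρ * t)) :=
        fun t => by simp only [hF]; push_cast; ring
      simp only [this]
      rw [← intervalIntegral.integral_of_le pi_pos.le, intervalIntegral.integral_const_mul,
        integral_coneEdge_mul_cos hG hC hs]
      ring
    · simp [hF, hsupp s hs, indicator]
  simp only [hin] at hsw
  rw [integral_indicator measurableSet_Ioc, ← intervalIntegral.integral_of_le pi_pos.le,
    ← intervalIntegral.integral_of_le pi_pos.le, intervalIntegral.integral_const_mul] at hsw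
  have i := integrable_potential_comp hq
  have hR : ∫ t in (0 : ℝ)..π, (goursatDx q G t : ℂ) * Complex.cos (ρ * t) =
      1 / 4 * (∫ t in (0 : ℝ)..π, ((q (π / 2 + t / 2) + q (π / 2 - t / 2) : ℝ) : ℂ) *
        Complex.cos (ρ * t)) + 1 / 2 * ∫ t in (0 : ℝ)..π, ∫ s, F (t, s) := by
    rw [← intervalIntegral.integral_const_mul, ← intervalIntegral.integral_const_mul,
      ← intervalIntegral.integral_add]
    · congr 1; ext t
      simp only [hF]
      rw [integral_const_mul, integral_complex_ofReal, goursatDx]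
      push_cast
      ring
    · exact ((i.1.add i.2).ofReal.intervalIntegrable.mul_continuousOn (by fun_prop)).const_mul _
    · refine IntervalIntegrable.const_mul ?_ _
      rw [intervalIntegrable_iff_integrableOn_Ioc_of_le pi_pos.le]
      exact hFi.integral_prod_left
  have hqi : ∀ a b, IntervalIntegrable (fun s => (q s : ℂ)) volume a b := fun a b =>
    hq.ofReal.intervalIntegrable
  have hcont : Continuous fun s : ℝ => ∫ τ in (0 : ℝ)..s, (G s τ : ℂ) * Complex.cos (ρ * τ) := by
    have := (continuous_transmutedCos (ρ := ρ) hG).sub (continuous_cos_mul ρ)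
    refine this.congr fun s => ?_
    simp [transmutedCos]
  have hL : ∫ s in (0 : ℝ)..π, Complex.cos (ρ * ((π - s : ℝ) : ℂ)) *
      ((q s : ℂ) * transmutedCos G ρ s) =
      1 / 2 * Complex.cos (ρ * π) * (∫ s in (0 : ℝ)..π, (q s : ℂ)) +
      1 / 2 * (∫ s in (0 : ℝ)..π, (q s : ℂ) * Complex.cos (ρ * ((π - 2 * s : ℝ) : ℂ))) +
      ∫ s in (0 : ℝ)..π, Complex.cos (ρ * ((π - s : ℝ) : ℂ)) * ((q s : ℂ) *
        ∫ τ in (0 : ℝ)..s, (G s τ : ℂ) * Complex.cos (ρ * τ)) := by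
    have k1 := (hqi 0 π).const_mul (1 / 2 * Complex.cos (ρ * π))
    have k2 : IntervalIntegrable (fun s : ℝ => (1 / 2 : ℂ) * ((q s : ℂ) *
        Complex.cos (ρ * ((π - 2 * s : ℝ) : ℂ)))) volume 0 π :=
      ((hqi 0 π).mul_continuousOn (by fun_prop)).const_mul _
    have k3 : IntervalIntegrable (fun s : ℝ => Complex.cos (ρ * ((π - s : ℝ) : ℂ)) * ((q s : ℂ) *
        ∫ τ in (0 : ℝ)..s, (G s τ : ℂ) * Complex.cos (ρ * τ))) volume 0 π :=
      ((hqi 0 π).mul_continuousOn hcont.continuousOn).continuousOn_mul (by fun_prop)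
    rw [← intervalIntegral.integral_const_mul, ← intervalIntegral.integral_const_mul,
      ← intervalIntegral.integral_add k1 k2, ← intervalIntegral.integral_add (k1.add k2) k3]
    congr 1; ext s
    have hc : Complex.cos (ρ * ((π - s : ℝ) : ℂ)) * Complex.cos (ρ * s) =
        1 / 2 * Complex.cos (ρ * π) + 1 / 2 * Complex.cos (ρ * ((π - 2 * s : ℝ) : ℂ)) := by
      have e1 : ρ * (π : ℂ) = ρ * ((π - s : ℝ) : ℂ) + ρ * s := by push_cast; ring
      have e2 : ρ * ((π - 2 * s : ℝ) : ℂ) = ρ * ((π - s : ℝ) : ℂ) - ρ * s := by push_cast; ring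
      rw [e1, e2, Complex.cos_add, Complex.cos_sub]
      ring
    simp only [transmutedCos]
    linear_combination (q s : ℂ) * hc
  rw [hL, hR, integral_potential_mul_cos hq, hsw]
  rw [intervalIntegral.integral_ofReal]
  push_cast
  ring

/-- The transmuted cosine is the normalized solution; its derivative at `π` is the cosine transform
of `G_x(π, t)`, up to the contribution of the edge `t = x`. -/
theorem exists_slPhi_transmutedCos (hq : Integrable q) (hsupp : ∀ x ∉ Ioo 0 π, q x = 0)
    (hG : Continuous fun p : ℝ × ℝ => G p.1 p.2) (hC0 : 0 ≤ C) (hC : ∀ s τ, |G s τ| ≤ C)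
    (hGe : ∀ x ∈ Icc 0 π, ∀ t ∈ Icc 0 π, G x t = goursatFree q h x t + goursatOp q G x t)
    (ρ : ℂ) :
    ∃ dZ : ℝ → ℂ, SLPhi ℂ q h (ρ ^ 2) (transmutedCos G ρ) dZ ∧
      dZ π = -ρ ^ 2 * cosPrim ρ π + ((h + 1 / 2 * ∫ s in (0 : ℝ)..π, q s : ℝ) : ℂ) *
        Complex.cos (ρ * π) + ∫ t in (0 : ℝ)..π, (goursatDx q G t : ℂ) * Complex.cos (ρ * t) := by
  refine ⟨_, SLPhi.of_volterra hq hsupp (continuous_transmutedCos hG)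
    (fun x hx => transmutedCos_volterra hq hsupp hG hC0 hC hGe hx), ?_⟩
  simp only [integral_cos_mul_transmutedCos hq hsupp hG hC0 hC]
  push_cast
  ring

end KernelDeriv

/-! ### Uniqueness of the kernel -/

section Moments

/-- An integrable function on `(a, b)` is determined by its moments with respect to the powers of an
injective continuous function `w`. -/
theorem ae_eq_zero_of_polynomial_moments {a b c d : ℝ} {F w v : ℝ → ℝ}
    (hF : IntegrableOn F (Ioo a b)) (hw : ContinuousOn w (Icc a b))
    (hwm : MapsTo w (Icc a b) (Icc c d)) (hv : ContinuousOn v (Icc c d))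
    (hvw : ∀ t ∈ Icc a b, v (w t) = t)
    (h0 : ∀ p : Polynomial ℝ, ∫ t in Ioo a b, F t * p.eval (w t) = 0) :
    ∀ᵐ t ∂(volume.restrict (Ioo a b)), F t = 0 := by
  rw [ae_restrict_iff' measurableSet_Ioo]
  refine isOpen_Ioo.ae_eq_zero_of_integral_contDiff_smul_eq_zero
    (hF.locallyIntegrableOn) fun g hg _ hgs => ?_
  have hgc : Continuous g := hg.continuous
  obtain ⟨B, hB⟩ := (isCompact_Icc (a := a) (b := b)).exists_bound_of_continuousOn hgc.continuousOn
  have hFg : IntegrableOn (fun t => F t * g t) (Ioo a b) := by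
    refine Integrable.mono' (hF.norm.mul_const B) (hF.aestronglyMeasurable.mul
      hgc.aestronglyMeasurable) ?_
    filter_upwards [ae_restrict_mem measurableSet_Ioo] with t ht
    rw [norm_mul]
    gcongr
    exact hB t ⟨ht.1.le, ht.2.le⟩
  have hset : ∫ t, g t • F t = ∫ t in Ioo a b, F t * g t := by
    rw [← setIntegral_eq_integral_of_forall_compl_eq_zero (s := Ioo a b)]
    · simp only [smul_eq_mul, mul_comm]
    · intro t ht
      rw [image_eq_zero_of_notMem_tsupport (fun h => ht (hgs h)), zero_smul]
  rw [hset]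
  set N := ∫ t in Ioo a b, ‖F t‖ with hN
  have hN0 : 0 ≤ N := integral_nonneg fun _ => norm_nonneg _
  -- `g` is within `ε` of a polynomial in `w`
  have key : ∀ ε > 0, ‖∫ t in Ioo a b, F t * g t‖ ≤ ε * N := fun ε hε => by
    obtain ⟨p, hp⟩ := exists_polynomial_near_of_continuousOn c d (fun u => g (v u))
      (hgc.comp_continuousOn hv) ε hε
    have hpc : ContinuousOn (fun t => p.eval (w t)) (Icc a b) := p.continuous.comp_continuousOn hw
    have hFp : IntegrableOn (fun t => F t * p.eval (w t)) (Ioo a b) := by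
      obtain ⟨B, hB⟩ := (isCompact_Icc (a := a) (b := b)).exists_bound_of_continuousOn hpc
      refine Integrable.mono' (hF.norm.mul_const B) (hF.aestronglyMeasurable.mul
        ((hpc.mono Ioo_subset_Icc_self).aestronglyMeasurable measurableSet_Ioo)) ?_
      filter_upwards [ae_restrict_mem measurableSet_Ioo] with t ht
      rw [norm_mul]
      gcongr
      exact hB t ⟨ht.1.le, ht.2.le⟩
    have e : ∫ t in Ioo a b, F t * g t = ∫ t in Ioo a b, (F t * g t - F t * p.eval (w t)) := by
      rw [integral_sub hFg hFp, h0 p, sub_zero]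
    rw [e, hN, ← integral_const_mul]
    refine norm_integral_le_of_norm_le (hF.norm.const_mul ε) ?_
    filter_upwards [ae_restrict_mem measurableSet_Ioo] with t ht
    have ht' : t ∈ Icc a b := ⟨ht.1.le, ht.2.le⟩
    have := hp (w t) (hwm ht')
    simp only [hvw t ht'] at this
    rw [← mul_sub, norm_mul, mul_comm]
    gcongr
    rw [Real.norm_eq_abs, abs_sub_comm]
    exact this.le
  have : ‖∫ t in Ioo a b, F t * g t‖ ≤ 0 := by
    refine le_of_forall_pos_le_add fun ε hε => ?_
    have h := key (ε / (N + 1)) (by positivity)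
    refine h.trans ?_
    rw [zero_add, div_mul_eq_mul_div, div_le_iff₀ (by positivity)]
    nlinarith
  exact norm_le_zero_iff.1 this

/-- A continuous function on `[0, x]` with vanishing cosine transform is zero. -/
theorem eqOn_zero_of_cos_transform {x : ℝ} (hx : 0 < x) {D : ℝ → ℝ}
    (hD : ContinuousOn D (Icc 0 x))
    (h0 : ∀ ρ : ℝ, ∫ t in (0 : ℝ)..x, D t * cos (ρ * t) = 0) : ∀ t ∈ Icc 0 x, D t = 0 := by
  have hi : ∀ f : ℝ → ℝ, Continuous f → IntervalIntegrable (fun t => D t * f t) volume 0 x :=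
    fun f hf => (hD.mul hf.continuousOn).intervalIntegrable_of_Icc hx.le
  -- powers of `cos (π t / x)` are trigonometric polynomials
  have hpow : ∀ (m : ℕ) (ρ : ℝ),
      ∫ t in (0 : ℝ)..x, D t * (cos (π / x * t) ^ m * cos (ρ * t)) = 0 := by
    intro m
    induction m with
    | zero => intro ρ; simpa using h0 ρ
    | succ m ih =>
      intro ρ
      have h1 := ih (ρ + π / x)
      have h2 := ih (ρ - π / x)
      have e : ∀ t, D t * (cos (π / x * t) ^ (m + 1) * cos (ρ * t)) =
          1 / 2 * (D t * (cos (π / x * t) ^ m * cos ((ρ + π / x) * t))) +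
          1 / 2 * (D t * (cos (π / x * t) ^ m * cos ((ρ - π / x) * t))) := fun t => by
        rw [add_mul, sub_mul, cos_add, cos_sub]
        ring
      simp only [e]
      rw [intervalIntegral.integral_add ((hi _ (by fun_prop)).const_mul _)
        ((hi _ (by fun_prop)).const_mul _), intervalIntegral.integral_const_mul,
        intervalIntegral.integral_const_mul, h1, h2]
      simp
  have hpoly : ∀ p : Polynomial ℝ, ∫ t in Ioo 0 x, D t * p.eval (cos (π / x * t)) = 0 := by
    intro p
    rw [← integral_Ioc_eq_integral_Ioo, ← intervalIntegral.integral_of_le hx.le]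
    induction p using Polynomial.induction_on' with
    | add p r hp hr =>
      have hc : Continuous fun t => cos (π / x * t) := by fun_prop
      simp only [Polynomial.eval_add, mul_add]
      rw [intervalIntegral.integral_add (hi (fun t => p.eval (cos (π / x * t))) (p.continuous.comp hc))
        (hi (fun t => r.eval (cos (π / x * t))) (r.continuous.comp hc)), hp, hr, add_zero]
    | monomial n k =>
      have := hpow n 0
      simp only [zero_mul, cos_zero, mul_one] at this
      simp only [Polynomial.eval_monomial, mul_left_comm _ k]
      rw [intervalIntegral.integral_const_mul, this, mul_zero]
  have hae := ae_eq_zero_of_polynomial_moments (c := -1) (d := 1) (w := fun t => cos (π / x * t))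
    (v := fun u => x / π * arccos u)
    ((hD.integrableOn_Icc).mono_set Ioo_subset_Icc_self) (by fun_prop)
    (fun t _ => ⟨neg_one_le_cos _, cos_le_one _⟩)
    (continuous_const.mul continuous_arccos).continuousOn (fun t ht => by
      have h1 : 0 ≤ π / x * t := mul_nonneg (by positivity) ht.1
      have h2 : π / x * t ≤ π := by
        rw [div_mul_eq_mul_div, div_le_iff₀ hx]
        exact mul_le_mul_of_nonneg_left ht.2 pi_pos.le
      simp only [arccos_cos h1 h2]
      field_simp) hpoly
  have hae' : D =ᵐ[volume.restrict (Icc 0 x)] fun _ => 0 := by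
    rw [← restrict_Ioo_eq_restrict_Icc]
    exact hae
  exact Measure.eqOn_Icc_of_ae_eq volume hx.ne hae' hD continuousOn_const

/-- The transmutation kernel is unique. -/
theorem IsTransmutationKernel.eq {q : ℝ → ℝ} {h : ℝ} {G G' : ℝ → ℝ → ℝ}
    (hG : IsTransmutationKernel q h G) (hG' : IsTransmutationKernel q h G')
    (hex : ∀ ρ : ℂ, ∃ y dy, SLPhi ℂ q h (ρ ^ 2) y dy) {x t : ℝ} (hx0 : 0 < x) (hxπ : x ≤ π)
    (ht : t ∈ Icc 0 x) : G x t = G' x t := by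
  have hc : ∀ K : ℝ → ℝ → ℝ, IsTransmutationKernel q h K → ContinuousOn (K x) (Icc 0 x) :=
    fun K hK => hK.continuousOn.comp (by fun_prop : Continuous fun t : ℝ => (x, t)).continuousOn
      fun t ht => ⟨ht.1, ht.2, hxπ⟩
  have hD := (hc G hG).sub (hc G' hG')
  refine sub_eq_zero.1 (eqOn_zero_of_cos_transform hx0 hD (fun ρ => ?_) t ht)
  obtain ⟨y, dy, hy⟩ := hex ρ
  have e1 := hG.transmutes ρ y dy hy x ⟨hx0.le, hxπ⟩
  have e2 := hG'.transmutes ρ y dy hy x ⟨hx0.le, hxπ⟩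
  rw [e1] at e2
  have e3 := add_left_cancel e2
  have hr : ∀ K : ℝ → ℝ → ℝ, ∫ t in (0 : ℝ)..x, (K x t : ℂ) * Complex.cos (ρ * t) =
      ((∫ t in (0 : ℝ)..x, K x t * cos (ρ * t) : ℝ) : ℂ) := fun K => by
    rw [← intervalIntegral.integral_ofReal]
    congr 1; ext t; push_cast; rfl
  rw [hr G, hr G'] at e3
  have e4 : ∫ t in (0 : ℝ)..x, G x t * cos (ρ * t) = ∫ t in (0 : ℝ)..x, G' x t * cos (ρ * t) := by
    exact_mod_cast e3
  have hi : ∀ K : ℝ → ℝ → ℝ, IsTransmutationKernel q h K →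
      IntervalIntegrable (fun t => K x t * cos (ρ * t)) volume 0 x := fun K hK =>
    ((hc K hK).mul (by fun_prop)).intervalIntegrable_of_Icc hx0.le
  simp only [Pi.sub_apply, sub_mul]
  rw [intervalIntegral.integral_sub (hi G hG) (hi G' hG'), e4, sub_self]

end Moments

/-! ### Moments of the even Legendre polynomials -/

section Legendre

open Polynomial in
/-- Integration by parts `j` times against a power of `X² - 1` of exponent at least `j`. -/
theorem integral_iterate_derivative_mul (n : ℕ) : ∀ j ≤ n, ∀ g : Polynomial ℝ,
    ∫ u in (-1 : ℝ)..1, (derivative^[j] ((X ^ 2 - 1 : Polynomial ℝ) ^ n)).eval u * g.eval u =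
      (-1) ^ j * ∫ u in (-1 : ℝ)..1, ((X ^ 2 - 1 : Polynomial ℝ) ^ n).eval u *
        (derivative^[j] g).eval u := by
  intro j
  induction j with
  | zero => intro _ g; simp
  | succ j ih =>
    intro hj g
    have hroot : ∀ u : ℝ, u ^ 2 = 1 →
        (derivative^[j] ((X ^ 2 - 1 : Polynomial ℝ) ^ n)).eval u = 0 := fun u hu => by
      obtain ⟨r, hr⟩ := pow_sub_dvd_iterate_derivative_of_pow_dvd j
        (dvd_refl ((X ^ 2 - 1 : Polynomial ℝ) ^ n))
      rw [hr, eval_mul, eval_pow]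
      simp [hu, zero_pow (Nat.sub_ne_zero_of_lt hj)]
    have hp := intervalIntegral.integral_mul_deriv_eq_deriv_mul (a := -1) (b := 1)
      (u := fun u => g.eval u)
      (v := fun u => (derivative^[j] ((X ^ 2 - 1 : Polynomial ℝ) ^ n)).eval u)
      (fun x _ => g.hasDerivAt x) (fun x _ => Polynomial.hasDerivAt _ x)
      ((Polynomial.continuous _).intervalIntegrable _ _)
      ((Polynomial.continuous _).intervalIntegrable _ _)
    rw [hroot 1 (by norm_num), hroot (-1) (by norm_num)] at hp
    have h2 := ih (by omega) (derivative g)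
    rw [Function.iterate_succ_apply']
    simp only [mul_comm (g.eval _), mul_comm ((derivative g).eval _)] at hp
    rw [hp, h2, Function.iterate_succ_apply]
    ring

/-- The beta integral `∫₀¹ (1 - u²)ⁿ u²ᵐ du`. -/
theorem integral_one_sub_sq_pow_mul (n : ℕ) : ∀ m : ℕ,
    ∫ u in (0 : ℝ)..1, (1 - u ^ 2) ^ n * u ^ (2 * m) =
      n.factorial * Gamma (m + 1 / 2) / (2 * Gamma (m + n + 3 / 2)) := by
  induction n with
  | zero =>
    intro m
    have hG : Gamma ((m : ℝ) + (0 : ℕ) + 3 / 2) = (m + 1 / 2) * Gamma (m + 1 / 2) := by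
      rw [← Real.Gamma_add_one (by positivity)]; congr 1; push_cast; ring
    have hpos : 0 < Gamma ((m : ℝ) + 1 / 2) := Real.Gamma_pos_of_pos (by positivity)
    rw [hG]
    simp only [pow_zero, one_mul, integral_pow]
    field_simp
    push_cast
    simp [mul_comm]
  | succ n ih =>
    intro m
    have i1 : ∀ a b : ℕ, IntervalIntegrable (fun u : ℝ => (1 - u ^ 2) ^ a * u ^ b) volume 0 1 :=
      fun a b => (by fun_prop : Continuous fun u : ℝ => (1 - u ^ 2) ^ a * u ^ b).intervalIntegrable _ _
    have h1 : ∫ u in (0 : ℝ)..1, (1 - u ^ 2) ^ (n + 1) * u ^ (2 * m) =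
        (∫ u in (0 : ℝ)..1, (1 - u ^ 2) ^ n * u ^ (2 * m)) -
          ∫ u in (0 : ℝ)..1, (1 - u ^ 2) ^ n * u ^ (2 * (m + 1)) := by
      rw [← intervalIntegral.integral_sub (i1 _ _) (i1 _ _)]
      congr 1; ext u; ring
    have hd1 : ∀ x : ℝ, HasDerivAt (fun u : ℝ => (1 - u ^ 2) ^ (n + 1))
        (((n + 1 : ℕ) : ℝ) * (1 - x ^ 2) ^ n * (-(2 * x))) x := fun x => by
      refine (((hasDerivAt_pow 2 x).const_sub 1).pow (n + 1)).congr_deriv ?_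
      simp
    have hd2 : ∀ x : ℝ, HasDerivAt (fun u : ℝ => u ^ (2 * m + 1))
        (((2 * m + 1 : ℕ) : ℝ) * x ^ (2 * m)) x := fun x => by
      simpa using hasDerivAt_pow (2 * m + 1) x
    have h2 := intervalIntegral.integral_mul_deriv_eq_deriv_mul (a := 0) (b := 1)
      (fun x _ => hd1 x) (fun x _ => hd2 x)
      ((by fun_prop : Continuous fun x : ℝ =>
        ((n + 1 : ℕ) : ℝ) * (1 - x ^ 2) ^ n * (-(2 * x))).intervalIntegrable _ _)
      ((by fun_prop : Continuous fun x : ℝ =>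
        ((2 * m + 1 : ℕ) : ℝ) * x ^ (2 * m)).intervalIntegrable _ _)
    have e1 : ∀ x : ℝ, (1 - x ^ 2) ^ (n + 1) * (((2 * m + 1 : ℕ) : ℝ) * x ^ (2 * m)) =
        (2 * m + 1) * ((1 - x ^ 2) ^ (n + 1) * x ^ (2 * m)) := fun x => by push_cast; ring
    have e2 : ∀ x : ℝ, ((n + 1 : ℕ) : ℝ) * (1 - x ^ 2) ^ n * (-(2 * x)) * x ^ (2 * m + 1) =
        (-(2 * (n + 1))) * ((1 - x ^ 2) ^ n * x ^ (2 * (m + 1))) := fun x => by push_cast; ring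
    simp only [e1, e2, intervalIntegral.integral_const_mul] at h2
    simp only [one_pow, sub_self, ne_eq, Nat.add_eq_zero_iff, one_ne_zero, and_false,
      not_false_eq_true, zero_pow, mul_zero, zero_sub, mul_one] at h2
    rw [ih m] at h1
    have hG : Gamma ((m : ℝ) + (n + 1 : ℕ) + 3 / 2) =
        (m + n + 3 / 2) * Gamma (m + n + 3 / 2) := by
      rw [← Real.Gamma_add_one (by positivity)]; congr 1; push_cast; ring
    have hpos : 0 < Gamma ((m : ℝ) + n + 3 / 2) := Real.Gamma_pos_of_pos (by positivity)
    rw [hG, Nat.factorial_succ]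
    have h3 : (2 * (n : ℝ) + 2 * m + 3) * ∫ u in (0 : ℝ)..1, (1 - u ^ 2) ^ (n + 1) * u ^ (2 * m) =
        (2 * n + 2) * (n.factorial * Gamma (m + 1 / 2) / (2 * Gamma (m + n + 3 / 2))) := by
      linear_combination (2 * (n : ℝ) + 2) * h1 + h2
    have h4 : (2 * (n : ℝ) + 2 * m + 3) ≠ 0 := by positivity
    rw [← mul_right_inj' h4, h3]
    push_cast
    field_simp
    ring

theorem Gamma_nat_add_half_eq (n : ℕ) :
    Gamma ((n : ℝ) + 1 / 2) = (2 * n).factorial / (4 ^ n * n.factorial) * √π := by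
  induction n with
  | zero => simpa using Real.Gamma_one_half_eq
  | succ n ih =>
    rw [show ((n + 1 : ℕ) : ℝ) + 1 / 2 = ((n : ℝ) + 1 / 2) + 1 by push_cast; ring,
      Real.Gamma_add_one (by positivity), ih, show 2 * (n + 1) = 2 * n + 1 + 1 by ring,
      Nat.factorial_succ, Nat.factorial_succ, Nat.factorial_succ]
    push_cast
    field_simp
    ring

open Polynomial in
/-- The even Legendre polynomial `P₂ₖ` in powers of `u²`, with its leading coefficient. -/
theorem exists_legendreP_eval (k : ℕ) : ∃ a : ℕ → ℝ,
    (∀ u, (legendreP (2 * k)).eval u = ∑ i ∈ Finset.range (k + 1), a i * u ^ (2 * i)) ∧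
      a k = (4 * k).factorial / (4 ^ k * ((2 * k).factorial : ℝ) ^ 2) := by
  refine ⟨fun i => 1 / (2 ^ (2 * k) * ((2 * k).factorial : ℝ)) *
    ((-1) ^ (2 * k - (i + k)) * (2 * k).choose (i + k) * (2 * (i + k)).descFactorial (2 * k)),
    fun u => ?_, ?_⟩
  · have hb : ((X ^ 2 - 1 : Polynomial ℝ)) ^ (2 * k) = ∑ j ∈ Finset.range (2 * k + 1),
        C ((-1 : ℝ) ^ (2 * k - j) * (2 * k).choose j) * X ^ (2 * j) := by
      rw [sub_eq_add_neg, add_pow]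
      refine Finset.sum_congr rfl fun j _ => ?_
      rw [← pow_mul]
      simp only [map_mul, map_pow, map_neg, map_one, map_natCast]
      ring
    rw [legendreP, hb, iterate_derivative_sum]
    simp only [iterate_derivative_C_mul, iterate_derivative_X_pow_eq_C_mul, eval_mul, eval_C,
      eval_finsetSum, eval_pow, eval_X]
    rw [show 2 * k + 1 = k + (k + 1) by ring, Finset.sum_range_add]
    have h0 : ∑ j ∈ Finset.range k, (-1 : ℝ) ^ (2 * k - j) * (2 * k).choose j *
        (((2 * j).descFactorial (2 * k) : ℕ) * u ^ (2 * j - 2 * k)) = 0 := by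
      refine Finset.sum_eq_zero fun j hj => ?_
      have : (2 * j).descFactorial (2 * k) = 0 :=
        Nat.descFactorial_eq_zero_iff_lt.2 (by have := Finset.mem_range.1 hj; omega)
      simp [this]
    rw [h0, zero_add, Finset.mul_sum]
    refine Finset.sum_congr rfl fun i _ => ?_
    rw [add_comm k i, show 2 * (i + k) - 2 * k = 2 * i by omega]
    ring
  · have h := Nat.factorial_mul_descFactorial (n := 4 * k) (k := 2 * k) (by omega)
    rw [show 4 * k - 2 * k = 2 * k by omega] at h
    have h' : ((4 * k).factorial : ℝ) = (2 * k).factorial * (4 * k).descFactorial (2 * k) := by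
      exact_mod_cast h.symm
    simp only
    rw [show k + k = 2 * k by ring, Nat.sub_self, Nat.choose_self, pow_mul,
      show 2 * (2 * k) = 4 * k by ring, h']
    have := (2 * k).factorial_ne_zero
    field_simp
    norm_num
    ring

theorem legendreP_eval_neg (k : ℕ) (u : ℝ) :
    (legendreP (2 * k)).eval (-u) = (legendreP (2 * k)).eval u := by
  obtain ⟨a, ha, _⟩ := exists_legendreP_eval k
  simp [ha, pow_mul]

open Polynomial in
/-- Rodrigues' formula and `2k` integrations by parts reduce the moments of `P₂ₖ` to beta
integrals. The exponent `2 * p - 2 * k` truncates only where the first factor vanishes. -/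
theorem integral_legendreP_mul_pow (k p : ℕ) :
    ∫ u in (0 : ℝ)..1, (legendreP (2 * k)).eval u * u ^ (2 * p) =
      (2 * p).descFactorial (2 * k) / (4 ^ k * ((2 * k).factorial : ℝ)) *
        ∫ u in (0 : ℝ)..1, (1 - u ^ 2) ^ (2 * k) * u ^ (2 * p - 2 * k) := by
  have hc : ∀ f : ℝ → ℝ, Continuous f → (∀ t, f (-t) = f t) →
      ∫ u in (-1 : ℝ)..1, f u = 2 * ∫ u in (0 : ℝ)..1, f u := fun f hf he =>
    integral_symm_of_even he (hf.intervalIntegrable _ _)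
  have h1 := integral_iterate_derivative_mul (2 * k) (2 * k) le_rfl (X ^ (2 * p))
  have e1 : ∀ u : ℝ, (legendreP (2 * k)).eval u * u ^ (2 * p) =
      1 / (2 ^ (2 * k) * ((2 * k).factorial : ℝ)) *
        ((derivative^[2 * k] ((X ^ 2 - 1 : Polynomial ℝ) ^ (2 * k))).eval u *
          (X ^ (2 * p) : Polynomial ℝ).eval u) := fun u => by
    rw [legendreP, eval_mul, eval_C]; simp; ring
  have e2 : ∀ u : ℝ, ((X ^ 2 - 1 : Polynomial ℝ) ^ (2 * k)).eval u *
      (derivative^[2 * k] (X ^ (2 * p) : Polynomial ℝ)).eval u =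
      (2 * p).descFactorial (2 * k) * ((1 - u ^ 2) ^ (2 * k) * u ^ (2 * p - 2 * k)) := fun u => by
    rw [iterate_derivative_X_pow_eq_C_mul]
    simp only [eval_mul, eval_pow, eval_sub, eval_X, eval_one, eval_C]
    rw [← neg_sub (u ^ 2) 1, (even_two_mul k).neg_pow]
    ring
  have h2 := hc (fun u => (legendreP (2 * k)).eval u * u ^ (2 * p))
    ((Polynomial.continuous _).mul (by fun_prop))
    (fun t => by rw [legendreP_eval_neg, (even_two_mul p).neg_pow])
  have h3 := hc (fun u : ℝ => (1 - u ^ 2) ^ (2 * k) * u ^ (2 * p - 2 * k)) (by fun_prop)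
    (fun t => by rw [← Nat.mul_sub, (even_two_mul (p - k)).neg_pow, neg_sq])
  have h4 : ∫ u in (-1 : ℝ)..1, (legendreP (2 * k)).eval u * u ^ (2 * p) =
      1 / (2 ^ (2 * k) * ((2 * k).factorial : ℝ)) * ((2 * p).descFactorial (2 * k) *
        ∫ u in (-1 : ℝ)..1, (1 - u ^ 2) ^ (2 * k) * u ^ (2 * p - 2 * k)) := by
    simp only [e2, intervalIntegral.integral_const_mul] at h1
    simp only [e1, intervalIntegral.integral_const_mul]
    rw [h1, (even_two_mul k).neg_one_pow, one_mul]
  rw [h4, h3, show (2 : ℝ) ^ (2 * k) = 4 ^ k by rw [pow_mul]; norm_num] at h2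
  linear_combination (-1 / 2) * h2

/-- The even moments of `P₂ₖ` of order less than `2k` vanish. -/
theorem integral_legendreP_mul_pow_of_lt {k p : ℕ} (h : p < k) :
    ∫ u in (0 : ℝ)..1, (legendreP (2 * k)).eval u * u ^ (2 * p) = 0 := by
  rw [integral_legendreP_mul_pow, Nat.descFactorial_eq_zero_iff_lt.2 (by omega)]
  simp

theorem integral_legendreP_mul_pow_add (k r : ℕ) :
    ∫ u in (0 : ℝ)..1, (legendreP (2 * k)).eval u * u ^ (2 * (r + k)) =
      (2 * (r + k)).factorial * √π /
        (2 * 4 ^ (k + r) * r.factorial * Gamma (r + (2 * k : ℕ) + 3 / 2)) := by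
  rw [integral_legendreP_mul_pow, show 2 * (r + k) - 2 * k = 2 * r by omega,
    integral_one_sub_sq_pow_mul, Gamma_nat_add_half_eq]
  have h := Nat.factorial_mul_descFactorial (n := 2 * (r + k)) (k := 2 * k) (by omega)
  rw [show 2 * (r + k) - 2 * k = 2 * r by omega] at h
  have h' : ((2 * (r + k)).factorial : ℝ) =
      (2 * r).factorial * (2 * (r + k)).descFactorial (2 * k) := by exact_mod_cast h.symm
  have hpos : Gamma ((r : ℝ) + (2 * k : ℕ) + 3 / 2) ≠ 0 :=
    (Real.Gamma_pos_of_pos (by positivity)).ne'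
  rw [h']
  have h1 := (2 * k).factorial_ne_zero
  have h2 := r.factorial_ne_zero
  field_simp
  ring

/-- Orthogonality of the even Legendre polynomials on `[0, 1]`. -/
theorem integral_legendreP_mul_legendreP (k l : ℕ) :
    ∫ u in (0 : ℝ)..1, (legendreP (2 * k)).eval u * (legendreP (2 * l)).eval u =
      if k = l then 1 / (4 * (k : ℝ) + 1) else 0 := by
  wlog hkl : l ≤ k generalizing k l with H
  · have := H l k (by omega)
    simp only [mul_comm ((legendreP (2 * l)).eval _)] at this
    rw [this]
    by_cases h : k = l
    · omega
    · simp [h, Ne.symm h]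
  obtain ⟨a, ha, hak⟩ := exists_legendreP_eval l
  have e : ∀ u, (legendreP (2 * k)).eval u * (legendreP (2 * l)).eval u =
      ∑ i ∈ Finset.range (l + 1), a i * ((legendreP (2 * k)).eval u * u ^ (2 * i)) := fun u => by
    rw [ha, Finset.mul_sum]
    exact Finset.sum_congr rfl fun i _ => by ring
  have hi : ∀ i : ℕ, IntervalIntegrable
      (fun u => a i * ((legendreP (2 * k)).eval u * u ^ (2 * i))) volume 0 1 := fun i =>
    (((Polynomial.continuous _).mul (by fun_prop)).intervalIntegrable _ _).const_mul _
  simp only [e]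
  rw [intervalIntegral.integral_finsetSum fun i _ => hi i, Finset.sum_range_succ]
  simp only [intervalIntegral.integral_const_mul]
  rw [Finset.sum_eq_zero fun i hi => by
    rw [integral_legendreP_mul_pow_of_lt ((Finset.mem_range.1 hi).trans_le hkl), mul_zero], zero_add]
  split_ifs with h
  · subst h
    have hm := integral_legendreP_mul_pow_add k 0
    rw [zero_add] at hm
    have hG : Gamma (((0 : ℕ) : ℝ) + (2 * k : ℕ) + 3 / 2) =
        (4 * k + 2).factorial / (4 ^ (2 * k + 1) * (2 * k + 1).factorial) * √π := by
      have := Gamma_nat_add_half_eq (2 * k + 1)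
      rw [show 2 * (2 * k + 1) = 4 * k + 2 by ring] at this
      rw [← this]; congr 1; push_cast; ring
    rw [hm, hak, hG, show (4 * k + 2).factorial = (4 * k + 2) * ((4 * k + 1) * (4 * k).factorial) from rfl,
      show (2 * k + 1).factorial = (2 * k + 1) * (2 * k).factorial from rfl]
    have h1 := (2 * k).factorial_ne_zero
    have h2 := (4 * k).factorial_ne_zero
    have h3 : √π ≠ 0 := (Real.sqrt_pos.2 pi_pos).ne'
    push_cast
    rw [Nat.factorial_zero, add_zero]
    have h4 : (4 : ℝ) ^ (2 * k + 1) = 4 * (4 ^ k * 4 ^ k) := by ring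
    rw [h4]
    push_cast
    field_simp
    ring
  · rw [integral_legendreP_mul_pow_of_lt (by omega), mul_zero]

end Legendre

/-! ### Legendre expansions in `L²(0, π)` -/

section LegendreBasis

/-- The even Legendre polynomials on `(0, π)`, normalized in `L²`. -/
noncomputable def evenLegendre (k : ℕ) (t : ℝ) : ℝ :=
  √((4 * k + 1) / π) * (legendreP (2 * k)).eval (t / π)

theorem continuous_legendreP_div (k : ℕ) :
    Continuous fun t : ℝ => (legendreP (2 * k)).eval (t / π) :=
  (Polynomial.continuous _).comp (by fun_prop)

theorem memLp_of_continuous {f : ℝ → ℝ} (hf : Continuous f) :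
    MemLp f 2 (volume.restrict (Ioo (0 : ℝ) π)) := by
  obtain ⟨B, hB⟩ := (isCompact_Icc (a := 0) (b := π)).exists_bound_of_continuousOn hf.continuousOn
  refine MemLp.of_bound hf.aestronglyMeasurable B ?_
  filter_upwards [ae_restrict_mem measurableSet_Ioo] with t ht
  exact hB t ⟨ht.1.le, ht.2.le⟩

theorem memLp_evenLegendre (k : ℕ) :
    MemLp (evenLegendre k) 2 (volume.restrict (Ioo (0 : ℝ) π)) :=
  memLp_of_continuous (continuous_const.mul (continuous_legendreP_div k))

theorem inner_toLp {f g : ℝ → ℝ} (hf : MemLp f 2 (volume.restrict (Ioo (0 : ℝ) π)))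
    (hg : MemLp g 2 (volume.restrict (Ioo (0 : ℝ) π))) :
    inner ℝ (hf.toLp f) (hg.toLp g) = ∫ t in (0 : ℝ)..π, f t * g t := by
  rw [L2.inner_def, intervalIntegral.integral_of_le pi_pos.le, integral_Ioc_eq_integral_Ioo]
  refine integral_congr_ae ?_
  filter_upwards [hf.coeFn_toLp, hg.coeFn_toLp] with t h1 h2
  rw [h1, h2]
  simp [mul_comm]

theorem orthonormal_evenLegendre :
    Orthonormal ℝ fun k => (memLp_evenLegendre k).toLp (evenLegendre k) := by
  rw [orthonormal_iff_ite]
  intro k l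
  rw [inner_toLp]
  have e : ∀ t, evenLegendre k t * evenLegendre l t = √((4 * k + 1) / π) * √((4 * l + 1) / π) *
      ((fun u => (legendreP (2 * k)).eval u * (legendreP (2 * l)).eval u) (t / π)) := fun t => by
    simp only [evenLegendre]; ring
  simp only [e]
  rw [intervalIntegral.integral_const_mul]
  have h := intervalIntegral.integral_comp_div (a := 0) (b := π)
    (fun u => (legendreP (2 * k)).eval u * (legendreP (2 * l)).eval u) pi_ne_zero
  rw [zero_div, div_self pi_ne_zero, integral_legendreP_mul_legendreP] at h
  rw [h]
  split_ifs with hkl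
  · subst hkl
    rw [Real.mul_self_sqrt (by positivity), smul_eq_mul]
    field_simp
  · simp

theorem memLp_intervalIntegrable {f : ℝ → ℝ} (hf : MemLp f 2 (volume.restrict (Ioo (0 : ℝ) π))) :
    IntervalIntegrable f volume 0 π := by
  rw [intervalIntegrable_iff_integrableOn_Ioc_of_le pi_pos.le]
  exact integrableOn_potential hf

theorem memLp_mul_intervalIntegrable {f g : ℝ → ℝ}
    (hf : MemLp f 2 (volume.restrict (Ioo (0 : ℝ) π))) (hg : Continuous g) :
    IntervalIntegrable (fun t => f t * g t) volume 0 π :=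
  (memLp_intervalIntegrable hf).mul_continuousOn hg.continuousOn

/-- Completeness of the even Legendre polynomials in `L²(0, π)`. -/
theorem ae_eq_zero_of_integral_legendreP {f : ℝ → ℝ}
    (hf : MemLp f 2 (volume.restrict (Ioo (0 : ℝ) π)))
    (h0 : ∀ k, ∫ t in (0 : ℝ)..π, f t * (legendreP (2 * k)).eval (t / π) = 0) :
    ∀ᵐ t ∂(volume.restrict (Ioo (0 : ℝ) π)), f t = 0 := by
  have hi : ∀ g : ℝ → ℝ, Continuous g → IntervalIntegrable (fun t => f t * g t) volume 0 π :=
    fun g hg => memLp_mul_intervalIntegrable hf hg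
  have hmom : ∀ m : ℕ, ∫ t in (0 : ℝ)..π, f t * (t / π) ^ (2 * m) = 0 := by
    intro m
    induction m using Nat.strong_induction_on with
    | _ m ih =>
      obtain ⟨a, ha, ham⟩ := exists_legendreP_eval m
      have ha0 : a m ≠ 0 := by
        rw [ham]
        have h1 := (4 * m).factorial_ne_zero
        have h2 := (2 * m).factorial_ne_zero
        positivity
      have h := h0 m
      have e : ∀ t, f t * (legendreP (2 * m)).eval (t / π) =
          ∑ i ∈ Finset.range (m + 1), a i * (f t * (t / π) ^ (2 * i)) := fun t => by
        rw [ha, Finset.mul_sum]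
        exact Finset.sum_congr rfl fun i _ => by ring
      simp only [e] at h
      rw [intervalIntegral.integral_finsetSum fun i _ => (hi _ (by fun_prop)).const_mul _,
        Finset.sum_range_succ, Finset.sum_eq_zero fun i hi => by
          rw [intervalIntegral.integral_const_mul, ih i (Finset.mem_range.1 hi), mul_zero],
        zero_add, intervalIntegral.integral_const_mul] at h
      exact (mul_eq_zero.1 h).resolve_left ha0
  refine ae_eq_zero_of_polynomial_moments (c := 0) (d := 1) (w := fun t => (t / π) ^ 2)
    (v := fun u => π * √u) (hf.integrable (by norm_num)) (by fun_prop) (fun t ht => ?_)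
    (by fun_prop) (fun t ht => ?_) (fun p => ?_)
  · have h1 : t / π ≤ 1 := (div_le_one pi_pos).2 ht.2
    have h2 : 0 ≤ t / π := div_nonneg ht.1 pi_pos.le
    exact ⟨by positivity, pow_le_one₀ h2 h1⟩
  · rw [Real.sqrt_sq (div_nonneg ht.1 pi_pos.le)]
    field_simp
  · rw [← integral_Ioc_eq_integral_Ioo, ← intervalIntegral.integral_of_le pi_pos.le]
    have hc : Continuous fun t : ℝ => (t / π) ^ 2 := by fun_prop
    induction p using Polynomial.induction_on' with
    | add p r hp hr =>
      simp only [Polynomial.eval_add, mul_add]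
      rw [intervalIntegral.integral_add
        (hi (fun t => p.eval ((t / π) ^ 2)) (p.continuous.comp hc))
        (hi (fun t => r.eval ((t / π) ^ 2)) (r.continuous.comp hc)), hp, hr, add_zero]
    | monomial n k =>
      simp only [Polynomial.eval_monomial, mul_left_comm _ k, ← pow_mul]
      rw [intervalIntegral.integral_const_mul, hmom, mul_zero]

theorem span_evenLegendre_orthogonal :
    (Submodule.span ℝ (range fun k => (memLp_evenLegendre k).toLp (evenLegendre k)))ᗮ = ⊥ := by
  rw [Submodule.eq_bot_iff]
  intro f hf
  rw [Submodule.mem_orthogonal] at hf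
  have hfm := Lp.memLp f
  have hft : hfm.toLp f = f := Lp.toLp_coeFn f hfm
  have h0 : ∀ k, ∫ t in (0 : ℝ)..π, f t * (legendreP (2 * k)).eval (t / π) = 0 := fun k => by
    have h := hf _ (Submodule.subset_span ⟨k, rfl⟩)
    simp only at h
    rw [← hft, inner_toLp (memLp_evenLegendre k) hfm] at h
    have e : ∀ t, evenLegendre k t * f t =
        √((4 * k + 1) / π) * (f t * (legendreP (2 * k)).eval (t / π)) := fun t => by
      simp only [evenLegendre]; ring
    simp only [e] at h
    rw [intervalIntegral.integral_const_mul] at h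
    have hs : √((4 * k + 1) / π) ≠ 0 := (Real.sqrt_pos.2 (by positivity)).ne'
    exact (mul_eq_zero.1 h).resolve_left hs
  have := ae_eq_zero_of_integral_legendreP hfm h0
  exact (Lp.eq_zero_iff_ae_eq_zero).2 this

/-- Parseval's identity for the even Legendre polynomials in `L²(0, π)`. -/
theorem hasSum_legendre {f g : ℝ → ℝ} (hf : MemLp f 2 (volume.restrict (Ioo (0 : ℝ) π)))
    (hg : MemLp g 2 (volume.restrict (Ioo (0 : ℝ) π))) :
    HasSum (fun k : ℕ => (4 * k + 1) / π *
      (∫ t in (0 : ℝ)..π, f t * (legendreP (2 * k)).eval (t / π)) *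
      ∫ t in (0 : ℝ)..π, (legendreP (2 * k)).eval (t / π) * g t) (∫ t in (0 : ℝ)..π, f t * g t) := by
  have h := (HilbertBasis.mkOfOrthogonalEqBot orthonormal_evenLegendre
    span_evenLegendre_orthogonal).hasSum_inner_mul_inner (hf.toLp f) (hg.toLp g)
  rw [inner_toLp] at h
  refine h.congr_fun ?_
  intro k
  rw [HilbertBasis.coe_mkOfOrthogonalEqBot, inner_toLp, inner_toLp]
  have e1 : ∀ t, f t * evenLegendre k t =
      √((4 * k + 1) / π) * (f t * (legendreP (2 * k)).eval (t / π)) := fun t => by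
    simp only [evenLegendre]; ring
  have e2 : ∀ t, evenLegendre k t * g t =
      √((4 * k + 1) / π) * ((legendreP (2 * k)).eval (t / π) * g t) := fun t => by
    simp only [evenLegendre]; ring
  simp only [e1, e2, intervalIntegral.integral_const_mul]
  have hs : √((4 * k + 1) / π) * √((4 * k + 1) / π) = (4 * k + 1) / π :=
    Real.mul_self_sqrt (by positivity)
  linear_combination (-(∫ t in (0 : ℝ)..π, f t * (legendreP (2 * k)).eval (t / π)) *
      ∫ t in (0 : ℝ)..π, (legendreP (2 * k)).eval (t / π) * g t) * hs

end LegendreBasis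

/-! ### Spherical Bessel functions as Legendre coefficients -/

section Bessel

/-- The terms of the power series of the spherical Bessel function `j_k`. -/
noncomputable def sphericalTerm (k : ℕ) (z : ℝ) (m : ℕ) : ℝ :=
  √π / 2 * ((-1) ^ m / (m.factorial * Gamma (m + k + 3 / 2)) * (z / 2) ^ (2 * m + k))

theorem sphericalJ_eq_tsum (k : ℕ) {z : ℝ} (hz : 0 < z) :
    sphericalJ k z = ∑' m, sphericalTerm k z m := by
  rw [sphericalJ, besselJ, ← tsum_mul_left]
  refine tsum_congr fun m => ?_
  have e1 : (z / 2) ^ (2 * (m : ℝ) + ((k : ℝ) + 1 / 2)) = (z / 2) ^ (2 * m + k) * √(z / 2) := by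
    rw [← add_assoc, Real.rpow_add (by positivity), Real.sqrt_eq_rpow, ← Real.rpow_natCast]
    push_cast; rfl
  have e2 : √(π / (2 * z)) * √(z / 2) = √π / 2 := by
    rw [← Real.sqrt_mul (by positivity), show π / (2 * z) * (z / 2) = π / 2 ^ 2 by field_simp,
      Real.sqrt_div pi_pos.le, Real.sqrt_sq (by norm_num)]
  rw [e1, sphericalTerm, ← e2, show (m : ℝ) + (k + 1 / 2) + 1 = m + k + 3 / 2 by ring]
  ring

/-- Termwise integration of a power series against a continuous function. -/
theorem hasSum_integral_mul_of_bound {g : ℝ → ℝ} (hg : Continuous g) {c : ℕ → ℝ} {e : ℕ → ℕ}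
    {f : ℝ → ℝ} (hc : Summable fun m => |c m|)
    (hf : ∀ u ∈ Icc (0 : ℝ) 1, HasSum (fun m => c m * u ^ e m) (f u)) :
    HasSum (fun m => c m * ∫ u in (0 : ℝ)..1, g u * u ^ e m) (∫ u in (0 : ℝ)..1, g u * f u) := by
  obtain ⟨B, hB⟩ := (isCompact_Icc (a := 0) (b := 1)).exists_bound_of_continuousOn hg.continuousOn
  have hB0 : 0 ≤ B := (norm_nonneg _).trans (hB 0 ⟨le_rfl, zero_le_one⟩)
  have h := intervalIntegral.hasSum_integral_of_dominated_convergence (a := 0) (b := 1)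
    (μ := volume) (F := fun m u => c m * (g u * u ^ e m)) (f := fun u => g u * f u)
    (fun m _ => |c m| * B)
    (fun m => (by fun_prop : Continuous fun u => c m * (g u * u ^ e m)).aestronglyMeasurable)
    (fun m => Filter.Eventually.of_forall fun u hu => by
      rw [uIoc_of_le zero_le_one] at hu
      rw [norm_mul, norm_mul, norm_pow, Real.norm_eq_abs, Real.norm_of_nonneg hu.1.le]
      have h1 : u ^ e m ≤ 1 := pow_le_one₀ hu.1.le hu.2
      have h2 := hB u ⟨hu.1.le, hu.2⟩
      have h3 : 0 ≤ u ^ e m := pow_nonneg hu.1.le _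
      gcongr
      calc ‖g u‖ * u ^ e m ≤ B * 1 := by gcongr
        _ = B := mul_one B)
    (Filter.Eventually.of_forall fun u _ => hc.mul_right B)
    (by simp)
    (Filter.Eventually.of_forall fun u hu => by
      rw [uIoc_of_le zero_le_one] at hu
      have := (hf u ⟨hu.1.le, hu.2⟩).mul_left (g u)
      refine this.congr_fun fun m => ?_
      ring)
  simpa only [intervalIntegral.integral_const_mul] using h

theorem summable_abs_pow_div_factorial (z : ℝ) {e : ℕ → ℕ} (he : Function.Injective e) :
    Summable fun m : ℕ => |(-1) ^ m * z ^ e m / (e m).factorial| := by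
  have := (Real.summable_pow_div_factorial |z|).comp_injective he
  refine this.congr fun m => ?_
  simp [abs_div, abs_mul, abs_pow]

/-- The terms of the power series of `(-1)ᵏ j₂ₖ` are those of the cosine moments of `P₂ₖ`, shifted
by `k` because the lower moments vanish. -/
theorem sphericalTerm_eq (k r : ℕ) (z : ℝ) :
    sphericalTerm (2 * k) z r = (-1) ^ k * ((-1) ^ (r + k) * z ^ (2 * (r + k)) /
      (2 * (r + k)).factorial *
        ∫ u in (0 : ℝ)..1, (legendreP (2 * k)).eval u * u ^ (2 * (r + k))) := by
  rw [integral_legendreP_mul_pow_add, sphericalTerm]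
  have h1 := (2 * (r + k)).factorial_ne_zero
  have h2 := r.factorial_ne_zero
  have h3 : Gamma ((r : ℝ) + (2 * k : ℕ) + 3 / 2) ≠ 0 :=
    (Real.Gamma_pos_of_pos (by positivity)).ne'
  have h4 : ((-1 : ℝ)) ^ (r + k) * (-1) ^ k = (-1) ^ r := by
    rw [pow_add, mul_assoc, ← mul_pow]; simp
  have h5 : (2 : ℝ) ^ (2 * r + 2 * k) = 4 ^ (k + r) := by
    rw [← mul_add, pow_mul, add_comm]; norm_num
  rw [div_pow, h5, ← h4, show 2 * (r + k) = 2 * r + 2 * k by ring]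
  rw [show 2 * (r + k) = 2 * r + 2 * k by ring] at h1
  field_simp

/-- Termwise form of `j_{2k+1}(z) = (2k/z) j_{2k}(z) - j_{2k}'(z)`. -/
theorem sphericalTerm_succ (k r : ℕ) {z : ℝ} (hz : 0 < z) :
    sphericalTerm (2 * k + 1) z r =
      -(2 * ((r + 1 : ℕ) : ℝ) / z * sphericalTerm (2 * k) z (r + 1)) := by
  rw [sphericalTerm, sphericalTerm, Nat.factorial_succ,
    show ((r + 1 : ℕ) : ℝ) + (2 * k : ℕ) + 3 / 2 = r + (2 * k + 1 : ℕ) + 3 / 2 by push_cast; ring]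
  have h2 := r.factorial_ne_zero
  have h3 : Gamma ((r : ℝ) + (2 * k + 1 : ℕ) + 3 / 2) ≠ 0 :=
    (Real.Gamma_pos_of_pos (by positivity)).ne'
  rw [show 2 * (r + 1) + 2 * k = (2 * r + (2 * k + 1)) + 1 by ring, pow_succ (z / 2)]
  push_cast
  field_simp
  ring

/-- The sine moments of the even Legendre polynomials, by comparison of power series. -/
theorem integral_legendreP_mul_sin (k : ℕ) {z : ℝ} (hz : 0 < z) :
    ∫ u in (0 : ℝ)..1, (legendreP (2 * k)).eval u * (u * sin (z * u)) =
      (-1) ^ k * (sphericalJ (2 * k + 1) z - 2 * k / z * sphericalJ (2 * k) z) := by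
  have hP : Continuous fun u : ℝ => (legendreP (2 * k)).eval u := Polynomial.continuous _
  set T : ℕ → ℝ := fun m => (-1) ^ m * z ^ (2 * m) / (2 * m).factorial *
    ∫ u in (0 : ℝ)..1, (legendreP (2 * k)).eval u * u ^ (2 * m) with hT
  have hTz : ∀ m < k, T m = 0 := fun m hm => by
    simp only [hT, integral_legendreP_mul_pow_of_lt hm, mul_zero]
  have hTs : ∀ r, sphericalTerm (2 * k) z r = (-1) ^ k * T (r + k) := fun r => sphericalTerm_eq k r z
  have hcos : HasSum T (∫ u in (0 : ℝ)..1, (legendreP (2 * k)).eval u * cos (z * u)) := by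
    refine hasSum_integral_mul_of_bound hP (e := fun m => 2 * m)
      (summable_abs_pow_div_factorial z fun a b h => by simpa using h) fun u _ => ?_
    refine (Real.hasSum_cos (z * u)).congr_fun fun m => ?_
    rw [mul_pow]; ring
  have hsin : HasSum (fun m : ℕ => 2 * (m : ℝ) / z * T m)
      (-∫ u in (0 : ℝ)..1, (legendreP (2 * k)).eval u * (u * sin (z * u))) := by
    have h := hasSum_integral_mul_of_bound hP (e := fun m => 2 * m + 2)
      (c := fun m => (-1) ^ m * z ^ (2 * m + 1) / (2 * m + 1).factorial)
      (f := fun u => u * sin (z * u))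
      (summable_abs_pow_div_factorial z (e := fun m => 2 * m + 1) fun a b h => by simpa using h)
      fun u _ => by
        refine ((Real.hasSum_sin (z * u)).mul_left u).congr_fun fun m => ?_
        rw [mul_pow]; ring
    rw [← hasSum_nat_add_iff' 1]
    simp only [Finset.range_one, Finset.sum_singleton, Nat.cast_zero, mul_zero, zero_div, zero_mul,
      sub_zero]
    refine h.neg.congr_fun fun m => ?_
    simp only [hT]
    rw [show 2 * (m + 1) = 2 * m + 1 + 1 by ring, Nat.factorial_succ (2 * m + 1), pow_succ z (2 * m + 1)]
    have h1 := (2 * m + 1).factorial_ne_zero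
    push_cast
    field_simp
    ring
  have shift : ∀ {f : ℕ → ℝ} {a : ℝ}, (∀ m < k, f m = 0) → HasSum f a →
      HasSum (fun r => f (r + k)) a := fun h0 h => by
    have := (hasSum_nat_add_iff' k).2 h
    rwa [Finset.sum_eq_zero fun i hi => h0 i (Finset.mem_range.1 hi), sub_zero] at this
  have h1 : HasSum (sphericalTerm (2 * k) z)
      ((-1) ^ k * ∫ u in (0 : ℝ)..1, (legendreP (2 * k)).eval u * cos (z * u)) :=
    ((shift hTz hcos).mul_left ((-1) ^ k)).congr_fun hTs
  have h2 := (shift (f := fun m : ℕ => 2 * (m : ℝ) / z * T m)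
    (fun m hm => by rw [hTz m hm, mul_zero]) hsin).mul_left ((-1) ^ k)
  have h3 := h2.sub (h1.mul_left (2 * k / z))
  have h4 : HasSum (fun r : ℕ => 2 * (r : ℝ) / z * sphericalTerm (2 * k) z r) _ :=
    h3.congr_fun fun r => by
      rw [hTs r]
      push_cast
      ring
  rw [← hasSum_nat_add_iff' 1] at h4
  have h5 : HasSum (sphericalTerm (2 * k + 1) z) _ := h4.neg.congr_fun fun r => sphericalTerm_succ k r hz
  rw [sphericalJ_eq_tsum _ hz, sphericalJ_eq_tsum _ hz, h1.tsum_eq, h5.tsum_eq]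
  simp only [Finset.range_one, Finset.sum_singleton, Nat.cast_zero, mul_zero, zero_div, zero_mul,
    sub_zero]
  have h6 : ((-1 : ℝ)) ^ k * (-1) ^ k = 1 := by rw [← mul_pow]; simp
  linear_combination (-(∫ u in (0 : ℝ)..1, (legendreP (2 * k)).eval u * (u * sin (z * u)))) * h6

/-- The sine moments of `P₂ₖ(t / π)` on `[0, π]`. -/
theorem integral_legendreP_div_pi_mul_sin (k : ℕ) {ρ : ℝ} (hρ : 0 < ρ) :
    ∫ t in (0 : ℝ)..π, (legendreP (2 * k)).eval (t / π) * (t * sin (ρ * t)) =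
      π * (-1) ^ k * (π * sphericalJ (2 * k + 1) (ρ * π) -
        2 * k / ρ * sphericalJ (2 * k) (ρ * π)) := by
  have h := intervalIntegral.integral_comp_div (a := 0) (b := π)
    (fun u => (legendreP (2 * k)).eval u * (u * sin (ρ * π * u))) pi_ne_zero
  rw [zero_div, div_self pi_ne_zero, integral_legendreP_mul_sin k (by positivity)] at h
  have e : ∀ t, (legendreP (2 * k)).eval (t / π) * (t * sin (ρ * t)) =
      π * ((legendreP (2 * k)).eval (t / π) * (t / π * sin (ρ * π * (t / π)))) := fun t => by
    rw [show ρ * π * (t / π) = ρ * t by field_simp]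
    field_simp
  simp only [e]
  rw [intervalIntegral.integral_const_mul, h, smul_eq_mul]
  field_simp

end Bessel

/-! ### Green's formula -/

section Green

open Filter Topology

/-- The product rule for indefinite integrals of integrable functions, in integrated form. -/
theorem integral_mul_primitive {f g F G : ℝ → ℝ} (hf : IntervalIntegrable f volume 0 π)
    (hg : IntervalIntegrable g volume 0 π)
    (hF : ∀ x ∈ Icc 0 π, F x = F 0 + ∫ t in (0 : ℝ)..x, f t)
    (hG : ∀ x ∈ Icc 0 π, G x = G 0 + ∫ t in (0 : ℝ)..x, g t) :
    ∫ x in (0 : ℝ)..π, (f x * G x + F x * g x) = F π * G π - F 0 * G 0 := by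
  have hp : π ∈ Icc 0 π := ⟨pi_pos.le, le_rfl⟩
  have hu : (0 : ℝ) ∈ uIcc 0 π := left_mem_uIcc
  have ac : ∀ {f : ℝ → ℝ} (a : ℝ), IntervalIntegrable f volume 0 π →
      AbsolutelyContinuousOnInterval (fun x => a + ∫ t in (0 : ℝ)..x, f t) 0 π := fun {f} a hf => by
    have h1 := hf.absolutelyContinuousOnInterval_intervalIntegral hu
    have h2 : AbsolutelyContinuousOnInterval (fun _ : ℝ => a) 0 π :=
      ((LipschitzWith.const a).lipschitzOnWith).absolutelyContinuousOnInterval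
    exact h2.add h1
  have h := AbsolutelyContinuousOnInterval.integral_deriv_mul_eq_sub (ac (F 0) hf) (ac (G 0) hg)
  simp only [intervalIntegral.integral_same, add_zero, ← hF π hp, ← hG π hp] at h
  rw [← h]
  refine intervalIntegral.integral_congr_ae ?_
  filter_upwards [hf.ae_hasDerivAt_integral, hg.ae_hasDerivAt_integral] with x h1 h2 hx
  have hx' : x ∈ uIcc 0 π := uIoc_subset_uIcc hx
  have hxI : x ∈ Icc 0 π := by rwa [uIcc_of_le pi_pos.le] at hx'
  rw [((h1 hx' 0 hu).const_add (F 0)).deriv, ((h2 hx' 0 hu).const_add (G 0)).deriv,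
    ← hF x hxI, ← hG x hxI]

variable {q : ℝ → ℝ} {h H : ℝ}

theorem SLSolution.continuousOn_deriv {μ : ℝ} {y dy : ℝ → ℝ}
    (hq : MemLp q 2 (volume.restrict (Ioo (0 : ℝ) π))) (S : SLSolution ℝ q μ y dy) :
    ContinuousOn dy (Icc 0 π) := by
  have hi := S.intervalIntegrable hq
  rw [intervalIntegrable_iff_integrableOn_Icc_of_le pi_pos.le, ← uIcc_of_le pi_pos.le] at hi
  have := (continuousOn_const (c := dy 0)).add (intervalIntegral.continuousOn_primitive_interval hi)
  rw [uIcc_of_le pi_pos.le] at this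
  exact this.congr fun x hx => S.integral_eq x hx

theorem SLSolution.eq_primitive {μ : ℝ} {y dy : ℝ → ℝ}
    (hq : MemLp q 2 (volume.restrict (Ioo (0 : ℝ) π))) (S : SLSolution ℝ q μ y dy) {x : ℝ}
    (hx : x ∈ Icc 0 π) : y x = y 0 + ∫ t in (0 : ℝ)..x, dy t := by
  have hsub : Icc 0 x ⊆ Icc 0 π := Icc_subset_Icc_right hx.2
  rw [intervalIntegral.integral_eq_sub_of_hasDerivAt_of_le hx.1 (S.continuousOn.mono hsub)
    (fun t ht => (S.hasDeriv t (hsub ⟨ht.1.le, ht.2.le⟩)).hasDerivAt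
      (Icc_mem_nhds ht.1 (ht.2.trans_le hx.2)))
    ((S.continuousOn_deriv hq).mono hsub |>.intervalIntegrable_of_Icc hx.1)]
  ring

/-- Green's formula for two normalized solutions. -/
theorem SLPhi.green {μ₁ μ₂ : ℝ} {y₁ dy₁ y₂ dy₂ : ℝ → ℝ}
    (hq : MemLp q 2 (volume.restrict (Ioo (0 : ℝ) π)))
    (S₁ : SLPhi ℝ q h μ₁ y₁ dy₁) (S₂ : SLPhi ℝ q h μ₂ y₂ dy₂) :
    y₁ π * dy₂ π - y₂ π * dy₁ π = (μ₁ - μ₂) * ∫ x in (0 : ℝ)..π, y₁ x * y₂ x := by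
  have i : ∀ {μ : ℝ} {y dy : ℝ → ℝ}, SLPhi ℝ q h μ y dy → IntervalIntegrable dy volume 0 π :=
    fun S => (S.toSLSolution.continuousOn_deriv hq).intervalIntegrable_of_Icc pi_pos.le
  have c : ∀ {μ : ℝ} {y dy : ℝ → ℝ}, SLPhi ℝ q h μ y dy → ContinuousOn y (uIcc 0 π) :=
    fun S => by rw [uIcc_of_le pi_pos.le]; exact S.toSLSolution.continuousOn
  have cd : ∀ {μ : ℝ} {y dy : ℝ → ℝ}, SLPhi ℝ q h μ y dy → ContinuousOn dy (uIcc 0 π) :=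
    fun S => by rw [uIcc_of_le pi_pos.le]; exact S.toSLSolution.continuousOn_deriv hq
  have j₁ := S₁.toSLSolution.intervalIntegrable hq
  have j₂ := S₂.toSLSolution.intervalIntegrable hq
  have e₁ := integral_mul_primitive (i S₁) j₂ (fun x hx => S₁.toSLSolution.eq_primitive hq hx)
    S₂.integral_eq
  have e₂ := integral_mul_primitive (i S₂) j₁ (fun x hx => S₂.toSLSolution.eq_primitive hq hx)
    S₁.integral_eq
  rw [S₁.init, S₂.init, S₁.init_deriv, S₂.init_deriv] at *
  simp only [RCLike.ofReal_real_eq_id, id_eq] at j₁ j₂ e₁ e₂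
  have k₁ := ((i S₁).mul_continuousOn (cd S₂)).add (j₂.continuousOn_mul (c S₁))
  have k₂ := ((i S₂).mul_continuousOn (cd S₁)).add (j₁.continuousOn_mul (c S₂))
  rw [← intervalIntegral.integral_const_mul]
  have e₃ : y₁ π * dy₂ π - y₂ π * dy₁ π = (∫ x in (0 : ℝ)..π, (dy₁ x * dy₂ x +
      y₁ x * (((q x : ℝ) - μ₂) * y₂ x))) - ∫ x in (0 : ℝ)..π, (dy₂ x * dy₁ x +
      y₂ x * (((q x : ℝ) - μ₁) * y₁ x)) := by
    rw [e₁, e₂]; ring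
  rw [e₃, ← intervalIntegral.integral_sub k₁ k₂]
  congr 1; ext x; ring

end Green

/-! ### The characteristic function and its derivative -/

section Characteristic

open Filter Topology

variable {q : ℝ → ℝ} {h H : ℝ} {G : ℝ → ℝ → ℝ} {C : ℝ}

/-- The real form of `transmutedCos`, for real `ρ`. -/
noncomputable def transmutedCosReal (G : ℝ → ℝ → ℝ) (ρ x : ℝ) : ℝ :=
  cos (ρ * x) + ∫ t in (0 : ℝ)..x, G x t * cos (ρ * t)

theorem transmutedCos_ofReal (G : ℝ → ℝ → ℝ) (ρ x : ℝ) :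
    transmutedCos G ρ x = (transmutedCosReal G ρ x : ℂ) := by
  rw [transmutedCos, transmutedCosReal]
  push_cast
  rw [← intervalIntegral.integral_ofReal]
  simp

theorem continuous_transmutedCosReal (hG : Continuous fun p : ℝ × ℝ => G p.1 p.2) :
    Continuous fun p : ℝ × ℝ => transmutedCosReal G p.1 p.2 := by
  have h1 : Continuous fun p : ℝ × ℝ => ∫ t in (0 : ℝ)..p.2, G p.2 t * cos (p.1 * t) := by
    refine intervalIntegral.continuous_parametric_intervalIntegral_of_continuous
      (f := fun (p : ℝ × ℝ) t => G p.2 t * cos (p.1 * t)) ?_ continuous_snd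
    exact (hG.comp (by fun_prop : Continuous fun r : (ℝ × ℝ) × ℝ => (r.1.2, r.2))).mul (by fun_prop)
  exact (by fun_prop : Continuous fun p : ℝ × ℝ => cos (p.1 * p.2)).add h1

/-- The characteristic function `φ'(ρ, π) + H φ(ρ, π)` in terms of
`F = G_x(π, ·) + H G(π, ·)`. -/
noncomputable def slCharFun (ω : ℝ) (F : ℝ → ℝ) (ρ : ℝ) : ℝ :=
  -(ρ * sin (ρ * π)) + ω * cos (ρ * π) + ∫ t in (0 : ℝ)..π, F t * cos (ρ * t)

/-- For real `ρ` the normalized solution is the real transmuted cosine, and its right boundary form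
is the characteristic function. -/
theorem exists_slPhi_transmutedCosReal (hq : Integrable q) (hq2 : Integrable fun t => q t ^ 2)
    (hsupp : ∀ x ∉ Ioo 0 π, q x = 0) (hqm : MemLp q 2 (volume.restrict (Ioo (0 : ℝ) π)))
    (hG : Continuous fun p : ℝ × ℝ => G p.1 p.2) (hC0 : 0 ≤ C) (hC : ∀ s τ, |G s τ| ≤ C)
    (hGe : ∀ x ∈ Icc 0 π, ∀ t ∈ Icc 0 π, G x t = goursatFree q h x t + goursatOp q G x t)
    (H ρ : ℝ) :
    ∃ dy : ℝ → ℝ, SLPhi ℝ q h (ρ ^ 2) (transmutedCosReal G ρ) dy ∧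
      dy π + H * transmutedCosReal G ρ π =
        slCharFun (slOmega q h H) (fun t => goursatDx q G t + H * G π t) ρ := by
  obtain ⟨dZ, hZ, hd⟩ := exists_slPhi_transmutedCos hq hsupp hG hC0 hC hGe (ρ : ℂ)
  have hre := SLPhi.re (μ := ρ ^ 2) hqm (by push_cast; exact hZ)
  have hfun : (fun x => (transmutedCos G ρ x).re) = transmutedCosReal G ρ := by
    ext x; rw [transmutedCos_ofReal, Complex.ofReal_re]
  rw [hfun] at hre
  refine ⟨_, hre, ?_⟩
  have hcos : ∀ t : ℝ, Complex.cos ((ρ : ℂ) * t) = ((cos (ρ * t) : ℝ) : ℂ) := fun t => by push_cast; rfl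
  have h1 : -(ρ : ℂ) ^ 2 * cosPrim ρ π = ((-(ρ * sin (ρ * π)) : ℝ) : ℂ) := by
    rw [neg_mul, sq, mul_assoc, mul_cosPrim]; push_cast; ring
  have h2 : ∫ t in (0 : ℝ)..π, (goursatDx q G t : ℂ) * Complex.cos ((ρ : ℂ) * t) =
      ((∫ t in (0 : ℝ)..π, goursatDx q G t * cos (ρ * t) : ℝ) : ℂ) := by
    rw [← intervalIntegral.integral_ofReal]; simp
  rw [h1, h2, hcos, ← Complex.ofReal_mul, ← Complex.ofReal_add, ← Complex.ofReal_add] at hd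
  rw [hd, Complex.ofReal_re, slCharFun, transmutedCosReal, slOmega]
  have hGc : Continuous (G π) := hG.comp (by fun_prop : Continuous fun t : ℝ => (π, t))
  have e : ∀ t, (goursatDx q G t + H * G π t) * cos (ρ * t) =
      goursatDx q G t * cos (ρ * t) + H * (G π t * cos (ρ * t)) := fun t => by ring
  simp only [e]
  rw [intervalIntegral.integral_add
    ((intervalIntegrable_goursatDx hq hq2 hG hC0 hC).mul_continuousOn (by fun_prop))
    ((by fun_prop : Continuous fun t => H * (G π t * cos (ρ * t))).intervalIntegrable _ _),
    intervalIntegral.integral_const_mul]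
  ring

/-- The divided difference of `cos (ρ t)` with respect to `ρ²`. -/
noncomputable def cosSlope (ρ₀ ρ t : ℝ) : ℝ := (cos (ρ * t) - cos (ρ₀ * t)) / (ρ ^ 2 - ρ₀ ^ 2)

/-- The divided differences are bounded uniformly in `ρ`, which allows to pass to the limit under the
integral. -/
theorem abs_cosSlope_le {ρ₀ ρ : ℝ} (h0 : 0 ≤ ρ₀) (h1 : ρ₀ < ρ) (t : ℝ) :
    |cosSlope ρ₀ ρ t| ≤ t ^ 2 / 2 := by
  have hpos : 0 < ρ ^ 2 - ρ₀ ^ 2 := by nlinarith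
  rw [cosSlope, abs_div, abs_of_pos hpos, div_le_iff₀ hpos, Real.cos_sub_cos, abs_mul, abs_mul]
  have e1 := Real.abs_sin_le_abs (x := (ρ * t + ρ₀ * t) / 2)
  have e2 := Real.abs_sin_le_abs (x := (ρ * t - ρ₀ * t) / 2)
  have e3 : |(ρ * t + ρ₀ * t) / 2| = (ρ + ρ₀) * |t| / 2 := by
    rw [← add_mul, abs_div, abs_mul, abs_of_pos (by linarith : 0 < ρ + ρ₀)]; norm_num
  have e4 : |(ρ * t - ρ₀ * t) / 2| = (ρ - ρ₀) * |t| / 2 := by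
    rw [← sub_mul, abs_div, abs_mul, abs_of_pos (by linarith : 0 < ρ - ρ₀)]; norm_num
  rw [e3] at e1
  rw [e4] at e2
  calc |(-2 : ℝ)| * |sin ((ρ * t + ρ₀ * t) / 2)| * |sin ((ρ * t - ρ₀ * t) / 2)|
      ≤ 2 * ((ρ + ρ₀) * |t| / 2) * ((ρ - ρ₀) * |t| / 2) := by
        gcongr
        · exact mul_nonneg (by norm_num) (div_nonneg (mul_nonneg (by linarith) (abs_nonneg t)) (by norm_num))
        · norm_num
    _ = |t| ^ 2 / 2 * (ρ ^ 2 - ρ₀ ^ 2) := by ring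
    _ = t ^ 2 / 2 * (ρ ^ 2 - ρ₀ ^ 2) := by rw [sq_abs]

theorem tendsto_slope_sq {f : ℝ → ℝ} {f' ρ₀ : ℝ} (h0 : 0 < ρ₀) (hf : HasDerivAt f f' ρ₀) :
    Tendsto (fun ρ => (f ρ - f ρ₀) / (ρ ^ 2 - ρ₀ ^ 2)) (𝓝[>] ρ₀) (𝓝 (f' / (2 * ρ₀))) := by
  have h1 : Tendsto (slope f ρ₀) (𝓝[>] ρ₀) (𝓝 f') :=
    (hasDerivAt_iff_tendsto_slope.1 hf).mono_left
      (nhdsWithin_mono _ fun x hx => (ne_of_gt hx : x ≠ ρ₀))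
  have h2 : Tendsto (fun ρ : ℝ => ρ + ρ₀) (𝓝[>] ρ₀) (𝓝 (2 * ρ₀)) := by
    have : Continuous fun ρ : ℝ => ρ + ρ₀ := by fun_prop
    have h := (this.tendsto ρ₀).mono_left (nhdsWithin_le_nhds (s := Ioi ρ₀))
    rwa [← two_mul] at h
  refine (h1.div h2 (by positivity)).congr' ?_
  filter_upwards [self_mem_nhdsWithin] with ρ hρ
  have hρ' : ρ₀ < ρ := hρ
  simp only [Pi.div_apply]
  rw [slope_def_field, div_div]
  congr 1; ring

theorem tendsto_cosSlope {ρ₀ : ℝ} (h0 : 0 < ρ₀) (t : ℝ) :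
    Tendsto (fun ρ => cosSlope ρ₀ ρ t) (𝓝[>] ρ₀) (𝓝 (-(t * sin (ρ₀ * t)) / (2 * ρ₀))) := by
  refine tendsto_slope_sq h0 (f := fun ρ => cos (ρ * t)) ?_
  have := ((hasDerivAt_id ρ₀).mul_const t).cos
  refine this.congr_deriv ?_
  simp; ring

theorem tendsto_sin_div (t : ℝ) : Tendsto (fun ρ => sin (ρ * t) / ρ) (𝓝[>] 0) (𝓝 t) := by
  have hd : HasDerivAt (fun ρ : ℝ => sin (ρ * t)) t 0 := by
    have := ((hasDerivAt_id (0 : ℝ)).mul_const t).sin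
    refine this.congr_deriv ?_
    simp
  have h1 : Tendsto (slope (fun ρ : ℝ => sin (ρ * t)) 0) (𝓝[>] 0) (𝓝 t) :=
    (hasDerivAt_iff_tendsto_slope.1 hd).mono_left
      (nhdsWithin_mono _ fun x hx => (ne_of_gt hx : x ≠ 0))
  refine h1.congr fun ρ => ?_
  rw [slope_def_field]; simp

theorem tendsto_cosSlope_zero (t : ℝ) :
    Tendsto (fun ρ => cosSlope 0 ρ t) (𝓝[>] 0) (𝓝 (-(t ^ 2 / 2))) := by
  have h := (((tendsto_sin_div (t / 2)).pow 2).const_mul (-2))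
  have e : -2 * (t / 2) ^ 2 = -(t ^ 2 / 2) := by ring
  rw [e] at h
  refine h.congr' ?_
  filter_upwards [self_mem_nhdsWithin] with ρ hρ
  have hρ' : (0 : ℝ) < ρ := hρ
  rw [cosSlope, Real.cos_sub_cos, zero_mul, add_zero, sub_zero, mul_div_assoc]
  field_simp
  ring

/-- The relation `φ(ρ₀, π) dΔ/dλ(λ₀) = -α₀` between the derivative of the characteristic function
with respect to `λ = ρ²` and the norming constant. The limit of the divided difference of
`ρ sin ρπ` and of `cos ρt` is left as a parameter in order to treat `ρ₀ = 0` simultaneously. -/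
theorem norming_eq_of_tendsto (hq : Integrable q) (hq2 : Integrable fun t => q t ^ 2)
    (hsupp : ∀ x ∉ Ioo 0 π, q x = 0) (hqm : MemLp q 2 (volume.restrict (Ioo (0 : ℝ) π)))
    (hG : Continuous fun p : ℝ × ℝ => G p.1 p.2) (hC0 : 0 ≤ C) (hC : ∀ s τ, |G s τ| ≤ C)
    (hGe : ∀ x ∈ Icc 0 π, ∀ t ∈ Icc 0 π, G x t = goursatFree q h x t + goursatOp q G x t)
    {ρ₀ : ℝ} (hρ₀ : 0 ≤ ρ₀) {φ dφ : ℝ → ℝ} (hφ : SLEigenfunction ℝ q h H (ρ₀ ^ 2) φ dφ)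
    (hφ' : SLPhi ℝ q h (ρ₀ ^ 2) φ dφ) {F : ℝ → ℝ}
    (hF : F = fun t => goursatDx q G t + H * G π t) {ℓ : ℝ} {L : ℝ → ℝ}
    (hL : ∀ t, Tendsto (fun ρ => cosSlope ρ₀ ρ t) (𝓝[>] ρ₀) (𝓝 (L t)))
    (hℓ : Tendsto (fun ρ => (ρ * sin (ρ * π) - ρ₀ * sin (ρ₀ * π)) / (ρ ^ 2 - ρ₀ ^ 2))
      (𝓝[>] ρ₀) (𝓝 ℓ)) :
    slCharFun (slOmega q h H) F ρ₀ = 0 ∧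
    slNorming φ = φ π * (ℓ - slOmega q h H * L π - ∫ t in (0 : ℝ)..π, F t * L t) := by
  set ω := slOmega q h H
  have hGc : Continuous (G π) := hG.comp (by fun_prop : Continuous fun t : ℝ => (π, t))
  have hFi : IntervalIntegrable F volume 0 π := by
    rw [hF]
    exact (intervalIntegrable_goursatDx hq hq2 hG hC0 hC).add
      ((by fun_prop : Continuous fun t => H * G π t).intervalIntegrable _ _)
  have hne := hφ.apply_pi_ne_zero hqm
  have hbc : dφ π = -(H * φ π) := by have := hφ.bc_pi; simp at this; linarith
  -- Green's formula for the solutions with parameters `ρ` and `ρ₀`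
  have hgreen : ∀ ρ : ℝ, φ π * slCharFun ω F ρ =
      -((ρ ^ 2 - ρ₀ ^ 2) * ∫ x in (0 : ℝ)..π, transmutedCosReal G ρ x * φ x) := fun ρ => by
    obtain ⟨dy, hy, hd⟩ := exists_slPhi_transmutedCosReal hq hq2 hsupp hqm hG hC0 hC hGe H ρ
    rw [← hy.green hqm hφ', hF, ← hd, hbc]
    ring
  have hzero : slCharFun ω F ρ₀ = 0 := by
    have := hgreen ρ₀
    rw [sub_self, zero_mul, neg_zero] at this
    exact (mul_eq_zero.1 this).resolve_left hne
  refine ⟨hzero, ?_⟩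
  have hφe : ∀ x ∈ Icc 0 π, φ x = transmutedCosReal G ρ₀ x := fun x hx => by
    obtain ⟨dy, hy, -⟩ := exists_slPhi_transmutedCosReal hq hq2 hsupp hqm hG hC0 hC hGe H ρ₀
    exact (hφ'.eq hqm hy hx).1
  have hlim1 : Tendsto (fun ρ => -∫ x in (0 : ℝ)..π, transmutedCosReal G ρ x * φ x)
      (𝓝[>] ρ₀) (𝓝 (-slNorming φ)) := by
    have hcont : Continuous fun ρ => ∫ x in (0 : ℝ)..π,
        transmutedCosReal G ρ x * transmutedCosReal G ρ₀ x := by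
      have hz := continuous_transmutedCosReal hG
      refine intervalIntegral.continuous_parametric_intervalIntegral_of_continuous'
        (f := fun ρ x => transmutedCosReal G ρ x * transmutedCosReal G ρ₀ x) ?_ 0 π
      exact hz.mul (hz.comp (by fun_prop : Continuous fun p : ℝ × ℝ => (ρ₀, p.2)))
    have e : ∀ ρ, ∫ x in (0 : ℝ)..π, transmutedCosReal G ρ x * φ x =
        ∫ x in (0 : ℝ)..π, transmutedCosReal G ρ x * transmutedCosReal G ρ₀ x := fun ρ => by
      refine intervalIntegral.integral_congr fun x hx => ?_
      rw [uIcc_of_le pi_pos.le] at hx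
      simp only [hφe x hx]
    have e0 : slNorming φ = ∫ x in (0 : ℝ)..π,
        transmutedCosReal G ρ₀ x * transmutedCosReal G ρ₀ x := by
      refine intervalIntegral.integral_congr fun x hx => ?_
      rw [uIcc_of_le pi_pos.le] at hx
      simp only [hφe x hx]
      ring
    simp only [e]
    rw [e0]
    exact ((hcont.tendsto ρ₀).mono_left nhdsWithin_le_nhds).neg
  have hlimF : Tendsto (fun ρ => ∫ t in (0 : ℝ)..π, F t * cosSlope ρ₀ ρ t) (𝓝[>] ρ₀)
      (𝓝 (∫ t in (0 : ℝ)..π, F t * L t)) := by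
    refine intervalIntegral.tendsto_integral_filter_of_dominated_convergence
      (fun t => ‖F t‖ * (t ^ 2 / 2)) ?_ ?_ (hFi.norm.mul_continuousOn (by fun_prop))
      (Eventually.of_forall fun t _ => (hL t).const_mul _)
    · refine Eventually.of_forall fun ρ => hFi.def'.aestronglyMeasurable.mul ?_
      unfold cosSlope
      exact (by fun_prop : Continuous fun t => (cos (ρ * t) - cos (ρ₀ * t)) /
        (ρ ^ 2 - ρ₀ ^ 2)).aestronglyMeasurable
    · filter_upwards [self_mem_nhdsWithin] with ρ hρ
      refine Eventually.of_forall fun t _ => ?_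
      rw [norm_mul]
      gcongr
      exact abs_cosSlope_le hρ₀ hρ t
  have hlim2 := (((hℓ.neg).add ((hL π).const_mul ω)).add hlimF).const_mul (φ π)
  have heq : (fun ρ => -∫ x in (0 : ℝ)..π, transmutedCosReal G ρ x * φ x) =ᶠ[𝓝[>] ρ₀]
      fun ρ => φ π * (-((ρ * sin (ρ * π) - ρ₀ * sin (ρ₀ * π)) / (ρ ^ 2 - ρ₀ ^ 2)) +
        ω * cosSlope ρ₀ ρ π + ∫ t in (0 : ℝ)..π, F t * cosSlope ρ₀ ρ t) := by
    filter_upwards [self_mem_nhdsWithin] with ρ hρ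
    have hρ' : ρ₀ < ρ := hρ
    have hpos : ρ ^ 2 - ρ₀ ^ 2 ≠ 0 := by nlinarith
    have h1 := hgreen ρ
    have h2 : ∫ t in (0 : ℝ)..π, F t * cosSlope ρ₀ ρ t =
        ((∫ t in (0 : ℝ)..π, F t * cos (ρ * t)) - ∫ t in (0 : ℝ)..π, F t * cos (ρ₀ * t)) /
          (ρ ^ 2 - ρ₀ ^ 2) := by
      rw [← intervalIntegral.integral_sub (hFi.mul_continuousOn (by fun_prop))
        (hFi.mul_continuousOn (by fun_prop)), ← intervalIntegral.integral_div]
      congr 1; ext t; rw [cosSlope]; ring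
    have h3 : slCharFun ω F ρ = slCharFun ω F ρ - slCharFun ω F ρ₀ := by rw [hzero, sub_zero]
    rw [h3, slCharFun, slCharFun] at h1
    rw [h2, cosSlope]
    field_simp
    simp only [mul_comm π ρ₀]
    linear_combination -h1
  have := tendsto_nhds_unique (hlim1.congr' heq) hlim2
  linear_combination -this

end Characteristic

/-! ### The norming constants through the kernel -/

section NormingConstants

open Filter Topology

variable {q : ℝ → ℝ} {h H : ℝ} {G : ℝ → ℝ → ℝ} {C : ℝ}

/-- The case `ρ₀ > 0` of `norming_eq_of_tendsto`. -/
theorem norming_eq_of_pos (hq : Integrable q) (hq2 : Integrable fun t => q t ^ 2)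
    (hsupp : ∀ x ∉ Ioo 0 π, q x = 0) (hqm : MemLp q 2 (volume.restrict (Ioo (0 : ℝ) π)))
    (hG : Continuous fun p : ℝ × ℝ => G p.1 p.2) (hC0 : 0 ≤ C) (hC : ∀ s τ, |G s τ| ≤ C)
    (hGe : ∀ x ∈ Icc 0 π, ∀ t ∈ Icc 0 π, G x t = goursatFree q h x t + goursatOp q G x t)
    {ρ₀ : ℝ} (hρ₀ : 0 < ρ₀) {φ dφ : ℝ → ℝ} (hφ : SLEigenfunction ℝ q h H (ρ₀ ^ 2) φ dφ)
    (hφ' : SLPhi ℝ q h (ρ₀ ^ 2) φ dφ) :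
    2 * ρ₀ * slNorming φ = φ π * ((1 + π * slOmega q h H) * sin (ρ₀ * π) + π * ρ₀ * cos (ρ₀ * π) +
      ∫ t in (0 : ℝ)..π, (goursatDx q G t + H * G π t) * (t * sin (ρ₀ * t))) := by
  have hℓ := tendsto_slope_sq hρ₀ (f := fun ρ => ρ * sin (ρ * π))
    ((hasDerivAt_id ρ₀).mul ((hasDerivAt_id ρ₀).mul_const π).sin)
  have hn := (norming_eq_of_tendsto hq hq2 hsupp hqm hG hC0 hC hGe hρ₀.le hφ hφ' rfl
    (tendsto_cosSlope hρ₀) hℓ).2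
  have e : ∀ t, (goursatDx q G t + H * G π t) * (-(t * sin (ρ₀ * t)) / (2 * ρ₀)) =
      (-1 / (2 * ρ₀)) * ((goursatDx q G t + H * G π t) * (t * sin (ρ₀ * t))) := fun t => by ring
  simp only [e] at hn
  rw [hn, intervalIntegral.integral_const_mul]
  simp only [id_eq, one_mul]
  field_simp
  ring

/-- The case `ρ₀ = 0` of `norming_eq_of_tendsto`, where the vanishing of the characteristic function
at `0` expresses the integral of `F` through `ω`. -/
theorem norming_eq_of_zero (hq : Integrable q) (hq2 : Integrable fun t => q t ^ 2)
    (hsupp : ∀ x ∉ Ioo 0 π, q x = 0) (hqm : MemLp q 2 (volume.restrict (Ioo (0 : ℝ) π)))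
    (hG : Continuous fun p : ℝ × ℝ => G p.1 p.2) (hC0 : 0 ≤ C) (hC : ∀ s τ, |G s τ| ≤ C)
    (hGe : ∀ x ∈ Icc 0 π, ∀ t ∈ Icc 0 π, G x t = goursatFree q h x t + goursatOp q G x t)
    {φ dφ : ℝ → ℝ} (hφ : SLEigenfunction ℝ q h H 0 φ dφ) (hφ' : SLPhi ℝ q h 0 φ dφ) :
    slNorming φ = φ π * (π + slOmega q h H * (π ^ 2 / 3) + π ^ 2 / 3 *
      ∫ t in (0 : ℝ)..π, (goursatDx q G t + H * G π t) * (legendreP (2 * 1)).eval (t / π)) := by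
  set F := fun t => goursatDx q G t + H * G π t with hF
  have hGc : Continuous (G π) := hG.comp (by fun_prop : Continuous fun t : ℝ => (π, t))
  have hFi : IntervalIntegrable F volume 0 π :=
    (intervalIntegrable_goursatDx hq hq2 hG hC0 hC).add
      ((by fun_prop : Continuous fun t => H * G π t).intervalIntegrable _ _)
  have h0 : (0 : ℝ) = 0 ^ 2 := by norm_num
  have hℓ : Tendsto (fun ρ : ℝ => (ρ * sin (ρ * π) - 0 * sin (0 * π)) / (ρ ^ 2 - 0 ^ 2))
      (𝓝[>] 0) (𝓝 π) := by
    refine (tendsto_sin_div π).congr' ?_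
    filter_upwards [self_mem_nhdsWithin] with ρ hρ
    have hρ' : ρ ≠ 0 := (show (0 : ℝ) < ρ from hρ).ne'
    field_simp
    ring
  obtain ⟨hz, hn⟩ := norming_eq_of_tendsto hq hq2 hsupp hqm hG hC0 hC hGe le_rfl
    (by rwa [← h0]) (by rwa [← h0]) hF tendsto_cosSlope_zero hℓ
  have hz' : slOmega q h H + ∫ t in (0 : ℝ)..π, F t = 0 := by simpa [slCharFun] using hz
  have hP : ∀ u : ℝ, (legendreP (2 * 1)).eval u = (3 * u ^ 2 - 1) / 2 := fun u => by
    simp [legendreP, Polynomial.derivative_pow]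
    ring
  -- `t² = (π² / 3) (2 P₂(t / π) + 1)`
  have e : ∀ t, F t * -(t ^ 2 / 2) = -(π ^ 2 / 3) * (F t * (legendreP (2 * 1)).eval (t / π)) -
      π ^ 2 / 6 * F t := fun t => by
    rw [hP]; field_simp; ring
  rw [hn]
  simp only [e]
  rw [intervalIntegral.integral_sub ((hFi.mul_continuousOn (by fun_prop)).const_mul _)
    (hFi.const_mul _), intervalIntegral.integral_const_mul, intervalIntegral.integral_const_mul]
  linear_combination φ π * (π ^ 2 / 6) * hz'

end NormingConstants

/-! ### Arbitrary kernels and potentials -/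

section Kernel

variable {q q' : ℝ → ℝ} {h H : ℝ} {G : ℝ → ℝ → ℝ} {C : ℝ}

theorem SLPhi.congr_potential {𝕜 : Type} [RCLike 𝕜] {μ : 𝕜} {y dy : ℝ → 𝕜}
    (hqq : EqOn q q' (Ioo 0 π)) (S : SLPhi 𝕜 q h μ y dy) : SLPhi 𝕜 q' h μ y dy where
  toSLSolution := S.toSLSolution.congr_potential hqq
  init := S.init
  init_deriv := S.init_deriv

theorem SLEigenfunction.congr_potential {𝕜 : Type} [RCLike 𝕜] {μ : 𝕜} {y dy : ℝ → 𝕜}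
    (hqq : EqOn q q' (Ioo 0 π)) (S : SLEigenfunction 𝕜 q h H μ y dy) :
    SLEigenfunction 𝕜 q' h H μ y dy where
  toSLSolution := S.toSLSolution.congr_potential hqq
  bc_zero := S.bc_zero
  bc_pi := S.bc_pi
  nontrivial := S.nontrivial

theorem IsTransmutationKernel.congr_potential (hqq : EqOn q q' (Ioo 0 π))
    (K : IsTransmutationKernel q h G) : IsTransmutationKernel q' h G where
  continuousOn := K.continuousOn
  transmutes ρ y dy S := K.transmutes ρ y dy (S.congr_potential hqq.symm)

theorem slOmega_congr (hqq : EqOn q q' (Ioo 0 π)) : slOmega q h H = slOmega q' h H := by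
  rw [slOmega, slOmega, intervalIntegral.integral_of_le pi_pos.le,
    intervalIntegral.integral_of_le pi_pos.le, integral_Ioc_eq_integral_Ioo,
    integral_Ioc_eq_integral_Ioo, setIntegral_congr_fun measurableSet_Ioo hqq]

/-- A continuous bounded solution of the Goursat integral equation is a transmutation kernel. -/
theorem isTransmutationKernel_of_goursat (hq : Integrable q)
    (hsupp : ∀ x ∉ Ioo 0 π, q x = 0) (hqm : MemLp q 2 (volume.restrict (Ioo (0 : ℝ) π)))
    (hG : Continuous fun p : ℝ × ℝ => G p.1 p.2) (hC0 : 0 ≤ C) (hC : ∀ s τ, |G s τ| ≤ C)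
    (hGe : ∀ x ∈ Icc 0 π, ∀ t ∈ Icc 0 π, G x t = goursatFree q h x t + goursatOp q G x t) :
    IsTransmutationKernel q h G where
  continuousOn := hG.continuousOn
  transmutes ρ y dy S x hx := by
    obtain ⟨dZ, hZ, -⟩ := exists_slPhi_transmutedCos hq hsupp hG hC0 hC hGe ρ
    exact (S.eq hqm hZ hx).1

/-- The left derivative at `x = π` of a kernel `K` that agrees on the triangle with the solution
`G` of the Goursat integral equation, as every transmutation kernel does by uniqueness. -/
theorem ae_hasDerivWithinAt_of_eq_goursat {K : ℝ → ℝ → ℝ} (hq : Integrable q)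
    (hsupp : ∀ x ∉ Ioo 0 π, q x = 0)
    (hG : Continuous fun p : ℝ × ℝ => G p.1 p.2) (hC0 : 0 ≤ C) (hC : ∀ s τ, |G s τ| ≤ C)
    (hGe : ∀ x ∈ Icc 0 π, ∀ t ∈ Icc 0 π, G x t = goursatFree q h x t + goursatOp q G x t)
    (hKG : ∀ x t, 0 < x → x ≤ π → t ∈ Icc 0 x → K x t = G x t) :
    ∀ᵐ t ∂(volume.restrict (Ioo (0 : ℝ) π)),
      HasDerivWithinAt (fun s => K s t) (goursatDx q G t) (Icc t π) π := by
  filter_upwards [ae_hasDerivWithinAt_goursat hq hsupp hG hC0 hC hGe,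
    ae_restrict_mem measurableSet_Ioo] with t hd ht
  exact hd.congr_of_mem (fun x hx => hKG x t (ht.1.trans_le hx.1) hx.2 ⟨ht.1.le, hx.1⟩)
    ⟨ht.2.le, le_rfl⟩

theorem kernelDx_ae_eq {K : ℝ → ℝ → ℝ} {g : ℝ → ℝ}
    (hd : ∀ᵐ t ∂(volume.restrict (Ioo (0 : ℝ) π)),
      HasDerivWithinAt (fun s => K s t) (g t) (Icc t π) π) :
    (fun t => kernelDx K π t) =ᵐ[volume.restrict (Ioo (0 : ℝ) π)] g := by
  filter_upwards [hd, ae_restrict_mem measurableSet_Ioo] with t h1 ht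
  exact h1.derivWithin (uniqueDiffOn_Icc ht.2 π ⟨ht.2.le, le_rfl⟩)

/-- The numbers `hₖ` as Legendre coefficients of `g + H f`, for `g` and `f` representing
`K_x(π, ·)` and `K(π, ·)`. -/
theorem slCoeffH_eq {K : ℝ → ℝ → ℝ} {g f : ℝ → ℝ} (hgi : IntervalIntegrable g volume 0 π)
    (hf : Continuous f)
    (hg : (fun t => kernelDx K π t) =ᵐ[volume.restrict (Ioo (0 : ℝ) π)] g)
    (hKf : ∀ t ∈ Icc 0 π, K π t = f t) (k : ℕ) :
    slCoeffH K H k =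
      (4 * k + 1) * ∫ t in (0 : ℝ)..π, (g t + H * f t) * (legendreP (2 * k)).eval (t / π) := by
  have hp : Continuous fun t : ℝ => (legendreP (2 * k)).eval (t / π) := by fun_prop
  have e1 : ∫ t in (0 : ℝ)..π, kernelDx K π t * (legendreP (2 * k)).eval (t / π) =
      ∫ t in (0 : ℝ)..π, g t * (legendreP (2 * k)).eval (t / π) := by
    rw [intervalIntegral.integral_of_le pi_pos.le, intervalIntegral.integral_of_le pi_pos.le,
      integral_Ioc_eq_integral_Ioo, integral_Ioc_eq_integral_Ioo]
    refine integral_congr_ae ?_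
    filter_upwards [hg] with t ht
    rw [ht]
  have e2 : ∫ t in (0 : ℝ)..π, K π t * (legendreP (2 * k)).eval (t / π) =
      ∫ t in (0 : ℝ)..π, f t * (legendreP (2 * k)).eval (t / π) := by
    refine intervalIntegral.integral_congr fun t ht => ?_
    rw [uIcc_of_le pi_pos.le] at ht
    simp only [hKf t ht]
  have e3 : ∀ t, (g t + H * f t) * (legendreP (2 * k)).eval (t / π) =
      g t * (legendreP (2 * k)).eval (t / π) + H * (f t * (legendreP (2 * k)).eval (t / π)) :=
    fun t => by ring
  simp only [e3]
  rw [slCoeffH, kernelDxCoeff, kernelCoeff, e1, e2, intervalIntegral.integral_add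
    (hgi.mul_continuousOn hp.continuousOn)
    ((by fun_prop : Continuous fun t => H * (f t * (legendreP (2 * k)).eval (t / π)))
      |>.intervalIntegrable _ _), intervalIntegral.integral_const_mul]
  ring

/-- Expansion of the integral of `F(t) t sin ρt` in the Legendre coefficients of `F`. -/
theorem hasSum_flipTerm {K : ℝ → ℝ → ℝ} {F : ℝ → ℝ} {ρ : ℝ}
    (hF : MemLp F 2 (volume.restrict (Ioo (0 : ℝ) π)))
    (hK : ∀ k : ℕ, slCoeffH K H k =
      (4 * k + 1) * ∫ t in (0 : ℝ)..π, F t * (legendreP (2 * k)).eval (t / π)) (hρ : 0 < ρ) :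
    HasSum (flipTerm K H ρ) (∫ t in (0 : ℝ)..π, F t * (t * sin (ρ * t))) := by
  refine (hasSum_legendre hF (memLp_of_continuous
    (by fun_prop : Continuous fun t => t * sin (ρ * t)))).congr_fun fun k => ?_
  rw [integral_legendreP_div_pi_mul_sin k hρ, flipTerm, hK]
  field_simp

end Kernel

theorem mainTheorem4
    (q : ℝ → ℝ) (hq : MemLp q 2 (volume.restrict (Ioo (0 : ℝ) π))) (h H : ℝ)
    -- the spectrum, in increasing order
    (lam : ℕ → ℝ) (hlam_mono : StrictMono lam)
    (hlam : range (fun n => (lam n : ℂ)) = slSpectrum q h H)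
    -- the normalized eigenfunctions `φ(ρₙ, ·)`, with `ρₙ² = lam n`
    (φ dφ : ℕ → ℝ → ℝ) (hφ : ∀ n, SLPhi ℝ q h (lam n) (φ n) (dφ n))
    -- the normalized eigenfunctions of the flipped problem
    (ψ dψ : ℕ → ℝ → ℝ) (hψ : ∀ n, SLPhi ℝ (slFlip q) H (lam n) (ψ n) (dψ n)) :
    -- the flipped problem has the same spectrum
    slSpectrum (slFlip q) H h = slSpectrum q h H ∧
    -- flipping an eigenfunction gives an eigenfunction of the flipped problem
    (∀ n, SLEigenfunction ℝ (slFlip q) H h (lam n)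
      (fun x => φ n (π - x)) (fun x => -dφ n (π - x))) ∧
    -- the norming constants of the flipped problem
    (∀ n, 0 < slNorming (φ n) ∧ φ n π ≠ 0 ∧ slNorming (ψ n) = slNorming (φ n) / φ n π ^ 2) ∧
    -- the transmutation kernel exists
    (∃ G, IsTransmutationKernel q h G) ∧
    ∀ G, IsTransmutationKernel q h G →
      -- the numbers `h_k` are well defined
      (∀ᵐ t ∂(volume.restrict (Ioo (0 : ℝ) π)),
        DifferentiableWithinAt ℝ (fun s => G s t) (Icc t π) π) ∧
      MemLp (fun t => kernelDx G π t) 2 (volume.restrict (Ioo (0 : ℝ) π)) ∧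
      -- the closed formula for positive eigenvalues
      (∀ n, 0 < lam n →
        Summable (flipTerm G H √(lam n)) ∧
        slNorming (ψ n) =
          ((1 + π * slOmega q h H) * sin (√(lam n) * π) + π * √(lam n) * cos (√(lam n) * π)
            + ∑' k, flipTerm G H √(lam n) k) ^ 2
          / (4 * slNorming (φ n) * √(lam n) ^ 2)) ∧
      -- the closed formula for the eigenvalue `ρ₀ = 0`
      (lam 0 = 0 →
        slNorming (ψ 0) =
          (π + slOmega q h H * (π ^ 2 / 3) + slCoeffH G H 1 * (π ^ 2 / 15)) ^ 2
            / slNorming (φ 0)) := by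
  -- the values of `q` outside `(0, π)` are irrelevant; extend it by zero
  set q₀ := (Ioo (0 : ℝ) π).indicator q with hq₀
  have hqq : EqOn q q₀ (Ioo 0 π) := fun x hx => (indicator_of_mem hx q).symm
  have hm : MemLp q₀ 2 volume := (memLp_indicator_iff_restrict measurableSet_Ioo).2 hq
  have hqm : MemLp q₀ 2 (volume.restrict (Ioo (0 : ℝ) π)) := hm.restrict _
  have hsupp : ∀ x ∉ Ioo 0 π, q₀ x = 0 := fun x hx => indicator_of_notMem hx q
  have hqi : Integrable q₀ :=
    (integrable_indicator_iff measurableSet_Ioo).2 (hq.integrable (by norm_num))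
  have hq2 : Integrable fun t => q₀ t ^ 2 := hm.integrable_sq
  have hmem : ∀ n, ((lam n : ℝ) : ℂ) ∈ slSpectrum q h H := fun n => hlam ▸ mem_range_self n
  have heig : ∀ n, SLEigenfunction ℝ q h H (lam n) (φ n) (dφ n) :=
    fun n => (hφ n).eigenfunction hq (hmem n)
  have hpos : ∀ n, 0 < slNorming (φ n) := fun n => (hφ n).norming_pos
  have hne : ∀ n, φ n π ≠ 0 := fun n => (heig n).apply_pi_ne_zero hq
  have hflip : ∀ n, slNorming (ψ n) = slNorming (φ n) / φ n π ^ 2 :=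
    fun n => slNorming_flip hq (heig n) (hψ n)
  obtain ⟨G, hG, ⟨C, hC0, hC⟩, hGe⟩ := exists_goursat_solution hqi hq2 hsupp h
  have hker := isTransmutationKernel_of_goursat hqi hsupp hqm hG hC0 hC hGe
  refine ⟨slSpectrum_flip hq, fun n => (heig n).flip hq, fun n => ⟨hpos n, hne n, hflip n⟩,
    ⟨G, hker.congr_potential hqq.symm⟩, fun K hK => ?_⟩
  have hKG : ∀ x t, 0 < x → x ≤ π → t ∈ Icc 0 x → K x t = G x t := fun x t hx0 hxπ ht =>
    (hK.congr_potential hqq).eq hker (fun ρ => by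
      obtain ⟨dZ, hZ, -⟩ := exists_slPhi_transmutedCos hqi hsupp hG hC0 hC hGe ρ
      exact ⟨_, dZ, hZ⟩) hx0 hxπ ht
  have hd := ae_hasDerivWithinAt_of_eq_goursat hqi hsupp hG hC0 hC hGe hKG
  have hdx := kernelDx_ae_eq hd
  have hg2 := memLp_goursatDx hqi hq2 hG hC0 hC
  have hGc : Continuous (G π) := hG.comp (by fun_prop : Continuous fun t : ℝ => (π, t))
  have hcoeff := slCoeffH_eq (H := H) (intervalIntegrable_goursatDx hqi hq2 hG hC0 hC) hGc hdx
    (fun t ht => hKG π t pi_pos le_rfl ht)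
  have hF : MemLp (fun t => goursatDx q₀ G t + H * G π t) 2
      (volume.restrict (Ioo (0 : ℝ) π)) :=
    hg2.add (memLp_of_continuous (by fun_prop : Continuous fun t => H * G π t))
  refine ⟨hd.mono fun t ht => ht.differentiableWithinAt, (memLp_congr_ae hdx).2 hg2,
    fun n hn => ?_, fun h0 => ?_⟩
  · have hρ : 0 < √(lam n) := Real.sqrt_pos.2 hn
    have hsq : √(lam n) ^ 2 = lam n := Real.sq_sqrt hn.le
    have hsum := hasSum_flipTerm hF hcoeff hρ
    have hmain := norming_eq_of_pos hqi hq2 hsupp hqm hG hC0 hC hGe hρ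
      (by rw [hsq]; exact (heig n).congr_potential hqq)
      (by rw [hsq]; exact (hφ n).congr_potential hqq)
    refine ⟨hsum.summable, ?_⟩
    rw [hsum.tsum_eq, slOmega_congr hqq, hflip n]
    set N := (1 + π * slOmega q₀ h H) * sin (√(lam n) * π) + π * √(lam n) * cos (√(lam n) * π) +
      ∫ t in (0 : ℝ)..π, (goursatDx q₀ G t + H * G π t) * (t * sin (√(lam n) * t))
    have hα := hpos n
    have hφπ := hne n
    rw [div_eq_div_iff (by positivity) (by positivity)]
    -- after clearing denominators, the claim is the square of `hmain`
    linear_combination (2 * √(lam n) * slNorming (φ n) + φ n π * N) * hmain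
  · have hmain := norming_eq_of_zero hqi hq2 hsupp hqm hG hC0 hC hGe
      (by rw [← h0]; exact (heig 0).congr_potential hqq)
      (by rw [← h0]; exact (hφ 0).congr_potential hqq)
    have hα := hpos 0
    have hφπ := hne 0
    have e : slCoeffH K H 1 * (π ^ 2 / 15) = π ^ 2 / 3 * ∫ t in (0 : ℝ)..π,
        (goursatDx q₀ G t + H * G π t) * (legendreP (2 * 1)).eval (t / π) := by
      rw [hcoeff 1]; push_cast; ring
    rw [slOmega_congr hqq, e, hflip 0]
    set N := π + slOmega q₀ h H * (π ^ 2 / 3) + π ^ 2 / 3 * ∫ t in (0 : ℝ)..π,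
      (goursatDx q₀ G t + H * G π t) * (legendreP (2 * 1)).eval (t / π)
    rw [div_eq_div_iff (by positivity) (by positivity)]
    linear_combination (slNorming (φ 0) + φ 0 π * N) * hmain
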